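/- Let $0<\alpha<1$ and $\gamma=(1-\alpha)/\alpha$. Let $\mathbf S=(s_{ij})\in\mathbb R^{N\times M}$ have i.i.d. entries with the symmetric $\alpha$-stable law $S(\alpha,1)$, that is, $E\,e^{\sqrt{-1}\,t s_{ij}}=e^{-|t|^\alpha}$ for all real $t$. Let $\mathbf x\in\mathbb R^N$ be fixed, $y_j=\sum_{t=1}^N x_t s_{tj}$, and $\theta=\big(\sum_{t=1}^N|x_t|^\alpha\big)^{1/\alpha}$. Fix a coordinate $i$, put $z_{i,j}=y_j/s_{ij}$ $(1\le j\le M)$, and let $z_{i,(1)}\le\dots\le z_{i,(M)}$ be the sorted values. The gap estimator of $x_i$ is $$\hat x_{i,gap}=\tfrac12\big\{z_{i,(j_i)}+z_{i,(j_i+1)}\big\},\qquad j_i=\operatorname*{argmin}_{1\le j\le M-1}\{z_{i,(j+1)}-z_{i,(j)}\}$$ (ties in the argmin may be broken in any way). For an integer $k\ge 1$ let $$\eta_{k,\gamma,2}=\min\Big\{u\in(0,1):\ 2\Big(1-\big(\tfrac{u}{2k}\big)^{1/k}\Big)^{\gamma}+\Big(1-\tfrac{u}{2k}\Big)^{\gamma}\le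 1\Big\},$$ with $\eta_{k,\gamma,2}=\infty$ if there is no such $u$. Let $0<\epsilon\le\theta$. Call a pair $(a_0,k_0)$, with $a_0>1$ real and $k_0\ge 2$ an integer, admissible if $a_0k_0<M$ and $$\theta\left(\frac{a_0k_0}{M-a_0k_0}\right)^{\gamma}\le\epsilon;$$ equivalently, $a_0k_0\le M/K^*$, where $K^*=(\epsilon/\theta)^{-\alpha/(1-\alpha)}+1$. Suppose that an admissible pair exists. Then $$\Pr\big(|\hat x_{i,gap}-x_i|>\epsilon\big)\ \le\ \min_{(a_0,k_0)}\left\{\Pr\big(\mathrm{Binomial}(M,a_0k_0/M)<k_0\big)+\sum_{k=k_0}^{M-2}\Big(1+\frac1{2k}\Big)\eta_{k,\gamma,2}\right\},$$ where the minimum is over all admissible pairs $(a_0,k_0)$, and it is attained. -/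

import Mathlib

open MeasureTheory ProbabilityTheory Set
open scoped ENNReal

namespace GapEstimator

noncomputable section

/-- `μ` is the standard symmetric `α`-stable law `S(α, 1)`: the probability measure on the real line
whose characteristic function is `t ↦ exp (-|t| ^ α)`. -/
structure IsStandardStable (α : ℝ) (μ : Measure ℝ) : Prop where
  isProbabilityMeasure : IsProbabilityMeasure μ
  charFun_eq : ∀ t : ℝ, charFun μ t = Complex.exp (-((|t| ^ α : ℝ) : ℂ))

/-- The entries of the random `N × M` matrix `S` are i.i.d. with law `S(α, 1)`. -/
structure IsStableDesign {Ω : Type*} [MeasurableSpace Ω] (P : Measure Ω) {N M : ℕ} (α : ℝ)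
    (S : Fin N → Fin M → Ω → ℝ) : Prop where
  aemeasurable : ∀ i j, AEMeasurable (S i j) P
  iIndepFun : iIndepFun (fun p : Fin N × Fin M => S p.1 p.2) P
  law : ∀ i j, IsStandardStable α (P.map (S i j))

/-- The `j`-th linear measurement `y_j = ∑ i, x_i s_{ij}`. -/
def measurement {Ω : Type*} {N M : ℕ} (S : Fin N → Fin M → Ω → ℝ) (x : Fin N → ℝ)
    (j : Fin M) (ω : Ω) : ℝ :=
  ∑ i, x i * S i j ω

/-- The ratio statistics `z_{i,j} = y_j / s_{ij}` of the coordinate `i`. -/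
def ratioStat {Ω : Type*} {N M : ℕ} (S : Fin N → Fin M → Ω → ℝ) (x : Fin N → ℝ)
    (i : Fin N) (ω : Ω) (j : Fin M) : ℝ :=
  measurement S x j ω / S i j ω

/-- The values of `z` in increasing order, `z_(1) ≤ ... ≤ z_(M)` (indexed from `0` here). -/
def orderStat {M : ℕ} (z : Fin M → ℝ) (j : Fin M) : ℝ :=
  z (Tuple.sort z j)

/-- `v` is a value of the gap estimator on the sample `z`: the midpoint of two neighbouring order
statistics at minimal distance. (If several gaps are minimal, each of them is allowed.) -/
def IsGapEstimate {M : ℕ} (z : Fin M → ℝ) (v : ℝ) : Prop :=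
  ∃ (j : ℕ) (hj : j + 1 < M),
    (∀ (l : ℕ) (hl : l + 1 < M),
      orderStat z ⟨j + 1, hj⟩ - orderStat z ⟨j, Nat.lt_of_succ_lt hj⟩ ≤
        orderStat z ⟨l + 1, hl⟩ - orderStat z ⟨l, Nat.lt_of_succ_lt hl⟩) ∧
    v = (orderStat z ⟨j, Nat.lt_of_succ_lt hj⟩ + orderStat z ⟨j + 1, hj⟩) / 2

/-- `θ = (∑ i, |x_i| ^ α) ^ (1 / α)`. -/
def theta {N : ℕ} (α : ℝ) (x : Fin N → ℝ) : ℝ :=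
  (∑ i, |x i| ^ α) ^ (1 / α)

/-- `γ = (1 - α) / α`. -/
def gam (α : ℝ) : ℝ := (1 - α) / α

/-- `η_{k,γ,c₀}`, the least `u ∈ (0, 1)` such that
`c₀ (1 - (u / 2k) ^ (1 / k)) ^ γ + (1 - u / 2k) ^ γ ≤ 1`, and `∞` if there is no such `u`. -/
def eta (k : ℕ) (γ c₀ : ℝ) : ℝ≥0∞ :=
  sInf (ENNReal.ofReal '' {u : ℝ | u ∈ Ioo (0 : ℝ) 1 ∧
    c₀ * (1 - (u / (2 * k)) ^ (1 / (k : ℝ))) ^ γ + (1 - u / (2 * k)) ^ γ ≤ 1})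

/-- The admissible pairs `(a₀, k₀)` of parameters of the bound. -/
structure Admissible (M : ℕ) (α ε θ a₀ : ℝ) (k₀ : ℕ) : Prop where
  one_lt : 1 < a₀
  two_le : 2 ≤ k₀
  lt : a₀ * k₀ < M
  le : θ * (a₀ * k₀ / (M - a₀ * k₀)) ^ gam α ≤ ε

/-- `K* = (ε / θ) ^ (-α / (1 - α)) + 1`. -/
def Kstar (α ε θ : ℝ) : ℝ := (ε / θ) ^ (-α / (1 - α)) + 1

/-- `B(M, q) = Pr (Binomial (M, q) < k₀)`, for `q ∈ [0, 1]`. -/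
def binomialLower (M : ℕ) (q : ℝ) (k₀ : ℕ) : ℝ≥0∞ :=
  binomial M (projIcc 0 1 zero_le_one q) (Iio k₀)

/-- The bound that belongs to the pair `(a₀, k₀)`. -/
def pairBound (M : ℕ) (α a₀ : ℝ) (k₀ : ℕ) : ℝ≥0∞ :=
  binomialLower M (a₀ * k₀ / M) k₀ +
    ∑ k ∈ Finset.Icc k₀ (M - 2), ENNReal.ofReal (1 + 1 / (2 * (k : ℝ))) * eta k (gam α) 2

/-- The bounds of all admissible pairs. -/
def boundSet (M : ℕ) (α ε θ : ℝ) : Set ℝ≥0∞ :=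
  {g | ∃ (a₀ : ℝ) (k₀ : ℕ), Admissible M α ε θ a₀ k₀ ∧ g = pairBound M α a₀ k₀}

end

end GapEstimator

/-! Since `y_j = x_i s_{ij} + (the other terms)`, the errors `D_j = |z_{i,j} - x_i|` are i.i.d.
moduli `|Y / X|` of ratios of independent symmetric stable variables, with `X` standard and `Y` of
scale parameter `κ = ∑_{t ≠ i} |x_t| ^ α ≤ θ ^ α`. The bound rests on two properties of their
distribution function `F` (`ratio_law`): `F(d) / d ^ (1/γ)` does not increase in `d > 0`, and `F(ε)
≥ 1 / K*`.

For these, write `exp (-t s²)` as a Gaussian average of characters. Frullani's integral then turns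
the stable laws into Gaussian ones: `E log (1 + l (Y/X)²) = (2/α) E log (1 + l ^ (α/2) κ |g₂/g₁| ^
α)` for `l > 0` (`lintegral_log_one_add_ratio`). Both sides are analytic in `l` on the slit plane.
Letting `l → -1` from above and taking imaginary parts recovers the law of `Y/X`: up to the factor
`β = πα/2`, `F` is a mixture of the functions `β - arg (1 + t e^{iβ})` (`ratioCdf_sandwich`). Both
properties reduce to one inequality: the logarithm of the odds `A / (β - A)` of this angle `A` has
derivative at most `1 / (1 - α)` in `log t` (`rayAngle_odds`).

The second property and admissibility give `a₀ k₀ / M ≤ 1 / K* ≤ F(ε)`, so with fewer than the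
stated binomial probability do less than `k₀` errors lie within `ε`. Suppose now that at least `k₀`
do, and that the gap estimate errs by more than `ε`. Let `i`, `i'` be the closest pair, `D_{i'} ≤
D_i`; then `D_i > ε`, and minimality of the gap gives `D_i ≤ D_{i'} + D_a + D_b` for all `a ≠ b`.
With `c` the largest error below `D_i`, this puts `D_i` in the window from `D_c` to `D_c` plus the
sum of any two errors below `D_c` in rank (`mem_someWindow_of_error`). By the first property such a
window above `y` has mass at most `F(y) / (γ y)` times its length, and the expected length is at
most that of the extremal law `F ∝ d ^ (1/γ)`. If `k` errors lie below `c`, the probability is at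
most `(k + 1) gapConst γ k` (`measure_someWindowAt_le`).

The rank of `c` is too low for the sum only when exactly `k₀` errors lie below `D_i`; then `ε`
replaces `D_c` as threshold, at the price of an additional term carrying a binomial weight of at
most `1/2` or `2/5`. It is absorbed by the slack in `(k + 1) C gapConst γ k ≤ (1 + 1/2k) η`, where
`C = 3/2` for `γ ≥ 4` and `C = 7/5` for `2 ≤ γ ≤ 4`, `k ≥ 4`. For the remaining `γ` and `k₀` the sum
of the `η` terms is at least `1` and nothing is to be proved (`one_le_sum_eta`). The minimum is
attained because for each of the finitely many possible `k₀` the largest admissible `a₀` is the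
best. -/

namespace GapEstimator

/-! ### Lower bounds for `η` and comparison with the gap constants -/

/-- `∏ j < k, (j + 1) / (γ + j + 1)`, the value of `∫ v in 0..1, (1 - v ^ (1 / γ)) ^ k`. -/
noncomputable def betaProd (γ : ℝ) (k : ℕ) : ℝ := ∏ j ∈ Finset.range k, ((j : ℝ) + 1) / (γ + j + 1)

/-- The expectation of `(U₍₁₎ ^ γ + U₍₂₎ ^ γ) / γ` for the two smallest of `k` independent uniform
variables. -/
noncomputable def gapConst (γ : ℝ) (k : ℕ) : ℝ := (γ + 2) / γ * betaProd γ k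

lemma betaProd_succ (γ : ℝ) (k : ℕ) :
    betaProd γ (k + 1) = betaProd γ k * (((k : ℝ) + 1) / (γ + k + 1)) := by
  rw [betaProd, Finset.prod_range_succ, ← betaProd]

lemma betaProd_pos {γ : ℝ} (hγ : 0 < γ) (k : ℕ) : 0 < betaProd γ k :=
  Finset.prod_pos fun j _ => by positivity

lemma gapConst_pos {γ : ℝ} (hγ : 0 < γ) (k : ℕ) : 0 < gapConst γ k :=
  mul_pos (by positivity) (betaProd_pos hγ k)

/-- The left side of the feasibility condition decreases strictly in `p` and does not increase with
the exponent. A point where it is still at least `1`, even for the larger exponent `γ₁`, is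
therefore a lower bound of every feasible `p`. Here and below `p` stands for `u / (2k)`. -/
lemma pow_le_of_feasible {γ γ₁ p q : ℝ} {k : ℕ} (hk : k ≠ 0) (hγ : 0 < γ) (hγ₁ : γ ≤ γ₁)
    (hp : 0 < p) (hq : 0 ≤ q) (hq1 : q ≤ 1)
    (h : 2 * (1 - p ^ (1 / (k : ℝ))) ^ γ + (1 - p) ^ γ ≤ 1)
    (hq' : 1 ≤ 2 * (1 - q) ^ γ₁ + (1 - q ^ k) ^ γ₁) : q ^ k ≤ p := by
  by_contra! hlt
  have hqk : q ^ k ≤ 1 := pow_le_one₀ hq hq1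
  have hr : p ^ (1 / (k : ℝ)) < q := by
    rw [one_div, ← Real.pow_rpow_inv_natCast hq hk]
    exact Real.rpow_lt_rpow hp.le hlt (by positivity)
  have e1 : (1 - q) ^ γ₁ ≤ (1 - q) ^ γ := by
    rcases eq_or_lt_of_le hq1 with rfl | h1
    · simp [hγ.ne', (hγ.trans_le hγ₁).ne']
    · exact Real.rpow_le_rpow_of_exponent_ge (by linarith) (by linarith) hγ₁
  have e2 : (1 - q ^ k) ^ γ₁ ≤ (1 - q ^ k) ^ γ := by
    rcases eq_or_lt_of_le hqk with h1 | h1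
    · simp [h1, hγ.ne', (hγ.trans_le hγ₁).ne']
    · exact Real.rpow_le_rpow_of_exponent_ge (by linarith) (by linarith [pow_nonneg hq k]) hγ₁
  have e3 : (1 - q) ^ γ < (1 - p ^ (1 / (k : ℝ))) ^ γ :=
    Real.rpow_lt_rpow (by linarith) (by linarith) hγ
  have e4 : (1 - q ^ k) ^ γ ≤ (1 - p) ^ γ :=
    Real.rpow_le_rpow (by linarith) (by linarith) hγ.le
  linarith

/-- Bernoulli's inequality `(1 - p) ^ γ ≥ 1 - γ p` turns feasibility into `2 (1 - p ^ (1/k)) ^ γ ≤ γ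
p`. The auxiliary `q` separates the two sides: if `p < p'`, then `p ^ (1/k) < q`, and the two
hypotheses on `q` contradict each other. -/
lemma le_of_feasible_of_split {γ p p' q : ℝ} {k : ℕ} (hk : k ≠ 0) (hγ : 1 ≤ γ)
    (hp : 0 < p) (hp1 : p ≤ 1) (hq : 0 ≤ q) (hq1 : q ≤ 1)
    (h : 2 * (1 - p ^ (1 / (k : ℝ))) ^ γ + (1 - p) ^ γ ≤ 1)
    (h₁ : p' ≤ q ^ k) (h₂ : γ * p' / 2 ≤ (1 - q) ^ γ) : p' ≤ p := by
  by_contra! hlt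
  have hr : p ^ (1 / (k : ℝ)) < q := by
    rw [one_div, ← Real.pow_rpow_inv_natCast hq hk]
    exact Real.rpow_lt_rpow hp.le (hlt.trans_le h₁) (by positivity)
  have e3 : (1 - q) ^ γ ≤ (1 - p ^ (1 / (k : ℝ))) ^ γ :=
    Real.rpow_le_rpow (by linarith) (by linarith) (by linarith)
  have e4 : 1 + γ * (-p) ≤ (1 + -p) ^ γ := one_add_mul_self_le_rpow_one_add (by linarith) hγ
  rw [← sub_eq_add_neg] at e4
  nlinarith

/-- Passing from `k` to `k + 1` multiplies `betaProd` by `(k + 1) / (γ + k + 1)`, while the right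
side shrinks by no more than this factor because `k / (γ + k)` increases. -/
lemma betaProd_mul_pow_antitone {γ : ℝ} (hγ : 0 < γ) {m : ℕ} (hm : 1 ≤ m) {k : ℕ} (hk : m ≤ k)
    {A : ℝ} (h : A * betaProd γ m ≤ ((m : ℝ) / (γ + m)) ^ m) :
    A * betaProd γ k ≤ ((k : ℝ) / (γ + k)) ^ k := by
  induction k, hk using Nat.le_induction with
  | base => exact h
  | succ k hk ih =>
    have hk0 : (0 : ℝ) < k := by exact_mod_cast hm.trans hk
    rw [betaProd_succ, ← mul_assoc]
    calc A * betaProd γ k * (((k : ℝ) + 1) / (γ + k + 1))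
        ≤ ((k : ℝ) / (γ + k)) ^ k * (((k : ℝ) + 1) / (γ + k + 1)) := by gcongr
      _ ≤ (((k : ℝ) + 1) / (γ + k + 1)) ^ k * (((k : ℝ) + 1) / (γ + k + 1)) := by
          gcongr 1
          refine pow_le_pow_left₀ (by positivity) ?_ _
          rw [div_le_div_iff₀ (by positivity) (by positivity)]
          nlinarith
      _ = _ := by rw [← pow_succ]; push_cast; ring_nf

/-- The induction step is Bernoulli's inequality: `1 - γ / (γ + k + 1) ≤ (1 - 1 / (γ + k + 1)) ^ γ`.
-/
lemma betaProd_mul_rpow_antitone {γ : ℝ} (hγ : 1 ≤ γ) {m : ℕ} {k : ℕ} (hk : m ≤ k)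
    {A : ℝ} (h : A * betaProd γ m ≤ (γ / (γ + m)) ^ γ) :
    A * betaProd γ k ≤ (γ / (γ + k)) ^ γ := by
  have hγ0 : 0 < γ := by linarith
  induction k, hk using Nat.le_induction with
  | base => exact h
  | succ k hk ih =>
    rw [betaProd_succ, ← mul_assoc]
    have hb : 1 + γ * (-(1 / (γ + k + 1))) ≤ (1 + -(1 / (γ + k + 1))) ^ γ := by
      refine one_add_mul_self_le_rpow_one_add ?_ hγ
      rw [neg_le_neg_iff, div_le_one (by positivity)]
      linarith [(Nat.cast_nonneg k : (0 : ℝ) ≤ k)]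
    have e1 : 1 + γ * (-(1 / (γ + k + 1))) = ((k : ℝ) + 1) / (γ + k + 1) := by field_simp; ring
    have e2 : 1 + -(1 / (γ + k + 1)) = (γ + k) / (γ + k + 1) := by field_simp; ring
    rw [e1, e2] at hb
    calc A * betaProd γ k * (((k : ℝ) + 1) / (γ + k + 1))
        ≤ (γ / (γ + k)) ^ γ * ((γ + k) / (γ + k + 1)) ^ γ := by gcongr
      _ = _ := by
        rw [← Real.mul_rpow (by positivity) (by positivity)]
        push_cast
        congr 1
        field_simp
        ring

/-- Reduces a bound for all `k ≥ m` to two explicit inequalities at `k = m`. -/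
lemma le_of_feasible_of_base {γ p A : ℝ} {m k : ℕ} (hm : 1 ≤ m) (hk : m ≤ k) (hγ : 1 ≤ γ)
    (hp : 0 < p) (hp1 : p ≤ 1)
    (h : 2 * (1 - p ^ (1 / (k : ℝ))) ^ γ + (1 - p) ^ γ ≤ 1)
    (h₁ : A * ((γ + 2) / γ) * betaProd γ m ≤ ((m : ℝ) / (γ + m)) ^ m)
    (h₂ : A * ((γ + 2) / 2) * betaProd γ m ≤ (γ / (γ + m)) ^ γ) : A * gapConst γ k ≤ p := by
  have hγ0 : 0 < γ := by linarith
  -- This `q` maximises `q ^ k (1 - q) ^ γ`, the product of the two quantities to be bounded below.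
  refine le_of_feasible_of_split (q := (k : ℝ) / (γ + k)) (by omega) hγ hp hp1 (by positivity) ?_ h ?_ ?_
  · rw [div_le_one (by positivity)]; linarith
  · have := betaProd_mul_pow_antitone hγ0 hm hk h₁
    rwa [gapConst, ← mul_assoc]
  · have := betaProd_mul_rpow_antitone hγ hk h₂
    have e : 1 - (k : ℝ) / (γ + k) = γ / (γ + k) := by field_simp; ring
    rw [e]
    convert this using 1
    rw [gapConst]; field_simp

lemma one_add_div_rpow_mono {c γ γ' : ℝ} (hc : 0 ≤ c) (hγ : 0 < γ) (h : γ ≤ γ') :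
    (1 + c / γ) ^ γ ≤ (1 + c / γ') ^ γ' := by
  have hγ' : 0 < γ' := hγ.trans_le h
  have h1 : 1 + γ' / γ * (c / γ') ≤ (1 + c / γ') ^ (γ' / γ) :=
    one_add_mul_self_le_rpow_one_add (by have : 0 ≤ c / γ' := by positivity
                                         linarith) (by rwa [one_le_div hγ])
  have e1 : 1 + γ' / γ * (c / γ') = 1 + c / γ := by field_simp
  rw [e1] at h1
  calc (1 + c / γ) ^ γ ≤ ((1 + c / γ') ^ (γ' / γ)) ^ γ := by gcongr
    _ = _ := by rw [← Real.rpow_mul (by positivity)]; congr 1; field_simp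

lemma div_add_rpow_eq {γ c : ℝ} (hγ : 0 < γ) (hc : 0 ≤ c) :
    (γ / (γ + c)) ^ γ = ((1 + c / γ) ^ γ)⁻¹ := by
  rw [← Real.inv_rpow (by positivity)]
  congr 1
  field_simp

lemma gapConst_le_of_four_le {γ p : ℝ} {k : ℕ} (hk : 2 ≤ k) (hγ : 4 ≤ γ)
    (hp : 0 < p) (hp1 : p ≤ 1)
    (h : 2 * (1 - p ^ (1 / (k : ℝ))) ^ γ + (1 - p) ^ γ ≤ 1) : 9 / 10 * gapConst γ k ≤ p := by
  have hγ0 : 0 < γ := by linarith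
  refine le_of_feasible_of_base (m := 2) (by norm_num) hk (by linarith) hp hp1 h ?_ ?_
  · simp only [betaProd, Finset.prod_range_succ, Finset.prod_range_zero]
    push_cast
    rw [← sub_nonneg]
    have : (2 / (γ + 2)) ^ 2 - 9 / 10 * ((γ + 2) / γ) *
        (1 * ((0 + 1) / (γ + 0 + 1)) * ((1 + 1) / (γ + 1 + 1))) =
        (4 * 10 * γ * (γ + 1) - 18 * (γ + 2) ^ 2) / (10 * γ * (γ + 1) * (γ + 2) ^ 2) := by
      field_simp; ring
    rw [this]
    apply div_nonneg _ (by positivity)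
    nlinarith
  · have hmain : (1 + 2 / γ) ^ γ ≤ 10 / 9 * (γ + 1) := by
      -- The left side increases in `γ` towards `e²`. On each piece its value (or limit) at the
      -- right end is compared with the right side at the left end.
      rcases le_total γ 5 with h5 | h5
      · refine (one_add_div_rpow_mono (by norm_num) hγ0 h5).trans ?_
        rw [show (5 : ℝ) = (5 : ℕ) by norm_num, Real.rpow_natCast]
        norm_num
        linarith
      rcases le_total γ 7 with h7 | h7
      · refine (one_add_div_rpow_mono (by norm_num) hγ0 h7).trans ?_
        rw [show (7 : ℝ) = (7 : ℕ) by norm_num, Real.rpow_natCast]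
        norm_num
        linarith
      · calc (1 + 2 / γ) ^ γ ≤ (Real.exp (2 / γ)) ^ γ := by
              gcongr
              linarith [Real.add_one_le_exp (2 / γ)]
          _ = Real.exp 1 ^ 2 := by
              rw [← Real.exp_mul, ← Real.exp_nat_mul]; congr 1; field_simp; norm_num
          _ ≤ 10 / 9 * (γ + 1) := by nlinarith [Real.exp_one_lt_d9, Real.exp_pos 1]
    have hpos : 0 < (1 + 2 / γ) ^ γ := by positivity
    have := div_add_rpow_eq hγ0 (c := 2) (by norm_num)
    push_cast
    rw [this]
    simp only [betaProd, Finset.prod_range_succ, Finset.prod_range_zero]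
    push_cast
    have e : 9 / 10 * ((γ + 2) / 2) * (1 * (((0 : ℝ) + 1) / (γ + 0 + 1)) * ((1 + 1) / (γ + 1 + 1)))
      = (10 / 9 * (γ + 1))⁻¹ := by field_simp; ring
    rw [e]
    exact inv_anti₀ hpos hmain

lemma gapConst_le_of_two_le {γ p : ℝ} {k : ℕ} (hk : 4 ≤ k) (hγ : 2 ≤ γ) (hγ4 : γ ≤ 4)
    (hp : 0 < p) (hp1 : p ≤ 1)
    (h : 2 * (1 - p ^ (1 / (k : ℝ))) ^ γ + (1 - p) ^ γ ≤ 1) : 7 / 9 * gapConst γ k ≤ p := by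
  have hγ0 : 0 < γ := by linarith
  refine le_of_feasible_of_base (m := 4) (by norm_num) hk (by linarith) hp hp1 h ?_ ?_
  · simp only [betaProd, Finset.prod_range_succ, Finset.prod_range_zero]
    push_cast
    rw [← sub_nonneg]
    have : (4 / (γ + 4)) ^ 4 - 7 / 9 * ((γ + 2) / γ) *
        (1 * ((0 + 1) / (γ + 0 + 1)) * ((1 + 1) / (γ + 1 + 1)) * ((2 + 1) / (γ + 2 + 1)) *
          ((3 + 1) / (γ + 3 + 1))) =
        (9 * 256 * γ * (γ + 1) * (γ + 3) - 168 * (γ + 4) ^ 3) /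
          (9 * γ * (γ + 1) * (γ + 3) * (γ + 4) ^ 4) := by
      field_simp; ring
    rw [this]
    apply div_nonneg _ (by positivity)
    nlinarith [mul_nonneg (sub_nonneg.2 hγ) (sub_nonneg.2 hγ),
      mul_nonneg (mul_nonneg (sub_nonneg.2 hγ) (sub_nonneg.2 hγ)) (sub_nonneg.2 hγ)]
  · have hmain : (1 + 4 / γ) ^ γ ≤ 18 / 168 * ((γ + 1) * (γ + 3) * (γ + 4)) := by
      rcases le_total γ 3 with h3 | h3
      -- The exponent `γ - 2` lies in `[0, 1]`, where Bernoulli's inequality bounds the power from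
      -- above; a polynomial inequality on `[2, 3]` remains.
      · have e1 : (1 + 4 / γ) ^ γ = (1 + 4 / γ) ^ 2 * (1 + 4 / γ) ^ (γ - 2) := by
          rw [← Real.rpow_natCast, ← Real.rpow_add (by positivity)]
          congr 1; push_cast; ring
        have e2 : (1 + 4 / γ) ^ (γ - 2) ≤ 1 + (γ - 2) * (4 / γ) :=
          rpow_one_add_le_one_add_mul_self (by linarith [div_pos (by norm_num : (0:ℝ) < 4) hγ0])
            (by linarith) (by linarith)
        rw [e1]
        refine (mul_le_mul_of_nonneg_left e2 (by positivity)).trans ?_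
        rw [← sub_nonneg]
        have : 18 / 168 * ((γ + 1) * (γ + 3) * (γ + 4)) - (1 + 4 / γ) ^ 2 * (1 + (γ - 2) * (4 / γ))
          = (γ + 4) * (18 * γ ^ 3 * (γ + 1) * (γ + 3) - 168 * (γ + 4) * (5 * γ - 8)) /
            (168 * γ ^ 3) := by
          field_simp; ring
        rw [this]
        refine div_nonneg (mul_nonneg (by positivity) ?_) (by positivity)
        obtain ⟨s, rfl⟩ : ∃ s, γ = 2 + s := ⟨γ - 2, by ring⟩
        have hs : 0 ≤ s := by linarith
        ring_nf
        nlinarith [sq_nonneg (s - 1 / 5), mul_nonneg hs (sq_nonneg (s - 1 / 5)), pow_nonneg hs 3,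
          pow_nonneg hs 4, pow_nonneg hs 5]
      · refine (one_add_div_rpow_mono (by norm_num) hγ0 hγ4).trans ?_
        rw [show (4 : ℝ) = (4 : ℕ) by norm_num, Real.rpow_natCast]
        norm_num
        nlinarith [mul_nonneg (sub_nonneg.2 h3) (sub_nonneg.2 h3),
          mul_nonneg (mul_nonneg (sub_nonneg.2 h3) (sub_nonneg.2 h3)) (sub_nonneg.2 h3)]
    have hpos : 0 < (1 + 4 / γ) ^ γ := by positivity
    have := div_add_rpow_eq hγ0 (c := 4) (by norm_num)
    push_cast
    rw [this]
    simp only [betaProd, Finset.prod_range_succ, Finset.prod_range_zero]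
    push_cast
    have e : 7 / 9 * ((γ + 2) / 2) * (1 * (((0 : ℝ) + 1) / (γ + 0 + 1)) * ((1 + 1) / (γ + 1 + 1))
        * ((2 + 1) / (γ + 2 + 1)) * ((3 + 1) / (γ + 3 + 1)))
      = (18 / 168 * ((γ + 1) * (γ + 3) * (γ + 4)))⁻¹ := by field_simp; ring
    rw [e]
    exact inv_anti₀ hpos hmain

/-- `(2 k + 1) / (2 k) * η` in terms of the feasible points. -/
lemma le_mul_eta {γ A : ℝ} {k : ℕ} (hk : 0 < k)
    (h : ∀ p : ℝ, 0 < p → p ≤ 1 → 2 * (1 - p ^ (1 / (k : ℝ))) ^ γ + (1 - p) ^ γ ≤ 1 →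
      A ≤ (2 * k + 1) * p) :
    ENNReal.ofReal A ≤ ENNReal.ofReal (1 + 1 / (2 * (k : ℝ))) * eta k γ 2 := by
  have hk' : (1 : ℝ) ≤ k := by exact_mod_cast hk
  have hpos : (0 : ℝ) < 1 + 1 / (2 * (k : ℝ)) := by positivity
  rw [eta, mul_comm, ← ENNReal.div_le_iff_le_mul (.inl (ENNReal.ofReal_pos.2 hpos).ne') (.inl ENNReal.ofReal_ne_top)]
  refine le_sInf ?_
  rintro _ ⟨u, ⟨⟨hu0, hu1⟩, hu⟩, rfl⟩
  rw [ENNReal.div_le_iff_le_mul (.inl (ENNReal.ofReal_pos.2 hpos).ne') (.inl ENNReal.ofReal_ne_top), ← ENNReal.ofReal_mul hu0.le]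
  refine ENNReal.ofReal_le_ofReal ?_
  have := h (u / (2 * k)) (by positivity) (by rw [div_le_one (by positivity)]; linarith) hu
  convert this using 1
  field_simp

lemma le_mul_eta_of_four_le {γ : ℝ} {k : ℕ} (hk : 2 ≤ k) (hγ : 4 ≤ γ) :
    ENNReal.ofReal ((k + 1) * (3 / 2) * gapConst γ k) ≤
      ENNReal.ofReal (1 + 1 / (2 * (k : ℝ))) * eta k γ 2 := by
  refine le_mul_eta (by omega) fun p hp hp1 h => ?_
  have h1 := gapConst_le_of_four_le hk hγ hp hp1 h
  have hk' : (2 : ℝ) ≤ k := by exact_mod_cast hk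
  have h2 := gapConst_pos (show 0 < γ by linarith) k
  -- The comparison of the coefficients is an equality at `k = 2`.
  calc (k + 1) * (3 / 2) * gapConst γ k ≤ (2 * k + 1) * (9 / 10) * gapConst γ k := by
        refine mul_le_mul_of_nonneg_right ?_ h2.le
        linarith
    _ ≤ _ := by rw [mul_assoc]; gcongr

lemma le_mul_eta_of_two_le {γ : ℝ} {k : ℕ} (hk : 4 ≤ k) (hγ : 2 ≤ γ) (hγ4 : γ ≤ 4) :
    ENNReal.ofReal ((k + 1) * (7 / 5) * gapConst γ k) ≤
      ENNReal.ofReal (1 + 1 / (2 * (k : ℝ))) * eta k γ 2 := by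
  refine le_mul_eta (by omega) fun p hp hp1 h => ?_
  have h1 := gapConst_le_of_two_le hk hγ hγ4 hp hp1 h
  have hk' : (4 : ℝ) ≤ k := by exact_mod_cast hk
  have h2 := gapConst_pos (show 0 < γ by linarith) k
  -- The comparison of the coefficients is an equality at `k = 4`.
  calc (k + 1) * (7 / 5) * gapConst γ k ≤ (2 * k + 1) * (7 / 9) * gapConst γ k := by
        refine mul_le_mul_of_nonneg_right ?_ h2.le
        linarith
    _ ≤ _ := by rw [mul_assoc]; gcongr

lemma le_mul_eta_of_pow {γ q : ℝ} {n k : ℕ} (hk : 0 < k) (hγ : 0 < γ) (hγn : γ ≤ n)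
    (hq : 0 ≤ q) (hq1 : q ≤ 1) (h : 1 ≤ 2 * (1 - q) ^ n + (1 - q ^ k) ^ n) :
    ENNReal.ofReal ((2 * k + 1) * q ^ k) ≤
      ENNReal.ofReal (1 + 1 / (2 * (k : ℝ))) * eta k γ 2 := by
  refine le_mul_eta hk fun p hp hp1 hf => ?_
  gcongr
  refine pow_le_of_feasible hk.ne' hγ hγn hp hq hq1 hf ?_
  simpa [Real.rpow_natCast] using h

lemma le_mul_eta_of_le_two {γ : ℝ} {k : ℕ} (hk : 2 ≤ k) (hγ : 0 < γ) (hγ2 : γ ≤ 2) :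
    ENNReal.ofReal (2 / k) ≤ ENNReal.ofReal (1 + 1 / (2 * (k : ℝ))) * eta k γ 2 := by
  have hk' : (2 : ℝ) ≤ k := by exact_mod_cast hk
  -- With `q ^ k = 1 / k²` and `1 - q ≥ 1 / k` the condition for the exponent `2` holds: `2 / k² +
  -- (1 - 1 / k²)² ≥ 1`. The resulting bound `(2k + 1) / k²` exceeds `2 / k`.
  set q : ℝ := (1 / (k : ℝ) ^ 2) ^ ((k : ℝ)⁻¹) with hq
  have hqk : q ^ k = 1 / (k : ℝ) ^ 2 := Real.rpow_inv_natCast_pow (by positivity) (by omega)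
  have hq0 : 0 ≤ q := by positivity
  have hmono : (1 / 4 : ℝ) ≤ (1 - 1 / k) ^ k := by
    have h1 : (1 + -(1 / (k : ℝ))) ^ ((k : ℝ) / 2) ≥ 1 + ((k : ℝ) / 2) * -(1 / (k : ℝ)) := by
      refine one_add_mul_self_le_rpow_one_add ?_ (by linarith)
      rw [neg_le_neg_iff, div_le_one (by positivity)]; linarith
    have e : 1 + ((k : ℝ) / 2) * -(1 / (k : ℝ)) = 1 / 2 := by field_simp; norm_num
    rw [e, ← sub_eq_add_neg] at h1
    have h0 : (0 : ℝ) ≤ 1 - 1 / k := by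
      rw [sub_nonneg, div_le_one (by positivity)]; linarith
    calc (1 / 4 : ℝ) = (1 / 2) ^ 2 := by norm_num
      _ ≤ ((1 - 1 / (k : ℝ)) ^ ((k : ℝ) / 2)) ^ 2 := by gcongr
      _ = _ := by
        rw [← Real.rpow_natCast, ← Real.rpow_mul h0, ← Real.rpow_natCast]
        congr 1; push_cast; ring
  have hq1 : q ≤ 1 - 1 / k := by
    have h0 : (0 : ℝ) ≤ 1 - 1 / k := by
      rw [sub_nonneg, div_le_one (by positivity)]; linarith
    refine le_of_pow_le_pow_left₀ (n := k) (by omega) h0 ?_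
    rw [hqk]
    refine le_trans ?_ hmono
    rw [div_le_div_iff₀ (by positivity) (by norm_num)]
    nlinarith
  have hinv : 0 < 1 / (k : ℝ) := by positivity
  refine le_trans (ENNReal.ofReal_le_ofReal ?_)
    (le_mul_eta_of_pow (n := 2) (by omega) hγ (by exact_mod_cast hγ2) hq0 (by linarith) ?_)
  · rw [hqk]
    rw [mul_one_div, div_le_div_iff₀ (by positivity) (by positivity)]
    nlinarith
  · rw [hqk, show 1 / (k : ℝ) ^ 2 = (1 / (k : ℝ)) ^ 2 by rw [div_pow, one_pow]]
    nlinarith [pow_le_pow_left₀ hinv.le (show 1 / (k : ℝ) ≤ 1 - q by linarith) 2,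
      sq_nonneg ((1 / (k : ℝ)) ^ 2)]

/-- If `γ` is small compared with `k₀`, the sum of the terms `(1 + 1 / 2k) η` is at least `1`. -/
lemma one_le_sum_eta {γ : ℝ} {k₀ M : ℕ} (hγ : 0 < γ) (hk₀ : 2 ≤ k₀) (hM : 2 * k₀ + 1 ≤ M)
    (h : γ ≤ 2 ∨ (γ ≤ 4 ∧ k₀ ≤ 3)) :
    1 ≤ ∑ k ∈ Finset.Icc k₀ (M - 2), ENNReal.ofReal (1 + 1 / (2 * (k : ℝ))) * eta k γ 2 := by
  rcases h with h | ⟨h4, h3⟩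
  · have hk0 : (2 : ℝ) ≤ k₀ := by exact_mod_cast hk₀
    -- The `k₀` terms `2 / k` with `k₀ ≤ k < 2 k₀` are each at least `1 / k₀`; `2 k₀ + 1 ≤ M` keeps
    -- them in the range of summation.
    calc (1 : ℝ≥0∞) ≤ ENNReal.ofReal (∑ k ∈ Finset.Ico k₀ (2 * k₀), (2 / (k : ℝ))) := by
          rw [ENNReal.one_le_ofReal]
          calc (1 : ℝ) = ∑ k ∈ Finset.Ico k₀ (2 * k₀), (1 / (k₀ : ℝ)) := by
                simp [two_mul]; field_simp
            _ ≤ _ := by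
              refine Finset.sum_le_sum fun k hk => ?_
              rw [Finset.mem_Ico] at hk
              have h1 : (k : ℝ) ≤ 2 * k₀ := by exact_mod_cast hk.2.le
              have h2 : (k₀ : ℝ) ≤ k := by exact_mod_cast hk.1
              rw [div_le_div_iff₀ (by positivity) (by linarith)]
              linarith
      _ = ∑ k ∈ Finset.Ico k₀ (2 * k₀), ENNReal.ofReal (2 / (k : ℝ)) :=
          ENNReal.ofReal_sum_of_nonneg fun _ _ => by positivity
      _ ≤ ∑ k ∈ Finset.Ico k₀ (2 * k₀), ENNReal.ofReal (1 + 1 / (2 * (k : ℝ))) * eta k γ 2 := by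
          refine Finset.sum_le_sum fun k hk => ?_
          exact le_mul_eta_of_le_two (hk₀.trans (Finset.mem_Ico.1 hk).1) hγ h
      _ ≤ _ := by
          refine Finset.sum_le_sum_of_subset fun k hk => ?_
          rw [Finset.mem_Ico] at hk
          rw [Finset.mem_Icc]
          omega
  · have key : ∀ {q : ℝ} {k : ℕ}, 0 < k → 0 ≤ q → q ≤ 1 →
        1 ≤ 2 * (1 - q) ^ 4 + (1 - q ^ k) ^ 4 → ENNReal.ofReal ((2 * k + 1) * q ^ k) ≤
        ENNReal.ofReal (1 + 1 / (2 * (k : ℝ))) * eta k γ 2 := fun hk hq hq1 hh =>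
      le_mul_eta_of_pow hk hγ (by exact_mod_cast h4) hq hq1 hh
    -- For each small `k` a rational `q` just satisfying the condition with exponent `4` is enough.
    -- The terms `k = 2, 3`, respectively `k = 3, 4, 5`, already add up to more than `1`.
    have k3 := key (q := 2 / 5) (k := 3) (by norm_num) (by norm_num) (by norm_num) (by norm_num)
    obtain rfl | rfl : k₀ = 2 ∨ k₀ = 3 := by omega
    · have k2 := key (q := 1 / 3) (k := 2) (by norm_num) (by norm_num) (by norm_num) (by norm_num)
      calc (1 : ℝ≥0∞) ≤ ENNReal.ofReal ((2 * (2 : ℕ) + 1) * (1 / 3) ^ 2)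
            + ENNReal.ofReal ((2 * (3 : ℕ) + 1) * (2 / 5) ^ 3) := by
            rw [← ENNReal.ofReal_add (by positivity) (by positivity), ENNReal.one_le_ofReal]
            norm_num
        _ ≤ _ := add_le_add k2 k3
        _ = ∑ k ∈ ({2, 3} : Finset ℕ), ENNReal.ofReal (1 + 1 / (2 * (k : ℝ))) * eta k γ 2 := by
            simp
        _ ≤ _ := by
            refine Finset.sum_le_sum_of_subset fun k hk => ?_
            simp only [Finset.mem_insert, Finset.mem_singleton] at hk
            rw [Finset.mem_Icc]
            omega
    · have k4 := key (q := 9 / 20) (k := 4) (by norm_num) (by norm_num) (by norm_num) (by norm_num)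
      have k5 := key (q := 1 / 2) (k := 5) (by norm_num) (by norm_num) (by norm_num) (by norm_num)
      calc (1 : ℝ≥0∞) ≤ ENNReal.ofReal ((2 * (3 : ℕ) + 1) * (2 / 5) ^ 3)
            + (ENNReal.ofReal ((2 * (4 : ℕ) + 1) * (9 / 20) ^ 4)
            + ENNReal.ofReal ((2 * (5 : ℕ) + 1) * (1 / 2) ^ 5)) := by
            rw [← ENNReal.ofReal_add (by positivity) (by positivity),
              ← ENNReal.ofReal_add (by positivity) (by positivity), ENNReal.one_le_ofReal]
            norm_num
        _ ≤ _ := add_le_add k3 (add_le_add k4 k5)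
        _ = ∑ k ∈ ({3, 4, 5} : Finset ℕ), ENNReal.ofReal (1 + 1 / (2 * (k : ℝ))) * eta k γ 2 := by
            simp
        _ ≤ _ := by
            refine Finset.sum_le_sum_of_subset fun k hk => ?_
            simp only [Finset.mem_insert, Finset.mem_singleton] at hk
            rw [Finset.mem_Icc]
            omega

end GapEstimator

/-! ### The angle of `1 + t e^{iβ}` -/

namespace GapEstimator

/-- The argument of `1 + t * exp (β * I)`, for `0 < β < π / 2` and `0 ≤ t`. -/
noncomputable def rayAngle (β t : ℝ) : ℝ := Real.arctan (t * Real.sin β / (1 + t * Real.cos β))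

section rayAngle

variable {β t : ℝ}

lemma sin_pos_cos_pos (h0 : 0 < β) (h1 : β < Real.pi / 2) : 0 < Real.sin β ∧ 0 < Real.cos β :=
  ⟨Real.sin_pos_of_pos_of_lt_pi h0 (by linarith [Real.pi_pos]),
    Real.cos_pos_of_mem_Ioo ⟨by linarith [Real.pi_pos], h1⟩⟩

@[simp] lemma rayAngle_zero : rayAngle β 0 = 0 := by simp [rayAngle]

lemma measurable_rayAngle : Measurable (rayAngle β) := by
  unfold rayAngle; fun_prop

lemma rayAngle_pos (h0 : 0 < β) (h1 : β < Real.pi / 2) (ht : 0 < t) : 0 < rayAngle β t := by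
  obtain ⟨hs, hc⟩ := sin_pos_cos_pos h0 h1
  rw [rayAngle, ← Real.arctan_zero]
  exact Real.arctan_strictMono (by positivity)

lemma rayAngle_nonneg (h0 : 0 < β) (h1 : β < Real.pi / 2) (ht : 0 ≤ t) : 0 ≤ rayAngle β t := by
  rcases ht.eq_or_lt with rfl | ht
  · simp
  · exact (rayAngle_pos h0 h1 ht).le

/-- Geometrically, `t (1 + t⁻¹ e^{iβ}) = e^{iβ} (1 + t e^{-iβ})`, and the last factor has the
opposite angle of `1 + t e^{iβ}`. In terms of arctangents it is the addition formula. -/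
lemma rayAngle_inv (h0 : 0 < β) (h1 : β < Real.pi / 2) (ht : 0 < t) :
    rayAngle β t⁻¹ = β - rayAngle β t := by
  obtain ⟨hs, hc⟩ := sin_pos_cos_pos h0 h1
  have hsc := Real.sin_sq_add_cos_sq β
  rw [eq_sub_iff_add_eq, rayAngle, rayAngle]
  have e : t⁻¹ * Real.sin β / (1 + t⁻¹ * Real.cos β) = Real.sin β / (t + Real.cos β) := by
    field_simp
  have hprod : Real.sin β / (t + Real.cos β) * (t * Real.sin β / (1 + t * Real.cos β)) < 1 := by
    rw [div_mul_div_comm, div_lt_one (by positivity)]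
    nlinarith [mul_pos ht hc, mul_pos hc hc, mul_pos (mul_pos ht hc) hc, sq_nonneg t,
      mul_pos (mul_pos ht ht) hc]
  rw [e, Real.arctan_add hprod]
  refine Eq.trans ?_ (Real.arctan_tan (by linarith [Real.pi_pos] : -(Real.pi / 2) < β) h1)
  congr 1
  rw [Real.tan_eq_sin_div_cos]
  have hden : 1 - Real.sin β / (t + Real.cos β) * (t * Real.sin β / (1 + t * Real.cos β)) =
      Real.cos β * (1 + 2 * t * Real.cos β + t ^ 2) / ((t + Real.cos β) * (1 + t * Real.cos β)) := by
    field_simp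
    linear_combination (-t) * hsc
  have hnum : Real.sin β / (t + Real.cos β) + t * Real.sin β / (1 + t * Real.cos β) =
      Real.sin β * (1 + 2 * t * Real.cos β + t ^ 2) / ((t + Real.cos β) * (1 + t * Real.cos β)) := by
    field_simp
    ring
  rw [hden, hnum]
  field_simp

lemma rayAngle_lt (h0 : 0 < β) (h1 : β < Real.pi / 2) (ht : 0 ≤ t) : rayAngle β t < β := by
  rcases ht.eq_or_lt with rfl | ht
  · simpa
  · have := rayAngle_pos h0 h1 (inv_pos.2 ht)
    rw [rayAngle_inv h0 h1 ht] at this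
    linarith

lemma hasDerivAt_rayAngle (h0 : 0 < β) (h1 : β < Real.pi / 2) (ht : 0 ≤ t) :
    HasDerivAt (rayAngle β) (Real.sin β / (1 + 2 * t * Real.cos β + t ^ 2)) t := by
  obtain ⟨hs, hc⟩ := sin_pos_cos_pos h0 h1
  have hsc := Real.sin_sq_add_cos_sq β
  have hpos : 0 < 1 + t * Real.cos β := by positivity
  have h := (((hasDerivAt_id t).mul_const (Real.sin β)).div
    (((hasDerivAt_id t).mul_const (Real.cos β)).const_add 1) hpos.ne').arctan
  refine h.congr_deriv ?_
  simp only [id, Pi.div_apply]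
  have h2 : 0 < 1 + 2 * t * Real.cos β + t ^ 2 := by positivity
  have h3 : 1 + (t * Real.sin β / (1 + t * Real.cos β)) ^ 2 =
      (1 + 2 * t * Real.cos β + t ^ 2) / (1 + t * Real.cos β) ^ 2 := by
    field_simp
    linear_combination t ^ 2 * hsc
  rw [h3]
  field_simp
  ring

/-- The left side is the sine of the angle. -/
lemma rayAngle_ge (h0 : 0 < β) (h1 : β < Real.pi / 2) (ht : 0 ≤ t) :
    t * Real.sin β / √(1 + 2 * t * Real.cos β + t ^ 2) ≤ rayAngle β t := by
  obtain ⟨hs, hc⟩ := sin_pos_cos_pos h0 h1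
  have hsc := Real.sin_sq_add_cos_sq β
  have h := Real.sin_le (rayAngle_nonneg h0 h1 ht)
  rw [rayAngle, Real.sin_arctan] at h
  rw [rayAngle]
  convert h using 1
  have hpos : 0 < 1 + t * Real.cos β := by positivity
  have h3 : 1 + (t * Real.sin β / (1 + t * Real.cos β)) ^ 2 =
      (1 + 2 * t * Real.cos β + t ^ 2) / (1 + t * Real.cos β) ^ 2 := by
    field_simp
    linear_combination t ^ 2 * hsc
  rw [h3, Real.sqrt_div (by positivity), Real.sqrt_sq hpos.le]
  field_simp

/-- Apply `rayAngle_ge` to `t` and to `t⁻¹`, whose angles add up to `β`. -/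
lemma rayAngle_mul_ge (h0 : 0 < β) (h1 : β < Real.pi / 2) (ht : 0 < t) :
    t * Real.sin β ^ 2 / (1 + 2 * t * Real.cos β + t ^ 2) ≤
      rayAngle β t * (β - rayAngle β t) := by
  obtain ⟨hs, hc⟩ := sin_pos_cos_pos h0 h1
  have e1 := rayAngle_ge h0 h1 ht.le
  have e2 := rayAngle_ge h0 h1 (inv_pos.2 ht).le
  rw [rayAngle_inv h0 h1 ht] at e2
  have hN : 0 < 1 + 2 * t * Real.cos β + t ^ 2 := by positivity
  have h4 : √(1 + 2 * t⁻¹ * Real.cos β + t⁻¹ ^ 2) = √(1 + 2 * t * Real.cos β + t ^ 2) / t := by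
    rw [eq_div_iff ht.ne', ← Real.sqrt_sq ht.le,
      ← Real.sqrt_mul (by rw [Real.sqrt_sq ht.le]; positivity),
      Real.sqrt_sq ht.le]
    congr 1
    field_simp
    ring
  rw [h4] at e2
  have hq : 0 < √(1 + 2 * t * Real.cos β + t ^ 2) := Real.sqrt_pos.2 hN
  have e3 := mul_le_mul e1 e2 (by positivity) (rayAngle_nonneg h0 h1 ht.le)
  refine le_trans (le_of_eq ?_) e3
  have hsq := Real.sq_sqrt hN.le
  rw [show t * Real.sin β ^ 2 / (1 + 2 * t * Real.cos β + t ^ 2) =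
    t * Real.sin β ^ 2 / √(1 + 2 * t * Real.cos β + t ^ 2) ^ 2 by rw [hsq]]
  field_simp

/-- Combines the chord bound `cos β ≥ 1 - 2β/π` with `β < tan β`. -/
lemma mul_one_sub_le_sin (h0 : 0 < β) (h1 : β < Real.pi / 2) :
    β * (1 - 2 / Real.pi * β) ≤ Real.sin β := by
  obtain ⟨hs, hc⟩ := sin_pos_cos_pos h0 h1
  have e1 := Real.one_sub_mul_le_cos h0.le h1.le
  have e2 := Real.lt_tan h0 h1
  rw [Real.tan_eq_sin_div_cos, lt_div_iff₀ hc] at e2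
  nlinarith

/-- The odds `rayAngle / (β - rayAngle)` grow at most like `t ^ e`. -/
lemma rayAngle_odds {e x y : ℝ} (h0 : 0 < β) (h1 : β < Real.pi / 2)
    (he : e * (1 - 2 / Real.pi * β) = 1) (hx : 0 < x) (hxy : x ≤ y) :
    rayAngle β y * (β - rayAngle β x) * x ^ e ≤ rayAngle β x * (β - rayAngle β y) * y ^ e := by
  obtain ⟨hs, hc⟩ := sin_pos_cos_pos h0 h1
  have hy := hx.trans_le hxy
  have hpos : ∀ t ∈ Ioi (0 : ℝ), 0 < rayAngle β t := fun t ht => rayAngle_pos h0 h1 ht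
  have hlt : ∀ t ∈ Ioi (0 : ℝ), 0 < β - rayAngle β t := fun t ht =>
    sub_pos.2 (rayAngle_lt h0 h1 (le_of_lt ht))
  set m : ℝ → ℝ := fun t =>
    Real.log (rayAngle β t) - Real.log (β - rayAngle β t) - e * Real.log t with hm
  have hder : ∀ t ∈ Ioi (0 : ℝ), HasDerivAt m
      (Real.sin β / (1 + 2 * t * Real.cos β + t ^ 2) / rayAngle β t -
        -(Real.sin β / (1 + 2 * t * Real.cos β + t ^ 2)) / (β - rayAngle β t) - e * t⁻¹) t := by
    intro t ht
    have hd := hasDerivAt_rayAngle h0 h1 (le_of_lt ht)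
    exact ((hd.log (hpos t ht).ne').sub ((hd.const_sub β).log (hlt t ht).ne')).sub
      ((Real.hasDerivAt_log (ne_of_gt ht)).const_mul e)
  have hanti : AntitoneOn m (Ioi 0) := by
    refine antitoneOn_of_deriv_nonpos (convex_Ioi 0)
      (fun t ht => (hder t ht).continuousAt.continuousWithinAt) ?_ ?_
    · rw [interior_Ioi]
      exact fun t ht => (hder t ht).differentiableAt.differentiableWithinAt
    · rw [interior_Ioi]
      intro t ht
      rw [(hder t ht).deriv]
      have ht' : 0 < t := ht
      have hA := hpos t ht
      have hB := hlt t ht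
      have hN : 0 < 1 + 2 * t * Real.cos β + t ^ 2 := by positivity
      have hge := rayAngle_mul_ge h0 h1 ht'
      have hsin := mul_one_sub_le_sin h0 h1
      have e1 : Real.sin β / (1 + 2 * t * Real.cos β + t ^ 2) / rayAngle β t -
        -(Real.sin β / (1 + 2 * t * Real.cos β + t ^ 2)) / (β - rayAngle β t) =
        Real.sin β * β / (1 + 2 * t * Real.cos β + t ^ 2) /
          (rayAngle β t * (β - rayAngle β t)) := by
        field_simp
        ring
      rw [e1, sub_nonpos]
      have hw : 0 < 1 - 2 / Real.pi * β := by
        rw [sub_pos, div_mul_eq_mul_div, div_lt_one Real.pi_pos]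
        linarith
      have he' : e = 1 / (1 - 2 / Real.pi * β) := eq_div_of_mul_eq hw.ne' he
      -- The derivative of the log-odds in `log t` is at most `β / sin β`, hence at most `1 / (1 -
      -- 2β/π) = e`.
      calc _ ≤ Real.sin β * β / (1 + 2 * t * Real.cos β + t ^ 2) /
            (t * Real.sin β ^ 2 / (1 + 2 * t * Real.cos β + t ^ 2)) := by gcongr
        _ = β / (t * Real.sin β) := by field_simp
        _ ≤ e * t⁻¹ := by
          rw [he', ← div_eq_mul_inv, div_div, div_le_div_iff₀ (by positivity) (by positivity)]
          nlinarith
  have hle := hanti hx hy hxy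
  simp only [hm] at hle
  rw [← Real.log_le_log_iff (by have := hpos y hy; have := hlt x hx; positivity)
    (by have := hpos x hx; have := hlt y hy; positivity)]
  have hxp := Real.rpow_pos_of_pos hx e
  have hyp := Real.rpow_pos_of_pos hy e
  rw [Real.log_mul (mul_pos (hpos y hy) (hlt x hx)).ne' hxp.ne',
    Real.log_mul (mul_pos (hpos x hx) (hlt y hy)).ne' hyp.ne',
    Real.log_mul (hpos y hy).ne' (hlt x hx).ne', Real.log_mul (hpos x hx).ne' (hlt y hy).ne',
    Real.log_rpow hx, Real.log_rpow hy]
  linarith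

lemma rayAngle_mono {x y : ℝ} (h0 : 0 < β) (h1 : β < Real.pi / 2) (hx : 0 ≤ x) (hxy : x ≤ y) :
    rayAngle β x ≤ rayAngle β y := by
  obtain ⟨hs, hc⟩ := sin_pos_cos_pos h0 h1
  refine Real.arctan_strictMono.monotone ?_
  rw [div_le_div_iff₀ (by positivity) (by have := hx.trans hxy; positivity)]
  nlinarith

/-- Follows from the bound on the odds because the angle itself increases. For `β = πα/2` one has `e
= 1 / (1 - α)`, and this monotonicity becomes that of `F(d) / d ^ (1/γ)`. -/
lemma rpow_mul_sub_rayAngle_le {e x y : ℝ} (h0 : 0 < β) (h1 : β < Real.pi / 2)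
    (he : e * (1 - 2 / Real.pi * β) = 1) (hx : 0 < x) (hxy : x ≤ y) :
    x ^ e * (β - rayAngle β x) ≤ y ^ e * (β - rayAngle β y) := by
  have h := rayAngle_odds h0 h1 he hx hxy
  have hA := rayAngle_pos h0 h1 hx
  have hB := rayAngle_lt h0 h1 hx.le
  have hm := rayAngle_mono h0 h1 hx.le hxy
  have hxp := Real.rpow_pos_of_pos hx e
  refine le_of_mul_le_mul_left ?_ hA
  calc rayAngle β x * (x ^ e * (β - rayAngle β x))
      ≤ rayAngle β y * (x ^ e * (β - rayAngle β x)) := by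
        gcongr
    _ = rayAngle β y * (β - rayAngle β x) * x ^ e := by ring
    _ ≤ _ := h
    _ = _ := by ring

/-- If the odds of two angles in `[0, β]` differ by a factor of at most `ρ²`, the angles differ by
at most `β (ρ - 1) / (ρ + 1)`; the extremal angles are symmetric about `β / 2`. -/
lemma rayAngle_sub_le {e x y ρ : ℝ} (h0 : 0 < β) (h1 : β < Real.pi / 2)
    (he : e * (1 - 2 / Real.pi * β) = 1) (hx : 0 < x) (hxy : x ≤ y) (hρ : 1 ≤ ρ)
    (h : y ^ e = ρ ^ 2 * x ^ e) :
    (rayAngle β y - rayAngle β x) * (ρ + 1) ≤ β * (ρ - 1) := by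
  have h2 := rayAngle_odds h0 h1 he hx hxy
  have hxp := Real.rpow_pos_of_pos hx e
  rw [h, ← mul_assoc] at h2
  have h3 := le_of_mul_le_mul_right h2 hxp
  have hA := rayAngle_pos h0 h1 hx
  have hB := rayAngle_lt h0 h1 hx.le
  have hA' := rayAngle_pos h0 h1 (hx.trans_le hxy)
  have hB' := rayAngle_lt h0 h1 (hx.trans_le hxy).le
  have hm := rayAngle_mono h0 h1 hx.le hxy
  generalize rayAngle β x = p at *
  generalize rayAngle β y = q at *
  clear h h2 hxp
  have hu : 0 ≤ q * (β - p) := mul_nonneg hA'.le (by linarith)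
  have hv : 0 ≤ p * (β - q) := mul_nonneg hA.le (by linarith)
  -- With `u² = q (β - p)` and `v² = p (β - q)` the odds bound reads `u ≤ ρ v`, the difference is `β
  -- (q - p) = (u - v)(u + v)`, and the inequality of arithmetic and geometric means gives `u + v ≤
  -- β`.
  obtain ⟨u, hu0, hu2⟩ : ∃ u, 0 ≤ u ∧ u ^ 2 = q * (β - p) := ⟨_, Real.sqrt_nonneg _, Real.sq_sqrt hu⟩
  obtain ⟨v, hv0, hv2⟩ : ∃ v, 0 ≤ v ∧ v ^ 2 = p * (β - q) := ⟨_, Real.sqrt_nonneg _, Real.sq_sqrt hv⟩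
  have huv : u ≤ ρ * v := by
    refine le_of_sq_le_sq ?_ (by positivity)
    rw [mul_pow, hu2, hv2]
    linarith
  have hw : 2 * (u * v) ≤ q * p + (β - q) * (β - p) := by
    refine le_of_sq_le_sq ?_ (by have := mul_pos hA' hA; nlinarith)
    have : (2 * (u * v)) ^ 2 = 4 * ((q * p) * ((β - q) * (β - p))) := by
      rw [mul_pow, mul_pow, hu2, hv2]; ring
    rw [this]
    nlinarith [sq_nonneg (q * p - (β - q) * (β - p))]
  have hβ : (u + v) ^ 2 ≤ β ^ 2 := by nlinarith
  have hd : β * (q - p) = u ^ 2 - v ^ 2 := by rw [hu2, hv2]; ring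
  refine le_of_mul_le_mul_left ?_ h0
  calc β * ((q - p) * (ρ + 1)) = (u + v) * ((u - v) * (ρ + 1)) := by rw [← mul_assoc, hd]; ring
    _ ≤ (u + v) * ((ρ - 1) * (u + v)) :=
      mul_le_mul_of_nonneg_left (by nlinarith) (by positivity)
    _ = (ρ - 1) * (u + v) ^ 2 := by ring
    _ ≤ (ρ - 1) * β ^ 2 := by
      gcongr
    _ = _ := by ring

end rayAngle
end GapEstimator

/-! ### Logarithmic transforms, their analytic continuation and inversion -/

namespace GapEstimator

section LogTransform

open Complex Filter Topology

lemma one_add_mul_mem_slitPlane {z : ℂ} (hz : z ∈ slitPlane) {x : ℝ} (hx : 0 ≤ x) :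
    1 + z * x ∈ slitPlane := by
  rw [mem_slitPlane_iff] at hz ⊢
  rcases hx.eq_or_lt with rfl | hx
  · simp
  · rcases hz with h | h
    · left
      simp
      positivity
    · right
      simp [h, hx.ne']

/-- For `x > 0`, `1 + w x = x (w - (-1/x))`, and the negative real `-1/x` lies off the slit plane,
so at distance at least `δ` from `w`. This uniform bound dominates the derivative `x / (1 + w x)` of
the logarithm. -/
lemma norm_one_add_mul_ge {z w : ℂ} {δ : ℝ} (hball : Metric.ball z (2 * δ) ⊆ slitPlane)
    (hw : w ∈ Metric.ball z δ) {x : ℝ} (hx : 0 ≤ x) : δ * x ≤ ‖1 + w * x‖ := by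
  rcases hx.eq_or_lt with rfl | hx
  · simp
  · by_contra! hlt
    have hmem : ((-x⁻¹ : ℝ) : ℂ) ∈ Metric.ball z (2 * δ) := by
      rw [Metric.mem_ball] at hw ⊢
      have h1 : dist ((-x⁻¹ : ℝ) : ℂ) w < δ := by
        have e : 1 + w * x = -(((-x⁻¹ : ℝ) : ℂ) - w) * x := by
          have : (x : ℂ) ≠ 0 := by exact_mod_cast hx.ne'
          push_cast
          field_simp
          ring
        rw [e, norm_mul, norm_neg, norm_real, Real.norm_of_nonneg hx.le] at hlt
        rw [dist_eq_norm]
        exact lt_of_mul_lt_mul_right hlt hx.le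
      linarith [dist_triangle ((-x⁻¹ : ℝ) : ℂ) w z]
    have := hball hmem
    rw [ofReal_mem_slitPlane] at this
    linarith [inv_pos.2 hx]

lemma exists_ball_subset_slitPlane {z : ℂ} (hz : z ∈ slitPlane) :
    ∃ δ > 0, Metric.ball z (2 * δ) ⊆ slitPlane := by
  obtain ⟨r, hr, h⟩ := Metric.isOpen_iff.1 isOpen_slitPlane z hz
  exact ⟨r / 2, by positivity, by rwa [mul_div_cancel₀ _ two_ne_zero]⟩

/-- `‖1 + z x‖` is bounded below by a positive constant and above by a multiple of `1 + x`, and the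
imaginary part of the logarithm is bounded by `π`. Integrability at real argument `1` thus carries
over to the slit plane. -/
lemma exists_norm_log_one_add_mul_le {z : ℂ} (hz : z ∈ slitPlane) :
    ∃ K, ∀ x : ℝ, 0 ≤ x → ‖log (1 + z * x)‖ ≤ Real.log (1 + x) + K := by
  obtain ⟨δ, hδ, hball⟩ := exists_ball_subset_slitPlane hz
  set c := min (1 / 2) (δ / (2 * (‖z‖ + 1))) with hc
  have hz0 : 0 ≤ ‖z‖ := norm_nonneg z
  have hc0 : 0 < c := lt_min (by norm_num) (by positivity)
  refine ⟨|Real.log c| + |Real.log (1 + ‖z‖)| + Real.pi, fun x hx => ?_⟩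
  have hlow : c ≤ ‖1 + z * x‖ := by
    rcases le_total (‖z‖ * x) (1 / 2) with h | h
    · refine (min_le_left _ _).trans ?_
      have : ‖(1 : ℂ)‖ - ‖z * x‖ ≤ ‖1 + z * x‖ := by
        simpa using norm_sub_norm_le (1 : ℂ) (-(z * x))
      rw [norm_mul, norm_real, Real.norm_of_nonneg hx, norm_one] at this
      linarith
    · refine (min_le_right _ _).trans (le_trans ?_
        (norm_one_add_mul_ge hball (Metric.mem_ball_self hδ) hx))
      rw [div_le_iff₀ (by positivity)]
      nlinarith
  have hup : ‖1 + z * x‖ ≤ (1 + ‖z‖) * (1 + x) := by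
    refine (norm_add_le _ _).trans ?_
    rw [norm_mul, norm_real, Real.norm_of_nonneg hx, norm_one]
    nlinarith
  have hpos : 0 < ‖1 + z * x‖ := hc0.trans_le hlow
  have h1 : ‖log (1 + z * x)‖ ≤ |(log (1 + z * x)).re| + |(log (1 + z * x)).im| :=
    norm_le_abs_re_add_abs_im _
  have h2 : |(log (1 + z * x)).im| ≤ Real.pi := by rw [log_im]; exact abs_arg_le_pi _
  have h3 : |(log (1 + z * x)).re| ≤
      |Real.log c| + |Real.log (1 + ‖z‖)| + Real.log (1 + x) := by
    rw [log_re, abs_le]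
    have e1 := Real.log_le_log hc0 hlow
    have e2 := Real.log_le_log hpos hup
    rw [Real.log_mul (by positivity) (by positivity)] at e2
    have e3 : 0 ≤ Real.log (1 + x) := Real.log_nonneg (by linarith)
    have := neg_abs_le (Real.log c)
    have := abs_nonneg (Real.log (1 + ‖z‖))
    have := le_abs_self (Real.log (1 + ‖z‖))
    have := abs_nonneg (Real.log c)
    constructor <;> linarith
  linarith

variable {A : Type*} [MeasurableSpace A] {m : Measure A} [IsProbabilityMeasure m] {X : A → ℝ}

lemma integrable_log_one_add_mul (hX : Measurable X) (hX0 : ∀ a, 0 ≤ X a)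
    (hint : Integrable (fun a => Real.log (1 + X a)) m) {z : ℂ} (hz : z ∈ slitPlane) :
    Integrable (fun a => log (1 + z * X a)) m := by
  obtain ⟨K, hK⟩ := exists_norm_log_one_add_mul_le hz
  refine (hint.add (integrable_const K)).mono' ?_ (ae_of_all _ fun a => hK _ (hX0 a))
  exact (measurable_log.comp (by fun_prop)).aestronglyMeasurable

lemma differentiableOn_integral_log (hX : Measurable X) (hX0 : ∀ a, 0 ≤ X a)
    (hint : Integrable (fun a => Real.log (1 + X a)) m) :
    DifferentiableOn ℂ (fun z => ∫ a, log (1 + z * X a) ∂m) slitPlane := by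
  intro z hz
  obtain ⟨δ, hδ, hball⟩ := exists_ball_subset_slitPlane hz
  refine (hasDerivAt_integral_of_dominated_loc_of_deriv_le (s := Metric.ball z δ)
    (F := fun z a => log (1 + z * X a)) (F' := fun z a => X a / (1 + z * X a))
    (bound := fun _ => 1 / δ) (Metric.ball_mem_nhds z hδ)
    (Eventually.of_forall fun w => (measurable_log.comp (by fun_prop)).aestronglyMeasurable)
    (integrable_log_one_add_mul hX hX0 hint hz)
    (Measurable.aestronglyMeasurable (by fun_prop))
    (ae_of_all _ fun a w hw => ?_) (integrable_const _)
    (ae_of_all _ fun a w hw => ?_)).2.differentiableAt.differentiableWithinAt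
  · rw [norm_div, norm_real, Real.norm_of_nonneg (hX0 a)]
    have h := norm_one_add_mul_ge hball hw (hX0 a)
    rcases (hX0 a).eq_or_lt with h0 | h0
    · rw [← h0, zero_div]; positivity
    · rw [div_le_div_iff₀ (lt_of_lt_of_le (by positivity) h) hδ]
      linarith
  · have hw' : w ∈ slitPlane :=
      hball (Metric.ball_subset_ball (by linarith) hw)
    have h1 : HasDerivAt (fun w : ℂ => 1 + w * X a) (X a : ℂ) w := by
      simpa using ((hasDerivAt_id w).mul_const (X a : ℂ)).const_add 1
    exact h1.clog (one_add_mul_mem_slitPlane hw' (hX0 a))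

variable {B : Type*} [MeasurableSpace B] {n : Measure B} [IsProbabilityMeasure n] {W : B → ℝ}

lemma cpow_mem_slitPlane {z : ℂ} {b : ℝ} (hz : z ∈ slitPlane) (hb : 0 < b) (hb1 : b < 1) :
    z ^ (b : ℂ) ∈ slitPlane := by
  rw [mem_slitPlane_iff_arg] at hz ⊢
  have hne : z ^ (b : ℂ) ≠ 0 := by simp [cpow_eq_zero_iff, hz.2]
  refine ⟨?_, hne⟩
  have h1 := neg_pi_lt_arg z
  have h2 := lt_of_le_of_ne (arg_le_pi z) hz.1
  rw [cpow_def_of_ne_zero hz.2, arg_exp]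
  have him : (log z * b).im = z.arg * b := by simp [log_im]
  rw [him, toIocMod_eq_self _ |>.2]
  · nlinarith
  · constructor <;> nlinarith

/-- Analytic continuation of a functional equation for logarithmic transforms. -/
lemma integral_log_eq_of_pos (hX : Measurable X) (hX0 : ∀ a, 0 ≤ X a)
    (hXint : Integrable (fun a => Real.log (1 + X a)) m)
    (hW : Measurable W) (hW0 : ∀ a, 0 ≤ W a)
    (hWint : Integrable (fun a => Real.log (1 + W a)) n) {b : ℝ} (hb : 0 < b) (hb1 : b < 1)
    (h : ∀ l : ℝ, 0 < l →
      ∫ a, Real.log (1 + l * X a) ∂m = b⁻¹ * ∫ a, Real.log (1 + l ^ b * W a) ∂n)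
    {z : ℂ} (hz : z ∈ slitPlane) :
    ∫ a, log (1 + z * X a) ∂m = b⁻¹ * ∫ a, log (1 + z ^ (b : ℂ) * W a) ∂n := by
  have h1 := differentiableOn_integral_log hX hX0 hXint
  have h2 : DifferentiableOn ℂ (fun z : ℂ => (b⁻¹ : ℂ) * ∫ a, log (1 + z ^ (b : ℂ) * W a) ∂n)
      slitPlane := by
    refine DifferentiableOn.const_mul ?_ _
    refine (differentiableOn_integral_log hW hW0 hWint).comp (f := fun z : ℂ => z ^ (b : ℂ)) ?_
      fun z hz => cpow_mem_slitPlane hz hb hb1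
    intro z hz
    exact (differentiableAt_id.cpow_const hz).differentiableWithinAt
  have hreal : ∀ l : ℝ, 0 < l → ∫ a, log (1 + (l : ℂ) * X a) ∂m =
      (b⁻¹ : ℂ) * ∫ a, log (1 + (l : ℂ) ^ (b : ℂ) * W a) ∂n := by
    intro l hl
    have e1 : ∀ a, log (1 + (l : ℂ) * X a) = (Real.log (1 + l * X a) : ℝ) := by
      intro a
      rw [Complex.ofReal_log (by have := hX0 a; positivity)]
      push_cast; rfl
    have e2 : ∀ a, log (1 + (l : ℂ) ^ (b : ℂ) * W a) = (Real.log (1 + l ^ b * W a) : ℝ) := by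
      intro a
      rw [Complex.ofReal_log (by have := hW0 a; positivity), ← ofReal_cpow hl.le]
      push_cast; rfl
    simp_rw [e1, e2, integral_complex_ofReal]
    rw [h l hl]
    push_cast; rfl
  rw [ofReal_inv]
  refine (h1.analyticOnNhd isOpen_slitPlane).eqOn_of_preconnected_of_frequently_eq
    (h2.analyticOnNhd isOpen_slitPlane)
    (starConvex_one_slitPlane.isPathConnected one_mem_slitPlane).isConnected.isPreconnected
    one_mem_slitPlane ?_ hz
  -- The identity theorem needs agreement on a set accumulating at one point; the real points `1 + 1
  -- / (k + 1)` accumulate at `1`.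
  have ht : Tendsto (fun k : ℕ => ((1 + 1 / ((k : ℝ) + 1) : ℝ) : ℂ)) atTop (𝓝[≠] 1) := by
    refine tendsto_nhdsWithin_iff.2 ⟨?_, Eventually.of_forall fun k => ?_⟩
    · have := (tendsto_const_nhds (x := (1 : ℝ))).add (tendsto_one_div_add_atTop_nhds_zero_nat (𝕜 := ℝ))
      rw [add_zero] at this
      exact_mod_cast (continuous_ofReal.tendsto 1).comp this
    · intro hk
      have hk' : (1 + 1 / ((k : ℝ) + 1) : ℝ) = 1 := Complex.ofReal_injective (by simpa using hk)
      have : (0 : ℝ) < 1 / ((k : ℝ) + 1) := by positivity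
      linarith
  refine ht.frequently (Eventually.frequently (Eventually.of_forall fun k => ?_))
  exact hreal _ (by positivity)

lemma arg_one_add_exp_mul {β t : ℝ} (h0 : 0 < β) (h1 : β < Real.pi / 2) (ht : 0 ≤ t) :
    arg (1 + exp (β * I) * t) = rayAngle β t := by
  obtain ⟨hs, hc⟩ := sin_pos_cos_pos h0 h1
  have hre : (1 + exp (β * I) * t).re = 1 + t * Real.cos β := by
    simp [exp_ofReal_mul_I_re, exp_ofReal_mul_I_im]; ring
  have him : (1 + exp (β * I) * t).im = t * Real.sin β := by
    simp [exp_ofReal_mul_I_re, exp_ofReal_mul_I_im]; ring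
  rw [rayAngle, ← hre, ← him, ← tan_arg]
  have hpos : 0 < (1 + exp (β * I) * t).re := by rw [hre]; positivity
  have := abs_lt.1 (abs_arg_lt_pi_div_two_iff.2 (Or.inl hpos))
  rw [Real.arctan_tan this.1 this.2]

/-- Inversion of the logarithmic transform: the law of `X` at `1` in terms of `W`. -/
lemma measure_le_integral_rayAngle_le (hX : Measurable X) (hX0 : ∀ a, 0 ≤ X a)
    (hXint : Integrable (fun a => Real.log (1 + X a)) m)
    (hW : Measurable W) (hW0 : ∀ a, 0 ≤ W a)
    (hWint : Integrable (fun a => Real.log (1 + W a)) n) {b : ℝ} (hb : 0 < b) (hb1 : b < 1 / 2)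
    (h : ∀ l : ℝ, 0 < l →
      ∫ a, Real.log (1 + l * X a) ∂m = b⁻¹ * ∫ a, Real.log (1 + l ^ b * W a) ∂n) :
    Real.pi * b * m.real {a | 1 < X a} ≤ ∫ a, rayAngle (Real.pi * b) (W a) ∂n ∧
      ∫ a, rayAngle (Real.pi * b) (W a) ∂n ≤ Real.pi * b * m.real {a | 1 ≤ X a} := by
  have hpi := Real.pi_pos
  set φ : ℕ → ℝ := fun k => Real.pi - 1 / ((k : ℝ) + 1) with hφ
  have hφ0 : ∀ k, 0 < φ k := fun k => by
    have : 1 / ((k : ℝ) + 1) ≤ 1 := by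
      rw [div_le_one (by positivity)]; linarith [(Nat.cast_nonneg k : (0 : ℝ) ≤ k)]
    have := Real.pi_gt_three
    simp only [hφ]; linarith
  have hφπ : ∀ k, φ k < Real.pi := fun k => by
    have : (0 : ℝ) < 1 / ((k : ℝ) + 1) := by positivity
    simp only [hφ]; linarith
  have hφt : Tendsto φ atTop (𝓝 Real.pi) := by
    have := (tendsto_const_nhds (x := Real.pi)).sub (tendsto_one_div_add_atTop_nhds_zero_nat (𝕜 := ℝ))
    rwa [sub_zero] at this
  set z : ℕ → ℂ := fun k => exp (φ k * I) with hz
  have hargz : ∀ k, arg (z k) = φ k := fun k => by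
    simp only [hz]
    rw [arg_exp_mul_I, toIocMod_eq_self _ |>.2]
    constructor <;> linarith [hφ0 k, hφπ k]
  have hzs : ∀ k, z k ∈ slitPlane := fun k => by
    rw [mem_slitPlane_iff_arg, hargz]
    exact ⟨(hφπ k).ne, exp_ne_zero _⟩
  have hzim : ∀ k, (z k).im = Real.sin (φ k) := fun k => exp_ofReal_mul_I_im _
  have hsin : ∀ k, 0 < Real.sin (φ k) := fun k => Real.sin_pos_of_pos_of_lt_pi (hφ0 k) (hφπ k)
  have hzt : Tendsto z atTop (𝓝 (-1)) := by
    have : Tendsto (fun x : ℝ => exp (x * I)) (𝓝 Real.pi) (𝓝 (exp (Real.pi * I))) :=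
      Continuous.tendsto (by fun_prop) _
    rw [exp_pi_mul_I] at this
    exact this.comp hφt
  have hzb : ∀ k, z k ^ (b : ℂ) = exp ((φ k * b : ℝ) * I) := fun k => by
    rw [cpow_def_of_ne_zero (exp_ne_zero _)]
    congr 1
    have : log (z k) = φ k * I := log_exp (by simp; linarith [hφ0 k]) (by simp; exact (hφπ k).le)
    rw [this]; push_cast; ring
  -- the imaginary parts of the functional equation
  have him : ∀ k, ∫ a, arg (1 + z k * X a) ∂m = b⁻¹ * ∫ a, arg (1 + z k ^ (b : ℂ) * W a) ∂n := by
    intro k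
    have e := integral_log_eq_of_pos hX hX0 hXint hW hW0 hWint hb (by linarith) h (hzs k)
    have e1 : (∫ a, log (1 + z k * X a) ∂m).im = ∫ a, arg (1 + z k * X a) ∂m := by
      have := integral_im (𝕜 := ℂ) (integrable_log_one_add_mul hX hX0 hXint (hzs k))
      simpa [log_im] using this.symm
    have e2 : (∫ a, log (1 + z k ^ (b : ℂ) * W a) ∂n).im = ∫ a, arg (1 + z k ^ (b : ℂ) * W a) ∂n := by
      have := integral_im (𝕜 := ℂ) (integrable_log_one_add_mul hW hW0 hWint
        (cpow_mem_slitPlane (hzs k) hb (by linarith)))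
      simpa [log_im] using this.symm
    rw [← e1, ← e2, e, im_ofReal_mul]
  have hβ0 : 0 < Real.pi * b := by positivity
  have hβ1 : Real.pi * b < Real.pi / 2 := by nlinarith
  have hWlim : Tendsto (fun k => ∫ a, arg (1 + z k ^ (b : ℂ) * W a) ∂n) atTop
      (𝓝 (∫ a, rayAngle (Real.pi * b) (W a) ∂n)) := by
    refine tendsto_integral_of_dominated_convergence (fun _ => Real.pi) (fun k => ?_)
      (integrable_const _) (fun k => ae_of_all _ fun a => abs_arg_le_pi _) (ae_of_all _ fun a => ?_)
    · exact (measurable_arg.comp (by fun_prop)).aestronglyMeasurable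
    · rw [← arg_one_add_exp_mul hβ0 hβ1 (hW0 a)]
      have hmem : 1 + exp (((Real.pi * b : ℝ) : ℂ) * I) * W a ∈ slitPlane := by
        obtain ⟨hs, hc⟩ := sin_pos_cos_pos hβ0 hβ1
        rw [mem_slitPlane_iff]
        left
        have := hW0 a
        rw [add_re, one_re, re_mul_ofReal, exp_ofReal_mul_I_re]
        positivity
      refine (continuousAt_arg hmem).tendsto.comp ?_
      simp_rw [hzb]
      have hc : Continuous fun x : ℝ => 1 + exp ((x * b : ℝ) * I) * W a := by fun_prop
      exact (hc.tendsto Real.pi).comp hφt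
  have hre1 : ∀ k a, (1 + z k * X a).im = Real.sin (φ k) * X a := fun k a => by
    simp [hzim]
  have hnn : ∀ k a, 0 ≤ arg (1 + z k * X a) := fun k a => by
    rw [arg_nonneg_iff, hre1]
    exact mul_nonneg (hsin k).le (hX0 a)
  have hargm : ∀ k, Measurable fun a => arg (1 + z k * X a) := fun k =>
    measurable_arg.comp (by fun_prop)
  have hargi : ∀ k, Integrable (fun a => arg (1 + z k * X a)) m := fun k =>
    (integrable_const Real.pi).mono' (hargm k).aestronglyMeasurable
      (ae_of_all _ fun a => abs_arg_le_pi _)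
  have hlim1 : ∀ a, Tendsto (fun k => 1 + z k * X a) atTop (𝓝 (1 - X a : ℝ)) := fun a => by
    have := (hzt.mul_const (X a : ℂ)).const_add 1
    convert this using 2
    push_cast; ring
  have hlim : Tendsto (fun k => b * ∫ a, arg (1 + z k * X a) ∂m) atTop
      (𝓝 (∫ a, rayAngle (Real.pi * b) (W a) ∂n)) := by
    refine hWlim.congr fun k => ?_
    rw [him k, mul_inv_cancel_left₀ hb.ne']
  have hS1 : MeasurableSet {a | 1 < X a} := measurableSet_lt measurable_const hX
  have hS2 : MeasurableSet {a | 1 ≤ X a} := measurableSet_le measurable_const hX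
  constructor
  · have hl : Tendsto (fun k => b * ∫ a in {a | 1 < X a}, arg (1 + z k * X a) ∂m) atTop
        (𝓝 (b * ∫ a in {a | 1 < X a}, Real.pi ∂m)) := by
      refine Tendsto.const_mul _ (tendsto_integral_of_dominated_convergence (fun _ => Real.pi)
        (fun k => (hargm k).aestronglyMeasurable)
        (integrable_const _) (fun k => ae_of_all _ fun a => abs_arg_le_pi _) ?_)
      filter_upwards [ae_restrict_mem hS1] with a ha
      have ha' : 1 < X a := ha
      -- `1 + z X` approaches the cut of the argument from above, so the limit is `π` and not `-π`.
      refine (tendsto_arg_nhdsWithin_im_nonneg_of_re_neg_of_im_zero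
        (z := ((1 - X a : ℝ) : ℂ)) (by rw [ofReal_re]; linarith) (ofReal_im _)).comp
        (tendsto_nhdsWithin_iff.2 ⟨hlim1 a, Eventually.of_forall fun k => ?_⟩)
      rw [Set.mem_ofPred_eq, hre1]
      exact mul_nonneg (hsin k).le (hX0 a)
    have e : b * ∫ a in {a | 1 < X a}, Real.pi ∂m = Real.pi * b * m.real {a | 1 < X a} := by
      rw [setIntegral_const, smul_eq_mul]; ring
    rw [← e]
    refine le_of_tendsto_of_tendsto' hl hlim fun k => ?_
    exact mul_le_mul_of_nonneg_left (setIntegral_le_integral (hargi k)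
      (ae_of_all _ fun a => hnn k a)) hb.le
  · have hl : Tendsto (fun k => b * (∫ a in {a | 1 ≤ X a}ᶜ, arg (1 + z k * X a) ∂m +
          Real.pi * m.real {a | 1 ≤ X a})) atTop
        (𝓝 (b * (∫ a in {a | 1 ≤ X a}ᶜ, (0 : ℝ) ∂m + Real.pi * m.real {a | 1 ≤ X a}))) := by
      refine Tendsto.const_mul _ (Tendsto.add_const _
        (tendsto_integral_of_dominated_convergence (fun _ => Real.pi)
        (fun k => (hargm k).aestronglyMeasurable)
        (integrable_const _) (fun k => ae_of_all _ fun a => abs_arg_le_pi _) ?_))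
      filter_upwards [ae_restrict_mem hS2.compl] with a ha
      have ha' : X a < 1 := not_le.1 ha
      have h0 : arg ((1 - X a : ℝ) : ℂ) = 0 := arg_ofReal_of_nonneg (by linarith)
      rw [← h0]
      exact (continuousAt_arg (ofReal_mem_slitPlane.2 (by linarith))).tendsto.comp (hlim1 a)
    have e : b * (∫ a in {a | 1 ≤ X a}ᶜ, (0 : ℝ) ∂m + Real.pi * m.real {a | 1 ≤ X a}) =
        Real.pi * b * m.real {a | 1 ≤ X a} := by
      rw [integral_zero]; ring
    rw [← e]
    refine le_of_tendsto_of_tendsto' hlim hl fun k => ?_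
    refine mul_le_mul_of_nonneg_left ?_ hb.le
    rw [← integral_add_compl hS2 (hargi k), add_comm]
    gcongr
    calc ∫ a in {a | 1 ≤ X a}, arg (1 + z k * X a) ∂m ≤ ∫ a in {a | 1 ≤ X a}, Real.pi ∂m :=
          setIntegral_mono (hargi k).integrableOn (integrable_const _) fun a => arg_le_pi _
      _ = _ := by rw [setIntegral_const, smul_eq_mul]; ring

end LogTransform

end GapEstimator

/-! ### Frullani's integral -/

namespace GapEstimator

section Frullani

open Real

lemma lintegral_rpow_mul_exp {p c : ℝ} (hp : 0 < p) (hc : 0 < c) :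
    ∫⁻ t in Ioi (0 : ℝ), ENNReal.ofReal (t ^ (p - 1) * exp (-c * t ^ p)) =
      ENNReal.ofReal (1 / (p * c)) := by
  have h := integral_rpow_mul_exp_neg_mul_rpow hp (show -1 < p - 1 by linarith) hc
  have e : c ^ (-(p - 1 + 1) / p) * (1 / p) * Gamma ((p - 1 + 1) / p) = 1 / (p * c) := by
    rw [sub_add_cancel, neg_div, div_self hp.ne', Gamma_one, rpow_neg_one]
    field_simp
  rw [e] at h
  rw [← h, ofReal_integral_eq_lintegral_ofReal]
  · by_contra hni
    rw [integral_undef hni] at h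
    have : 0 < 1 / (p * c) := by positivity
    linarith
  · filter_upwards [ae_restrict_mem measurableSet_Ioi] with t ht
    have : (0 : ℝ) < t := ht
    positivity

/-- Frullani's integral for `t ↦ exp (- t ^ p)`. -/
lemma lintegral_frullani {p a b : ℝ} (hp : 0 < p) (ha : 0 < a) (hb : 0 ≤ b) :
    ∫⁻ t in Ioi (0 : ℝ), ENNReal.ofReal t⁻¹ * (ENNReal.ofReal (exp (-a * t ^ p)) *
      ENNReal.ofReal (1 - exp (-b * t ^ p))) = ENNReal.ofReal (p⁻¹ * log (1 + b / a)) := by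
  have hab : a ≤ a + b := by linarith
  -- The difference of exponentials over `t` is an integral over the rate `c` from `a` to `a + b`.
  -- After interchanging the integrals the integral over `t` is `1 / (p c)`.
  have h1 : ∀ t ∈ Ioi (0 : ℝ), ENNReal.ofReal t⁻¹ * (ENNReal.ofReal (exp (-a * t ^ p)) *
      ENNReal.ofReal (1 - exp (-b * t ^ p))) =
      ∫⁻ c in Ioc a (a + b), ENNReal.ofReal (t ^ (p - 1) * exp (-c * t ^ p)) := by
    intro t ht
    have ht' : (0 : ℝ) < t := ht
    have htp : 0 < t ^ p := by positivity
    have hder : ∀ c : ℝ, HasDerivAt (fun c => -t⁻¹ * exp (-c * t ^ p))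
        (t ^ (p - 1) * exp (-c * t ^ p)) c := by
      intro c
      have h := (((hasDerivAt_id c).neg.mul_const (t ^ p)).exp).const_mul (-t⁻¹)
      refine h.congr_deriv ?_
      rw [rpow_sub_one ht'.ne']
      simp only [id, Pi.neg_apply]
      field_simp
    have hint : ∫ c in a..(a + b), t ^ (p - 1) * exp (-c * t ^ p) =
        -t⁻¹ * exp (-(a + b) * t ^ p) - -t⁻¹ * exp (-a * t ^ p) :=
      intervalIntegral.integral_eq_sub_of_hasDerivAt (fun c _ => hder c)
        (Continuous.intervalIntegrable (by fun_prop) _ _)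
    rw [intervalIntegral.integral_of_le hab] at hint
    rw [← ofReal_integral_eq_lintegral_ofReal
      ((Continuous.integrableOn_Icc (by fun_prop)).mono_set Ioc_subset_Icc_self)
      (ae_of_all _ fun c => by positivity), hint, ← ENNReal.ofReal_mul (by positivity),
      ← ENNReal.ofReal_mul (by positivity)]
    congr 1
    have : exp (-(a + b) * t ^ p) = exp (-a * t ^ p) * exp (-b * t ^ p) := by
      rw [← exp_add]; congr 1; ring
    rw [this]
    ring
  rw [setLIntegral_congr_fun measurableSet_Ioi h1, lintegral_lintegral_swap
    (Measurable.aemeasurable (by unfold Function.uncurry; fun_prop))]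
  have h2 : ∀ c ∈ Ioc a (a + b),
      ∫⁻ t in Ioi (0 : ℝ), ENNReal.ofReal (t ^ (p - 1) * exp (-c * t ^ p)) =
        ENNReal.ofReal (1 / (p * c)) := fun c hc => lintegral_rpow_mul_exp hp (ha.trans hc.1)
  rw [setLIntegral_congr_fun measurableSet_Ioc h2]
  have hpos : ∀ c ∈ Icc a (a + b), 0 < c := fun c hc => ha.trans_le hc.1
  have hcont : ContinuousOn (fun c : ℝ => 1 / (p * c)) (Icc a (a + b)) := by
    refine ContinuousOn.div continuousOn_const (by fun_prop) fun c hc => ?_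
    have := hpos c hc
    positivity
  rw [← ofReal_integral_eq_lintegral_ofReal
      (hcont.integrableOn_Icc.mono_set Ioc_subset_Icc_self) ?_,
    ← intervalIntegral.integral_of_le hab]
  · congr 1
    have e : ∀ c : ℝ, 1 / (p * c) = p⁻¹ * c⁻¹ := fun c => by rw [one_div, mul_inv]
    simp_rw [e]
    rw [intervalIntegral.integral_const_mul, integral_inv_of_pos ha (by linarith)]
    congr 2
    field_simp
  · filter_upwards [ae_restrict_mem measurableSet_Ioc] with c hc
    have := hpos c (Ioc_subset_Icc_self hc)
    positivity

lemma lintegral_prod_mul_swap {A B : Type*} [MeasurableSpace A] [MeasurableSpace B]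
    (m : Measure A) (n : Measure B) [SFinite m] [SFinite n] {u : ℝ → ℝ≥0∞} {f : A → ℝ → ℝ≥0∞}
    {g : B → ℝ → ℝ≥0∞} (hu : Measurable u) (hf : Measurable (Function.uncurry f))
    (hg : Measurable (Function.uncurry g)) :
    ∫⁻ x : A × B, (∫⁻ t in Ioi (0 : ℝ), u t * (f x.1 t * g x.2 t)) ∂(m.prod n) =
      ∫⁻ t in Ioi (0 : ℝ), u t * ((∫⁻ a, f a t ∂m) * ∫⁻ b, g b t ∂n) := by
  rw [lintegral_lintegral_swap]
  · refine lintegral_congr fun t => ?_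
    rw [lintegral_const_mul]
    · congr 1
      exact lintegral_prod_mul (hf.comp (by fun_prop : Measurable fun a => (a, t))).aemeasurable
        (hg.comp (by fun_prop : Measurable fun b => (b, t))).aemeasurable
    · exact (hf.comp (by fun_prop : Measurable fun x : A × B => (x.1, t))).mul
        (hg.comp (by fun_prop : Measurable fun x : A × B => (x.2, t)))
  · refine Measurable.aemeasurable ?_
    exact (hu.comp measurable_snd).mul
      ((hf.comp (by fun_prop : Measurable fun x : (A × B) × ℝ => (x.1.1, x.2))).mul
        (hg.comp (by fun_prop : Measurable fun x : (A × B) × ℝ => (x.1.2, x.2))))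

end Frullani

/-! ### Squared stable variables as Gaussian mixtures -/

section StableRatio

open Real

/-- `μ` is the symmetric `α`-stable law of scale parameter `κ = (scale) ^ α`. -/
structure IsStableLaw (α κ : ℝ) (μ : Measure ℝ) : Prop where
  charFun_eq : ∀ t : ℝ, charFun μ t = Complex.exp (-((κ * |t| ^ α : ℝ) : ℂ))

variable {α κ : ℝ} {μ ν : Measure ℝ} [IsProbabilityMeasure μ] [IsProbabilityMeasure ν]

/-- `exp (-t s²)` is the Gaussian characteristic function at `√(2t) s`. By Fubini's theorem the
stable characteristic function can be evaluated at `√(2t) g` instead and averaged over the Gaussian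
`g`. -/
lemma IsStableLaw.integral_exp_neg_sq (h : IsStableLaw α κ μ) {t : ℝ} (ht : 0 ≤ t) :
    ∫ s, exp (-(t * s ^ 2)) ∂μ = ∫ g, exp (-(κ * |g| ^ α * (2 * t) ^ (α / 2))) ∂(gaussianReal 0 1) := by
  have hc : ((∫ s, exp (-(t * s ^ 2)) ∂μ : ℝ) : ℂ) =
      ((∫ g, exp (-(κ * |g| ^ α * (2 * t) ^ (α / 2))) ∂(gaussianReal 0 1) : ℝ) : ℂ) := by
    have e1 : ∀ s : ℝ, ((exp (-(t * s ^ 2)) : ℝ) : ℂ) =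
        ∫ g : ℝ, Complex.exp ((√(2 * t) * s * g : ℝ) * Complex.I) ∂(gaussianReal 0 1) := by
      intro s
      have := charFun_gaussianReal (μ := 0) (v := 1) (√(2 * t) * s)
      rw [charFun_apply_real] at this
      push_cast at this ⊢
      rw [this]
      congr 1
      have h2 : ((√(2 * t) : ℝ) : ℂ) ^ 2 = 2 * t := by
        rw [← Complex.ofReal_pow, sq_sqrt (by positivity)]; push_cast; ring
      rw [mul_pow, h2]
      simp
      ring
    have e2 : ∀ g : ℝ, ((exp (-(κ * |g| ^ α * (2 * t) ^ (α / 2))) : ℝ) : ℂ) =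
        ∫ s : ℝ, Complex.exp ((√(2 * t) * s * g : ℝ) * Complex.I) ∂μ := by
      intro g
      have := h.charFun_eq (√(2 * t) * g)
      rw [charFun_apply_real] at this
      have e3 : |√(2 * t) * g| ^ α = |g| ^ α * (2 * t) ^ (α / 2) := by
        rw [abs_mul, abs_of_nonneg (sqrt_nonneg _), mul_rpow (sqrt_nonneg _) (abs_nonneg _),
          sqrt_eq_rpow, ← rpow_mul (by positivity), mul_comm]
        congr 2; ring
      rw [e3] at this
      rw [Complex.ofReal_exp, Complex.ofReal_neg, mul_assoc, ← this]
      refine integral_congr_ae (ae_of_all _ fun s => ?_)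
      push_cast
      ring_nf
    rw [← integral_complex_ofReal, ← integral_complex_ofReal]
    simp_rw [e1, e2]
    refine integral_integral_swap (f := fun s g : ℝ =>
      Complex.exp ((√(2 * t) * s * g : ℝ) * Complex.I)) ?_
    refine (integrable_const (1 : ℝ)).mono' ?_ (ae_of_all _ fun x => ?_)
    · exact Continuous.aestronglyMeasurable (by unfold Function.uncurry; fun_prop)
    · simp only [Function.uncurry, Complex.norm_exp_ofReal_mul_I, le_refl]
  exact_mod_cast hc

lemma IsStableLaw.integrable_exp (μ : Measure ℝ) [IsProbabilityMeasure μ] {f : ℝ → ℝ}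
    (hf : Measurable f) (hf0 : ∀ s, 0 ≤ f s) : Integrable (fun s => exp (-f s)) μ := by
  refine (integrable_const (1 : ℝ)).mono' (by fun_prop) (ae_of_all _ fun s => ?_)
  rw [norm_of_nonneg (exp_pos _).le, exp_le_one_iff]
  linarith [hf0 s]

lemma IsStableLaw.lintegral_exp_neg_sq (h : IsStableLaw α κ μ) (hκ : 0 ≤ κ) {t : ℝ} (ht : 0 ≤ t) :
    ∫⁻ s, ENNReal.ofReal (exp (-(t * s ^ 2))) ∂μ =
      ∫⁻ g, ENNReal.ofReal (exp (-(κ * |g| ^ α * (2 * t) ^ (α / 2)))) ∂(gaussianReal 0 1) := by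
  rw [← ofReal_integral_eq_lintegral_ofReal, ← ofReal_integral_eq_lintegral_ofReal,
    h.integral_exp_neg_sq ht]
  · exact integrable_exp _ (by fun_prop) fun g => by positivity
  · exact ae_of_all _ fun g => (exp_pos _).le
  · exact integrable_exp _ (by fun_prop) fun g => by positivity
  · exact ae_of_all _ fun g => (exp_pos _).le

lemma IsStableLaw.lintegral_one_sub_exp_neg_sq (h : IsStableLaw α κ μ) (hκ : 0 ≤ κ) {t : ℝ}
    (ht : 0 ≤ t) : ∫⁻ s, ENNReal.ofReal (1 - exp (-(t * s ^ 2))) ∂μ =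
      ∫⁻ g, ENNReal.ofReal (1 - exp (-(κ * |g| ^ α * (2 * t) ^ (α / 2)))) ∂(gaussianReal 0 1) := by
  have i1 : Integrable (fun s => exp (-(t * s ^ 2))) μ :=
    integrable_exp _ (by fun_prop) fun g => by positivity
  have i2 : Integrable (fun g => exp (-(κ * |g| ^ α * (2 * t) ^ (α / 2)))) (gaussianReal 0 1) :=
    integrable_exp _ (by fun_prop) fun g => by positivity
  rw [← ofReal_integral_eq_lintegral_ofReal, ← ofReal_integral_eq_lintegral_ofReal,
    integral_sub (integrable_const _) i1, integral_sub (integrable_const _) i2,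
    h.integral_exp_neg_sq ht]
  · simp
  · exact (integrable_const _).sub i2
  · refine ae_of_all _ fun g => ?_
    simp only [Pi.zero_apply, sub_nonneg, exp_le_one_iff, Left.neg_nonpos_iff]
    positivity
  · exact (integrable_const _).sub i1
  · refine ae_of_all _ fun g => ?_
    simp only [Pi.zero_apply, sub_nonneg, exp_le_one_iff, Left.neg_nonpos_iff]
    positivity

lemma ae_ne_zero_gaussianReal : ∀ᵐ g ∂(gaussianReal 0 1), g ≠ 0 := by
  have := nullSingletonClass_gaussianReal (μ := 0) (v := 1) one_ne_zero
  rw [ae_iff]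
  simp

/-- The mass of `0` is at most `∫ exp (-n s²)`, which tends to `0` by the Gaussian representation.
-/
lemma IsStableLaw.measure_singleton_zero (h : IsStableLaw α 1 μ) (hα : 0 < α) : μ {0} = 0 := by
  have hlim : Filter.Tendsto (fun n : ℕ =>
      ∫ g, exp (-(1 * |g| ^ α * (2 * (n : ℝ)) ^ (α / 2))) ∂(gaussianReal 0 1)) Filter.atTop
      (nhds (∫ _, (0 : ℝ) ∂(gaussianReal 0 1))) := by
    refine tendsto_integral_of_dominated_convergence (fun _ => 1)
      (fun n => Measurable.aestronglyMeasurable (by fun_prop))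
      (integrable_const _) (fun n => ae_of_all _ fun g => ?_) ?_
    · rw [norm_of_nonneg (exp_pos _).le, exp_le_one_iff, Left.neg_nonpos_iff]
      positivity
    · filter_upwards [ae_ne_zero_gaussianReal] with g hg
      have hg' : 0 < 1 * |g| ^ α := by have := abs_pos.2 hg; positivity
      refine tendsto_exp_atBot.comp (Filter.tendsto_neg_atTop_atBot.comp
        (Filter.Tendsto.const_mul_atTop hg' ?_))
      exact (tendsto_rpow_atTop (by positivity)).comp
        (Filter.Tendsto.const_mul_atTop two_pos tendsto_natCast_atTop_atTop)
  rw [integral_zero] at hlim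
  have hle : μ.real {0} ≤ 0 := by
    refine ge_of_tendsto' hlim fun n => ?_
    rw [← h.integral_exp_neg_sq (Nat.cast_nonneg n), ← integral_indicator_one (by simp)]
    refine integral_mono ((integrable_const (1 : ℝ)).indicator (by simp))
      (integrable_exp _ (by fun_prop) fun s => by positivity) fun s => ?_
    by_cases hs : s = 0
    · simp [hs]
    · rw [indicator_of_notMem (by simpa using hs)]
      positivity
  have := le_antisymm hle measureReal_nonneg
  rwa [measureReal_eq_zero_iff] at this

/-- The logarithmic transform of the squared ratio of two stable variables. -/
lemma lintegral_log_one_add_ratio (hα : 0 < α) (hκ : 0 ≤ κ) (hμ : IsStableLaw α 1 μ)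
    (hν : IsStableLaw α κ ν) {l : ℝ} (hl : 0 < l) :
    ∫⁻ x : ℝ × ℝ, ENNReal.ofReal (log (1 + l * (x.2 / x.1) ^ 2)) ∂(μ.prod ν) =
      ∫⁻ x : ℝ × ℝ, ENNReal.ofReal ((α / 2)⁻¹ * log (1 + l ^ (α / 2) * (κ * (|x.2| / |x.1|) ^ α)))
        ∂((gaussianReal 0 1).prod (gaussianReal 0 1)) := by
  have hb : 0 < α / 2 := by positivity
  -- Both logarithms are Frullani integrals, with exponent `1` on the stable side and `α / 2` on the
  -- Gaussian side. The integrands over `t` factor over the two independent variables and agree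
  -- factor by factor.
  have h1 : ∫⁻ x : ℝ × ℝ, ENNReal.ofReal (log (1 + l * (x.2 / x.1) ^ 2)) ∂(μ.prod ν) =
      ∫⁻ x : ℝ × ℝ, (∫⁻ t in Ioi (0 : ℝ), ENNReal.ofReal t⁻¹ *
        (ENNReal.ofReal (exp (-(t * x.1 ^ 2))) *
          ENNReal.ofReal (1 - exp (-(l * t * x.2 ^ 2))))) ∂(μ.prod ν) := by
    have hae : ∀ᵐ x ∂(μ.prod ν), x.1 ≠ 0 := by
      have h0 : ∀ᵐ s ∂μ, s ≠ 0 := by rw [ae_iff]; simpa using hμ.measure_singleton_zero hα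
      exact Measure.quasiMeasurePreserving_fst.ae h0
    refine lintegral_congr_ae ?_
    filter_upwards [hae] with x hx
    have := lintegral_frullani (p := 1) (a := x.1 ^ 2) (b := l * x.2 ^ 2) one_pos (by positivity)
      (by positivity)
    rw [inv_one, one_mul] at this
    rw [div_pow, ← mul_div_assoc, ← this]
    refine lintegral_congr fun t => ?_
    rw [rpow_one]
    ring_nf
  have h2 : ∫⁻ x : ℝ × ℝ, ENNReal.ofReal ((α / 2)⁻¹ *
        log (1 + l ^ (α / 2) * (κ * (|x.2| / |x.1|) ^ α)))
        ∂((gaussianReal 0 1).prod (gaussianReal 0 1)) =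
      ∫⁻ x : ℝ × ℝ, (∫⁻ t in Ioi (0 : ℝ), ENNReal.ofReal t⁻¹ *
        (ENNReal.ofReal (exp (-(1 * |x.1| ^ α * (2 * t) ^ (α / 2)))) *
          ENNReal.ofReal (1 - exp (-(κ * |x.2| ^ α * (2 * (l * t)) ^ (α / 2))))))
        ∂((gaussianReal 0 1).prod (gaussianReal 0 1)) := by
    have hae : ∀ᵐ x ∂((gaussianReal 0 1).prod (gaussianReal 0 1)), x.1 ≠ 0 :=
      Measure.quasiMeasurePreserving_fst.ae ae_ne_zero_gaussianReal
    refine lintegral_congr_ae ?_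
    filter_upwards [hae] with x hx
    have hx' : 0 < |x.1| := abs_pos.2 hx
    have := lintegral_frullani (p := α / 2) (a := 2 ^ (α / 2) * |x.1| ^ α)
      (b := κ * |x.2| ^ α * (2 * l) ^ (α / 2)) hb (by positivity) (by positivity)
    have e : κ * |x.2| ^ α * (2 * l) ^ (α / 2) / (2 ^ (α / 2) * |x.1| ^ α) =
        l ^ (α / 2) * (κ * (|x.2| / |x.1|) ^ α) := by
      rw [div_rpow (abs_nonneg _) (abs_nonneg _), mul_rpow two_pos.le hl.le]
      field_simp
    rw [e] at this
    rw [← this]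
    refine setLIntegral_congr_fun measurableSet_Ioi fun t ht => ?_
    have ht' : (0 : ℝ) < t := ht
    rw [← mul_assoc 2 l t, mul_rpow (by positivity : 0 ≤ 2 * l) ht'.le,
      mul_rpow two_pos.le ht'.le]
    ring_nf
  rw [h1, h2, lintegral_prod_mul_swap (f := fun a t => ENNReal.ofReal (exp (-(t * a ^ 2))))
    (g := fun a t => ENNReal.ofReal (1 - exp (-(l * t * a ^ 2)))) μ ν (by fun_prop)
    (by unfold Function.uncurry; fun_prop) (by unfold Function.uncurry; fun_prop),
    lintegral_prod_mul_swap
      (f := fun a t => ENNReal.ofReal (exp (-(1 * |a| ^ α * (2 * t) ^ (α / 2)))))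
      (g := fun a t => ENNReal.ofReal (1 - exp (-(κ * |a| ^ α * (2 * (l * t)) ^ (α / 2)))))
      _ _ (by fun_prop)
      (by unfold Function.uncurry; fun_prop) (by unfold Function.uncurry; fun_prop)]
  refine setLIntegral_congr_fun measurableSet_Ioi fun t ht => ?_
  have ht' : (0 : ℝ) < t := ht
  rw [hμ.lintegral_exp_neg_sq zero_le_one ht'.le,
    hν.lintegral_one_sub_exp_neg_sq hκ (by positivity : 0 ≤ l * t)]

lemma integrable_abs_rpow_gaussianReal {s : ℝ} (hs : -1 < s) :
    Integrable (fun g : ℝ => |g| ^ s) (gaussianReal 0 1) := by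
  rw [gaussianReal_of_var_ne_zero 0 one_ne_zero,
    integrable_withDensity_iff (measurable_gaussianPDF _ _) (by simp [gaussianPDF])]
  -- The real power of a negative base is not `|g| ^ s`. The function and its reflection are added,
  -- so that one of them gives the bound on each half-line.
  have h := integrable_rpow_mul_exp_neg_mul_sq (b := 1 / 2) (by norm_num) hs
  refine ((h.norm.add h.comp_neg.norm).const_mul ((√(2 * π * 1))⁻¹)).mono'
    (Measurable.aestronglyMeasurable (by fun_prop)) (ae_of_all _ fun g => ?_)
  rw [toReal_gaussianPDF, gaussianPDFReal]
  simp only [NNReal.coe_one, sub_zero, Pi.add_apply]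
  rw [norm_of_nonneg (by positivity), mul_left_comm]
  gcongr
  have e : -g ^ 2 / (2 * 1) = -(1 / 2) * g ^ 2 := by ring
  rw [e]
  rcases abs_cases g with ⟨h1, -⟩ | ⟨h1, -⟩ <;> rw [h1]
  · exact (le_abs_self _).trans (le_add_of_nonneg_right (norm_nonneg _))
  · rw [← neg_sq g]
    exact (le_abs_self _).trans (le_add_of_nonneg_left (norm_nonneg _))

/-- From `log (1 + y) ≤ 2 √y` it suffices that `|g| ^ (α/2)` and `|g| ^ (-α/2)` have finite Gaussian
mean. -/
lemma integrable_log_one_add_gaussian_ratio (hα : 0 < α) (hα1 : α < 1) (hκ : 0 ≤ κ) :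
    Integrable (fun x : ℝ × ℝ => log (1 + κ * (|x.2| / |x.1|) ^ α))
      ((gaussianReal 0 1).prod (gaussianReal 0 1)) := by
  have h := ((integrable_abs_rpow_gaussianReal (s := -(α / 2)) (by linarith)).mul_prod
    (integrable_abs_rpow_gaussianReal (s := α / 2) (by linarith))).const_mul (2 * √κ)
  refine h.mono' (Measurable.aestronglyMeasurable (by fun_prop)) (ae_of_all _ fun x => ?_)
  have hx : 0 ≤ κ * (|x.2| / |x.1|) ^ α := by positivity
  rw [norm_of_nonneg (log_nonneg (by linarith))]
  have e : |x.1| ^ (-(α / 2)) * |x.2| ^ (α / 2) = √((|x.2| / |x.1|) ^ α) := by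
    rw [sqrt_eq_rpow, ← rpow_mul (by positivity), div_rpow (abs_nonneg _) (abs_nonneg _),
      rpow_neg (abs_nonneg _), show α * (1 / 2) = α / 2 by ring]
    field_simp
  rw [e, mul_assoc, ← sqrt_mul hκ]
  set y := κ * (|x.2| / |x.1|) ^ α
  calc log (1 + y) ≤ log ((1 + √y) ^ 2) := by
        refine log_le_log (by linarith) ?_
        nlinarith [sq_sqrt hx, sqrt_nonneg y]
    _ = 2 * log (1 + √y) := by rw [log_pow]; norm_num
    _ ≤ 2 * √y := by
        have := log_le_sub_one_of_pos (show 0 < 1 + √y by have := sqrt_nonneg y; linarith)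
        linarith

end StableRatio

end GapEstimator

/-! ### The distribution function of the modulus of a stable ratio -/

namespace GapEstimator

open Real

/-- The distribution function at `d` of the modulus of the ratio of a stable variable of scale
parameter `κ` and a standard one, as a mixture over the ratio of two Gaussian variables. -/
noncomputable def ratioCdf (α κ d : ℝ) : ℝ :=
  ∫ x : ℝ × ℝ, (π * (α / 2) - rayAngle (π * (α / 2)) (d ^ (-α) * (κ * (|x.2| / |x.1|) ^ α)))
    ∂((gaussianReal 0 1).prod (gaussianReal 0 1))

section ratioCdf

variable {α κ : ℝ} {μ ν : Measure ℝ} [IsProbabilityMeasure μ] [IsProbabilityMeasure ν]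

lemma pi_mul_half_bounds (hα : 0 < α) (hα1 : α < 1) :
    0 < π * (α / 2) ∧ π * (α / 2) < π / 2 := by
  have := pi_pos
  constructor
  · positivity
  · nlinarith

lemma integrable_rayAngle {A : Type*} [MeasurableSpace A] (m : Measure A) [IsFiniteMeasure m]
    {β : ℝ} (h0 : 0 < β) (h1 : β < π / 2) {W : A → ℝ} (hW : Measurable W) (hW0 : ∀ a, 0 ≤ W a) :
    Integrable (fun a => rayAngle β (W a)) m :=
  (integrable_const β).mono' (measurable_rayAngle.comp hW).aestronglyMeasurable
    (ae_of_all _ fun a => by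
      rw [norm_of_nonneg (rayAngle_nonneg h0 h1 (hW0 a))]
      exact (rayAngle_lt h0 h1 (hW0 a)).le)

/-- Inversion of the logarithmic transform for the squared ratio, with `b = α / 2`. It shows that
`ratioCdf` carries the factor `π α / 2` relative to a probability; the two sides differ by the
possible atom at `d`. -/
lemma ratioCdf_sandwich (hα : 0 < α) (hα1 : α < 1) (hκ : 0 ≤ κ) (hμ : IsStableLaw α 1 μ)
    (hν : IsStableLaw α κ ν) {d : ℝ} (hd : 0 < d) :
    π * (α / 2) * (μ.prod ν).real {x | |x.2 / x.1| < d} ≤ ratioCdf α κ d ∧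
      ratioCdf α κ d ≤ π * (α / 2) * (μ.prod ν).real {x | |x.2 / x.1| ≤ d} := by
  obtain ⟨hβ0, hβ1⟩ := pi_mul_half_bounds hα hα1
  have hb : 0 < α / 2 := by positivity
  -- Scaling by `d ^ (-2)` moves the threshold of the squared ratio to `1`, where the inversion is
  -- available.
  set c : ℝ := d ^ (-2 : ℝ) with hc
  have hc0 : 0 < c := by positivity
  have hcα : c ^ (α / 2) = d ^ (-α) := by
    rw [hc, ← rpow_mul hd.le]; congr 1; ring
  have hL : ∀ l : ℝ, 0 < l → ∫⁻ x : ℝ × ℝ, ENNReal.ofReal (log (1 + l * (c * (x.2 / x.1) ^ 2)))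
      ∂(μ.prod ν) = ∫⁻ x : ℝ × ℝ, ENNReal.ofReal ((α / 2)⁻¹ *
        log (1 + l ^ (α / 2) * (d ^ (-α) * (κ * (|x.2| / |x.1|) ^ α))))
        ∂((gaussianReal 0 1).prod (gaussianReal 0 1)) := by
    intro l hl
    have := lintegral_log_one_add_ratio hα hκ hμ hν (mul_pos hl hc0)
    rw [mul_rpow hl.le hc0.le, hcα] at this
    simpa only [mul_assoc] using this
  have hW0 : ∀ x : ℝ × ℝ, 0 ≤ d ^ (-α) * (κ * (|x.2| / |x.1|) ^ α) := fun x => by positivity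
  have hX0 : ∀ x : ℝ × ℝ, 0 ≤ c * (x.2 / x.1) ^ 2 := fun x => by positivity
  have hXm : Measurable fun x : ℝ × ℝ => c * (x.2 / x.1) ^ 2 := by fun_prop
  have hWm : Measurable fun x : ℝ × ℝ => d ^ (-α) * (κ * (|x.2| / |x.1|) ^ α) := by fun_prop
  have hWint : Integrable (fun x : ℝ × ℝ => log (1 + d ^ (-α) * (κ * (|x.2| / |x.1|) ^ α)))
      ((gaussianReal 0 1).prod (gaussianReal 0 1)) := by
    have := integrable_log_one_add_gaussian_ratio (κ := d ^ (-α) * κ) hα hα1 (by positivity)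
    simpa only [mul_assoc] using this
  have hXint : Integrable (fun x : ℝ × ℝ => log (1 + c * (x.2 / x.1) ^ 2)) (μ.prod ν) := by
    have h1 := hL 1 one_pos
    simp only [one_rpow, one_mul] at h1
    refine (lintegral_ofReal_ne_top_iff_integrable
      (Measurable.aestronglyMeasurable (by fun_prop)) (ae_of_all _ fun x => ?_)).1 ?_
    · exact log_nonneg (by linarith [hX0 x])
    · rw [h1]
      exact ((hWint.const_mul (α / 2)⁻¹).lintegral_lt_top).ne
  have hfun : ∀ l : ℝ, 0 < l → ∫ x : ℝ × ℝ, log (1 + l * (c * (x.2 / x.1) ^ 2)) ∂(μ.prod ν) =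
      (α / 2)⁻¹ * ∫ x : ℝ × ℝ, log (1 + l ^ (α / 2) * (d ^ (-α) * (κ * (|x.2| / |x.1|) ^ α)))
        ∂((gaussianReal 0 1).prod (gaussianReal 0 1)) := by
    intro l hl
    rw [← integral_const_mul, integral_eq_lintegral_of_nonneg_ae (ae_of_all _ fun x => ?_)
      (Measurable.aestronglyMeasurable (by fun_prop)), hL l hl,
      integral_eq_lintegral_of_nonneg_ae (ae_of_all _ fun x => ?_)
      (Measurable.aestronglyMeasurable (by fun_prop))]
    · have h1 : 0 ≤ log (1 + l ^ (α / 2) * (d ^ (-α) * (κ * (|x.2| / |x.1|) ^ α))) :=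
        log_nonneg (by have := mul_nonneg (rpow_nonneg hl.le (α / 2)) (hW0 x); linarith)
      simp only [Pi.zero_apply]
      positivity
    · exact log_nonneg (by have := mul_nonneg hl.le (hX0 x); linarith)
  obtain ⟨h1, h2⟩ := measure_le_integral_rayAngle_le hXm hX0 hXint hWm hW0 hWint hb
    (by linarith) hfun
  have hiff : ∀ x : ℝ × ℝ, (1 < c * (x.2 / x.1) ^ 2 ↔ d < |x.2 / x.1|) ∧
      (1 ≤ c * (x.2 / x.1) ^ 2 ↔ d ≤ |x.2 / x.1|) := by
    intro x
    have hcd : c = (d ^ 2)⁻¹ := by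
      rw [hc, rpow_neg hd.le]; norm_num
    rw [hcd, ← sq_abs (x.2 / x.1), inv_mul_eq_div, one_lt_div (by positivity),
      one_le_div (by positivity)]
    exact ⟨sq_lt_sq₀ hd.le (abs_nonneg _), sq_le_sq₀ hd.le (abs_nonneg _)⟩
  have hms : MeasurableSet {x : ℝ × ℝ | d < |x.2 / x.1|} :=
    measurableSet_lt measurable_const (by fun_prop)
  have hms' : MeasurableSet {x : ℝ × ℝ | d ≤ |x.2 / x.1|} :=
    measurableSet_le measurable_const (by fun_prop)
  have e1 : (μ.prod ν).real {x | |x.2 / x.1| ≤ d} =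
      1 - (μ.prod ν).real {x | 1 < c * (x.2 / x.1) ^ 2} := by
    have : {x : ℝ × ℝ | |x.2 / x.1| ≤ d} = {x | d < |x.2 / x.1|}ᶜ := by
      ext x; simp
    rw [this, probReal_compl_eq_one_sub hms]
    simp_rw [(hiff _).1]
  have e2 : (μ.prod ν).real {x | |x.2 / x.1| < d} =
      1 - (μ.prod ν).real {x | 1 ≤ c * (x.2 / x.1) ^ 2} := by
    have : {x : ℝ × ℝ | |x.2 / x.1| < d} = {x | d ≤ |x.2 / x.1|}ᶜ := by
      ext x; simp
    rw [this, probReal_compl_eq_one_sub hms']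
    simp_rw [(hiff _).2]
  have e3 : ratioCdf α κ d = π * (α / 2) - ∫ x : ℝ × ℝ,
      rayAngle (π * (α / 2)) (d ^ (-α) * (κ * (|x.2| / |x.1|) ^ α))
      ∂((gaussianReal 0 1).prod (gaussianReal 0 1)) := by
    rw [ratioCdf, integral_sub (integrable_const _) (integrable_rayAngle _ hβ0 hβ1 hWm hW0)]
    simp
  rw [e1, e2, e3]
  constructor <;> nlinarith

/-- The inequality holds for each component of the mixture: `t ^ e (β - A(t))` increases in `t = d ^
(-α) w`, and with `e = 1 / (1 - α)` the power of `d` is `-α / (1 - α) = -1/γ`. -/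
lemma rpow_mul_ratioCdf_le (hα : 0 < α) (hα1 : α < 1) (hκ : 0 ≤ κ) {c d : ℝ} (hc : 0 < c)
    (hcd : c ≤ d) : c ^ (1 / gam α) * ratioCdf α κ d ≤ d ^ (1 / gam α) * ratioCdf α κ c := by
  obtain ⟨hβ0, hβ1⟩ := pi_mul_half_bounds hα hα1
  have hd := hc.trans_le hcd
  have hW0 : ∀ d : ℝ, 0 < d → ∀ x : ℝ × ℝ, 0 ≤ d ^ (-α) * (κ * (|x.2| / |x.1|) ^ α) :=
    fun d hd x => by positivity
  have hint : ∀ d : ℝ, 0 < d → Integrable (fun x : ℝ × ℝ => π * (α / 2) -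
      rayAngle (π * (α / 2)) (d ^ (-α) * (κ * (|x.2| / |x.1|) ^ α)))
      ((gaussianReal 0 1).prod (gaussianReal 0 1)) := fun d hd =>
    (integrable_const _).sub (integrable_rayAngle _ hβ0 hβ1 (by fun_prop) (hW0 d hd))
  rw [ratioCdf, ratioCdf, ← integral_const_mul, ← integral_const_mul]
  refine integral_mono ((hint d hd).const_mul _) ((hint c hc).const_mul _) fun x => ?_
  have hV : 0 ≤ κ * (|x.2| / |x.1|) ^ α := by positivity
  have hg : 0 < gam α := div_pos (by linarith) hα
  have hcd' : c ^ (1 / gam α) ≤ d ^ (1 / gam α) := rpow_le_rpow hc.le hcd (by positivity)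
  dsimp only
  generalize κ * (|x.2| / |x.1|) ^ α = w at *
  rcases hV.eq_or_lt with rfl | hw
  · simp only [mul_zero, rayAngle_zero, sub_zero]
    gcongr
  · have he : 1 / (1 - α) * (1 - 2 / π * (π * (α / 2))) = 1 := by
      have : 1 - α ≠ 0 := by linarith
      field_simp
    have hle : d ^ (-α) * w ≤ c ^ (-α) * w := by
      rw [rpow_neg hd.le, rpow_neg hc.le]
      gcongr
    have h := rpow_mul_sub_rayAngle_le hβ0 hβ1 he (by positivity) hle
    have hp : ∀ d : ℝ, 0 < d → (d ^ (-α) * w) ^ (1 / (1 - α)) =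
        (d ^ (1 / gam α))⁻¹ * w ^ (1 / (1 - α)) := by
      intro d hd
      rw [mul_rpow (by positivity) hw.le, ← rpow_mul hd.le, ← rpow_neg hd.le]
      congr 2
      rw [gam]
      field_simp
    rw [hp d hd, hp c hc] at h
    have hwp : 0 < w ^ (1 / (1 - α)) := by positivity
    have hcp : 0 < c ^ (1 / gam α) := by positivity
    have hdp : 0 < d ^ (1 / gam α) := by positivity
    rw [mul_right_comm, mul_right_comm _ (w ^ _)] at h
    have h' := le_of_mul_le_mul_right h hwp
    rw [inv_mul_le_iff₀ hdp] at h'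
    calc _ ≤ c ^ (1 / gam α) * (d ^ (1 / gam α) * ((c ^ (1 / gam α))⁻¹ *
          (π * (α / 2) - rayAngle (π * (α / 2)) (c ^ (-α) * w)))) := by gcongr
      _ = _ := by field_simp

/-- The Gaussian ratio `V = (|g₂| / |g₁|) ^ α` and its inverse have the same law. Averaging the
integrands at `t V` and `t / V`, `t = (θ/ε) ^ α`, leaves `β` minus the increase of the angle from `V
/ t` to `t V`, which `rayAngle_sub_le` bounds pointwise. -/
lemma ratioCdf_ge (hα : 0 < α) (hα1 : α < 1) (hκ : 0 ≤ κ) {ε θ : ℝ} (hε : 0 < ε) (hεθ : ε ≤ θ)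
    (hκθ : κ ≤ θ ^ α) : π * (α / 2) ≤ ((θ / ε) ^ (1 / gam α) + 1) * ratioCdf α κ ε := by
  obtain ⟨hβ0, hβ1⟩ := pi_mul_half_bounds hα hα1
  have hθ := hε.trans_le hεθ
  set β := π * (α / 2) with hβ
  set G := (gaussianReal 0 1).prod (gaussianReal 0 1) with hG
  set t : ℝ := (θ / ε) ^ α with ht
  have hr1 : 1 ≤ θ / ε := by rwa [one_le_div hε]
  have ht1 : 1 ≤ t := one_le_rpow hr1 hα.le
  set V : ℝ × ℝ → ℝ := fun x => (|x.2| / |x.1|) ^ α with hV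
  have hVm : Measurable V := by fun_prop
  have hV0 : ∀ x, 0 ≤ V x := fun x => by positivity
  have hint : ∀ W : ℝ × ℝ → ℝ, Measurable W → (∀ x, 0 ≤ W x) →
      Integrable (fun x => β - rayAngle β (W x)) G := fun W hW hW0 =>
    (integrable_const _).sub (integrable_rayAngle _ hβ0 hβ1 hW hW0)
  have h1 : ∫ x, (β - rayAngle β (t * V x)) ∂G ≤ ratioCdf α κ ε := by
    refine integral_mono (hint _ (by fun_prop) fun x => mul_nonneg (by positivity) (hV0 x))
      (hint _ (by fun_prop) fun x => by positivity) fun x => ?_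
    dsimp only
    refine sub_le_sub_left (rayAngle_mono hβ0 hβ1 (by positivity) ?_) _
    rw [← mul_assoc, ht, div_rpow hθ.le hε.le, rpow_neg hε.le, div_eq_inv_mul (θ ^ α)]
    exact mul_le_mul_of_nonneg_right (mul_le_mul_of_nonneg_left hκθ
      (inv_nonneg.2 (rpow_nonneg hε.le α))) (hV0 x)
  have h2 : ∫ x, (β - rayAngle β (t * V x)) ∂G = ∫ x, (β - rayAngle β (t * (V x)⁻¹)) ∂G := by
    rw [hG, ← integral_prod_swap]
    refine integral_congr_ae (ae_of_all _ fun x => ?_)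
    simp only [hV, Prod.fst_swap, Prod.snd_swap]
    rw [← inv_rpow (by positivity), inv_div]
  have hpos : ∀ᵐ x ∂G, 0 < V x := by
    filter_upwards [Measure.quasiMeasurePreserving_fst.ae ae_ne_zero_gaussianReal,
      Measure.quasiMeasurePreserving_snd.ae ae_ne_zero_gaussianReal] with x h1 h2
    have := abs_pos.2 h1
    have := abs_pos.2 h2
    positivity
  set ρ := (θ / ε) ^ (1 / gam α) with hρ
  have hg : 0 < gam α := div_pos (by linarith) hα
  have hρ1 : 1 ≤ ρ := one_le_rpow hr1 (by positivity)
  have h3 : 2 * β ≤ (ρ + 1) * (∫ x, (β - rayAngle β (t * V x)) ∂G +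
      ∫ x, (β - rayAngle β (t * (V x)⁻¹)) ∂G) := by
    rw [← integral_add (hint _ (by fun_prop) fun x => mul_nonneg (by positivity) (hV0 x))
      (hint _ (by fun_prop) fun x => mul_nonneg (by positivity) (inv_nonneg.2 (hV0 x))),
      ← integral_const_mul]
    have e : 2 * β = ∫ _, 2 * β ∂G := by simp
    rw [e]
    refine integral_mono_ae (integrable_const _) (((hint _ (by fun_prop) fun x =>
      mul_nonneg (by positivity) (hV0 x)).add (hint _ (by fun_prop) fun x =>
      mul_nonneg (by positivity) (inv_nonneg.2 (hV0 x)))).const_mul _) ?_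
    filter_upwards [hpos] with x hx
    -- Inversion makes the second integrand the angle at `V / t`. The arguments `V / t` and `t V`
    -- differ by `t²`, and `(t²) ^ (1 / (1 - α)) = ρ²`.
    have e1 : rayAngle β (t * (V x)⁻¹) = β - rayAngle β (V x / t) := by
      rw [← rayAngle_inv hβ0 hβ1 (by positivity), inv_div, div_eq_mul_inv]
    have he : 1 / (1 - α) * (1 - 2 / π * β) = 1 := by
      have : 1 - α ≠ 0 := by linarith
      rw [hβ]
      field_simp
    have hsub := rayAngle_sub_le (x := V x / t) (y := t * V x) hβ0 hβ1 he (by positivity)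
      (by rw [div_le_iff₀ (by positivity)]
          have : V x * 1 ≤ V x * (t * t) := by gcongr; nlinarith
          linarith) hρ1 (by
        have e2 : t * V x = t ^ 2 * (V x / t) := by field_simp
        rw [e2, mul_rpow (by positivity) (by positivity)]
        congr 1
        rw [← rpow_natCast, ← rpow_mul (by positivity), ht, ← rpow_mul (by positivity), hρ,
          ← rpow_natCast, ← rpow_mul (by positivity), gam]
        congr 1
        push_cast
        field_simp)
    rw [e1]
    nlinarith
  rw [← h2] at h3
  have : (ρ + 1) * ∫ x, (β - rayAngle β (t * V x)) ∂G ≤ (ρ + 1) * ratioCdf α κ ε := by gcongr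
  linarith

/-- The two properties of the law of the modulus of the ratio that the gap bound uses. -/
theorem ratio_law (hα : 0 < α) (hα1 : α < 1) (hκ : 0 ≤ κ) (hμ : IsStableLaw α 1 μ)
    (hν : IsStableLaw α κ ν) :
    (∀ c d : ℝ, 0 < c → c ≤ d →
      c ^ (1 / gam α) * (μ.prod ν).real {x | |x.2 / x.1| ≤ d} ≤
        d ^ (1 / gam α) * (μ.prod ν).real {x | |x.2 / x.1| ≤ c}) ∧
    ∀ ε θ : ℝ, 0 < ε → ε ≤ θ → κ ≤ θ ^ α →
      1 ≤ ((θ / ε) ^ (1 / gam α) + 1) * (μ.prod ν).real {x | |x.2 / x.1| ≤ ε} := by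
  obtain ⟨hβ0, hβ1⟩ := pi_mul_half_bounds hα hα1
  refine ⟨fun c d hc hcd => ?_, fun ε θ hε hεθ hκθ => ?_⟩
  · have hd := hc.trans_le hcd
    have hcp : 0 < c ^ (1 / gam α) := by positivity
    -- The lower sandwich bound only sees `{|x.2 / x.1| < d'}`; letting `d'` decrease to `d` yields
    -- the closed event.
    have hlim : Filter.Tendsto (fun d' : ℝ => d' ^ (1 / gam α) *
        (μ.prod ν).real {x | |x.2 / x.1| ≤ c}) (nhdsWithin d (Ioi d))
        (nhds (d ^ (1 / gam α) * (μ.prod ν).real {x | |x.2 / x.1| ≤ c})) := by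
      refine Filter.Tendsto.mul_const _ (Filter.Tendsto.mono_left ?_ nhdsWithin_le_nhds)
      exact (continuousAt_rpow_const d _ (Or.inl hd.ne')).tendsto
    refine ge_of_tendsto hlim ?_
    filter_upwards [self_mem_nhdsWithin] with d' hd'
    have hdd : d < d' := hd'
    have hd0 := hd.trans hdd
    refine le_of_mul_le_mul_left ?_ hβ0
    have s1 := (ratioCdf_sandwich hα hα1 hκ hμ hν hd0).1
    have s2 := (ratioCdf_sandwich hα hα1 hκ hμ hν hc).2
    have s3 := rpow_mul_ratioCdf_le hα hα1 hκ hc (hcd.trans hdd.le)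
    have s4 : (μ.prod ν).real {x | |x.2 / x.1| ≤ d} ≤ (μ.prod ν).real {x | |x.2 / x.1| < d'} :=
      measureReal_mono fun x hx => lt_of_le_of_lt hx hdd
    calc π * (α / 2) * (c ^ (1 / gam α) * (μ.prod ν).real {x | |x.2 / x.1| ≤ d})
        ≤ π * (α / 2) * (c ^ (1 / gam α) * (μ.prod ν).real {x | |x.2 / x.1| < d'}) := by gcongr
      _ = c ^ (1 / gam α) * (π * (α / 2) * (μ.prod ν).real {x | |x.2 / x.1| < d'}) := by ring
      _ ≤ c ^ (1 / gam α) * ratioCdf α κ d' := by gcongr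
      _ ≤ d' ^ (1 / gam α) * ratioCdf α κ c := s3
      _ ≤ d' ^ (1 / gam α) * (π * (α / 2) * (μ.prod ν).real {x | |x.2 / x.1| ≤ c}) := by gcongr
      _ = _ := by ring
  · have h1 := ratioCdf_ge hα hα1 hκ hε hεθ hκθ
    have h2 := (ratioCdf_sandwich hα hα1 hκ hμ hν hε).2
    refine le_of_mul_le_mul_left ?_ hβ0
    have : 0 ≤ (θ / ε) ^ (1 / gam α) + 1 := by have := hε.trans_le hεθ; positivity
    calc _ = π * (α / 2) := mul_one _
      _ ≤ _ := h1
      _ ≤ ((θ / ε) ^ (1 / gam α) + 1) *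
          (π * (α / 2) * (μ.prod ν).real {x | |x.2 / x.1| ≤ ε}) := by gcongr
      _ = _ := by ring

end ratioCdf

end GapEstimator

/-! ### The expected sum of the two smallest values under the extremal law -/

namespace GapEstimator

section BetaIntegral

variable {δ : ℝ}

lemma hasDerivAt_mul_one_sub_rpow_pow {u : ℝ} (hu : 0 < u) (δ : ℝ) (k : ℕ) :
    HasDerivAt (fun u : ℝ => u * (1 - u ^ δ) ^ k)
      ((1 - u ^ δ) ^ k - k * δ * (u ^ δ * (1 - u ^ δ) ^ (k - 1))) u := by
  have h1 : HasDerivAt (fun u : ℝ => u ^ δ) (δ * u ^ (δ - 1)) u :=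
    Real.hasDerivAt_rpow_const (Or.inl hu.ne')
  have h2 := (hasDerivAt_id u).mul ((h1.const_sub 1).pow k)
  refine h2.congr_deriv ?_
  simp only [id, Real.rpow_sub_one hu.ne', Pi.pow_apply]
  field_simp
  ring

lemma continuous_one_sub_rpow_pow (hδ : 0 < δ) (k : ℕ) :
    Continuous fun u : ℝ => (1 - u ^ δ) ^ k :=
  (continuous_const.sub (Real.continuous_rpow_const hδ.le)).pow k

lemma continuous_rpow_mul_one_sub_rpow_pow (hδ : 0 < δ) (k : ℕ) :
    Continuous fun u : ℝ => u ^ δ * (1 - u ^ δ) ^ k :=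
  (Real.continuous_rpow_const hδ.le).mul (continuous_one_sub_rpow_pow hδ k)

/-- Integration by parts: `u (1 - u ^ δ) ^ k` vanishes at both ends since `k ≠ 0`. -/
lemma integral_one_sub_rpow_pow_eq (hδ : 0 < δ) {k : ℕ} (hk : k ≠ 0) :
    ∫ u in (0 : ℝ)..1, (1 - u ^ δ) ^ k =
      k * δ * ∫ u in (0 : ℝ)..1, u ^ δ * (1 - u ^ δ) ^ (k - 1) := by
  have hc := continuous_one_sub_rpow_pow hδ k
  have hc' := continuous_rpow_mul_one_sub_rpow_pow hδ (k - 1)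
  have h := intervalIntegral.integral_eq_sub_of_hasDerivAt_of_le (zero_le_one (α := ℝ))
    (continuous_id.mul hc).continuousOn
    (fun u hu => hasDerivAt_mul_one_sub_rpow_pow hu.1 δ k)
    ((hc.sub (continuous_const.mul hc')).intervalIntegrable _ _)
  rw [intervalIntegral.integral_sub (hc.intervalIntegrable _ _)
    ((hc'.intervalIntegrable _ _).const_mul _), intervalIntegral.integral_const_mul] at h
  simp [hk] at h
  linarith

lemma integral_one_sub_rpow_pow {γ : ℝ} (hγ : 0 < γ) (k : ℕ) :
    ∫ u in (0 : ℝ)..1, (1 - u ^ (1 / γ)) ^ k = betaProd γ k := by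
  have hδ : 0 < 1 / γ := by positivity
  induction k with
  | zero => simp [betaProd]
  | succ k ih =>
    have h := integral_one_sub_rpow_pow_eq hδ k.succ_ne_zero
    have hc := continuous_one_sub_rpow_pow hδ k
    have hc' := continuous_rpow_mul_one_sub_rpow_pow hδ k
    have h2 : ∫ u in (0 : ℝ)..1, (1 - u ^ (1 / γ)) ^ (k + 1) =
        (∫ u in (0 : ℝ)..1, (1 - u ^ (1 / γ)) ^ k) -
          ∫ u in (0 : ℝ)..1, u ^ (1 / γ) * (1 - u ^ (1 / γ)) ^ k := by
      rw [← intervalIntegral.integral_sub (hc.intervalIntegrable _ _)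
        (hc'.intervalIntegrable _ _)]
      congr 1 with u
      ring
    simp only [Nat.succ_eq_add_one, Nat.add_sub_cancel] at h
    rw [ih] at h2
    rw [betaProd_succ]
    set J := ∫ u in (0 : ℝ)..1, (1 - u ^ (1 / γ)) ^ (k + 1)
    set I := ∫ u in (0 : ℝ)..1, u ^ (1 / γ) * (1 - u ^ (1 / γ)) ^ k
    push_cast at h ⊢
    have hI : I = betaProd γ k - J := by linarith
    rw [hI] at h
    field_simp at h ⊢
    linarith

/-- The expected sum of the two smallest of `k` variables with distribution function `u ^ δ` on
the unit interval is the integral of this function at `u ^ δ`. -/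
def twoLowest (k : ℕ) (w : ℝ) : ℝ := 2 * (1 - w) ^ k + k * (w * (1 - w) ^ (k - 1))

lemma integral_twoLowest {γ : ℝ} (hγ : 0 < γ) {k : ℕ} (hk : k ≠ 0) :
    ∫ u in (0 : ℝ)..1, twoLowest k (u ^ (1 / γ)) = γ * gapConst γ k := by
  have hδ : 0 < 1 / γ := by positivity
  have hc := continuous_one_sub_rpow_pow hδ k
  have hc' := continuous_rpow_mul_one_sub_rpow_pow hδ (k - 1)
  have h := integral_one_sub_rpow_pow_eq hδ hk
  simp only [twoLowest]
  rw [intervalIntegral.integral_add ((hc.intervalIntegrable _ _).const_mul _)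
    ((hc'.intervalIntegrable _ _).const_mul _), intervalIntegral.integral_const_mul,
    intervalIntegral.integral_const_mul]
  rw [integral_one_sub_rpow_pow hγ k] at h ⊢
  rw [gapConst]
  have h' : (k : ℝ) * ∫ u in (0 : ℝ)..1, u ^ (1 / γ) * (1 - u ^ (1 / γ)) ^ (k - 1) =
      γ * betaProd γ k := by
    rw [h]; field_simp
  rw [h']
  field_simp
  ring

lemma continuous_twoLowest (k : ℕ) : Continuous (twoLowest k) := by
  unfold twoLowest; fun_prop

lemma twoLowest_nonneg {w : ℝ} (hw : w ∈ Icc (0 : ℝ) 1) (k : ℕ) : 0 ≤ twoLowest k w := by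
  have h0 := hw.1
  have : 0 ≤ 1 - w := sub_nonneg.2 hw.2
  unfold twoLowest
  positivity

lemma twoLowest_antitoneOn {k : ℕ} (hk : 2 ≤ k) : AntitoneOn (twoLowest k) (Icc 0 1) := by
  have hd : ∀ w : ℝ, HasDerivAt (twoLowest k)
      (-(k * (1 - w) ^ (k - 1)) - k * (w * ((k - 1 : ℕ) * (1 - w) ^ (k - 1 - 1)))) w := fun w => by
    have h1 : HasDerivAt (fun w : ℝ => 1 - w) (-1) w := (hasDerivAt_id w).const_sub 1
    have h := ((h1.pow k).const_mul 2).add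
      (((hasDerivAt_id w).mul (h1.pow (k - 1))).const_mul (k : ℝ))
    refine h.congr_deriv ?_
    simp only [id, Pi.pow_apply]
    ring
  refine antitoneOn_of_deriv_nonpos (convex_Icc 0 1) (continuous_twoLowest k).continuousOn
    (fun w _ => (hd w).differentiableAt.differentiableWithinAt) fun w hw => ?_
  rw [interior_Icc] at hw
  rw [(hd w).deriv]
  have h0 := hw.1
  have : 0 < 1 - w := sub_pos.2 hw.2
  have : 0 ≤ (k * (1 - w) ^ (k - 1)) + k * (w * ((k - 1 : ℕ) * (1 - w) ^ (k - 1 - 1))) := by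
    positivity
  linarith

lemma lintegral_twoLowest {γ y : ℝ} (hγ : 0 < γ) (hy : 0 < y) {k : ℕ} (hk : k ≠ 0) :
    ∫⁻ v in Ioo 0 y, ENNReal.ofReal (twoLowest k ((v / y) ^ (1 / γ))) =
      ENNReal.ofReal (y * (γ * gapConst γ k)) := by
  have hδ : 0 < 1 / γ := by positivity
  have hc : Continuous fun v : ℝ => twoLowest k ((v / y) ^ (1 / γ)) :=
    (continuous_twoLowest k).comp ((Real.continuous_rpow_const hδ.le).comp (continuous_id.div_const y))
  rw [← ofReal_integral_eq_lintegral_ofReal]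
  · congr 1
    rw [← integral_Ioc_eq_integral_Ioo, ← intervalIntegral.integral_of_le hy.le,
      intervalIntegral.integral_comp_div (fun u => twoLowest k (u ^ (1 / γ))) hy.ne']
    simp [hy.ne', ← integral_twoLowest hγ hk]
  · exact (hc.integrableOn_Icc (a := 0) (b := y)).mono_set Ioo_subset_Icc_self
  · filter_upwards [ae_restrict_mem measurableSet_Ioo] with v hv
    have h0 : 0 ≤ v / y := div_nonneg hv.1.le hy.le
    exact twoLowest_nonneg ⟨by positivity, Real.rpow_le_one h0 ((div_le_one hy).2 hv.2.le) hδ.le⟩ k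

end BetaIntegral

/-! ### Product measures: resampling one coordinate, independent blocks -/

section Pi

variable {ι : Type*} [Fintype ι] [DecidableEq ι] (ρ : Measure ℝ) [IsProbabilityMeasure ρ]

lemma measurePreserving_update (c : ι) :
    MeasurePreserving (fun p : ℝ × (ι → ℝ) => Function.update p.2 c p.1)
      (ρ.prod (Measure.pi fun _ => ρ)) (Measure.pi fun _ => ρ) := by
  have hm : Measurable fun p : ℝ × (ι → ℝ) => Function.update p.2 c p.1 := by
    rw [measurable_pi_iff]
    intro j
    rcases eq_or_ne j c with rfl | h
    · simpa using measurable_fst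
    · simpa [h, Function.comp_def] using (measurable_pi_apply j).comp measurable_snd
  refine ⟨hm, Eq.symm (Measure.pi_eq fun s hs => ?_)⟩
  rw [Measure.map_apply hm (MeasurableSet.univ_pi hs)]
  have : (fun p : ℝ × (ι → ℝ) => Function.update p.2 c p.1) ⁻¹' univ.pi s =
      s c ×ˢ univ.pi (Function.update s c univ) := by
    ext p
    simp only [mem_preimage, mem_univ_pi, mem_prod]
    constructor
    · intro h
      refine ⟨by simpa using h c, fun j => ?_⟩
      rcases eq_or_ne j c with rfl | hj
      · simp
      · simpa [hj] using h j
    · rintro ⟨h1, h2⟩ j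
      rcases eq_or_ne j c with rfl | hj
      · simpa using h1
      · simpa [hj] using h2 j
  rw [this, Measure.prod_prod, Measure.pi_pi, ← Finset.mul_prod_erase _ _ (Finset.mem_univ c),
    ← Finset.mul_prod_erase _ (fun j => ρ (s j)) (Finset.mem_univ c)]
  simp only [Function.update_self, measure_univ, one_mul]
  congr 1
  exact Finset.prod_congr rfl fun j hj => by
    rw [Function.update_of_ne (Finset.ne_of_mem_erase hj)]

lemma pi_apply_eq_lintegral_update (c : ι) {E : Set (ι → ℝ)} (hE : MeasurableSet E) :
    (Measure.pi fun _ => ρ) E =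
      ∫⁻ y, (Measure.pi fun _ => ρ) {x | Function.update x c y ∈ E} ∂ρ := by
  have h := measurePreserving_update ρ c
  rw [← h.measure_preimage hE.nullMeasurableSet, Measure.prod_apply (h.measurable hE)]
  rfl

lemma pi_apply_eq_lintegral_update' (c : ι) {E : Set (ι → ℝ)} (hE : MeasurableSet E) :
    (Measure.pi fun _ => ρ) E =
      ∫⁻ x, ρ {y | Function.update x c y ∈ E} ∂(Measure.pi fun _ => ρ) := by
  have h := measurePreserving_update ρ c
  rw [← h.measure_preimage hE.nullMeasurableSet, Measure.prod_apply_symm (h.measurable hE)]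
  rfl

lemma pi_setOf_forall_mem (A : Finset ι) (s : ι → Set ℝ) :
    (Measure.pi fun _ => ρ) {x : ι → ℝ | ∀ j ∈ A, x j ∈ s j} = ∏ j ∈ A, ρ (s j) := by
  have : {x : ι → ℝ | ∀ j ∈ A, x j ∈ s j} = univ.pi fun j => if j ∈ A then s j else univ := by
    ext x
    simp only [mem_ofPred_eq, mem_univ_pi]
    refine forall_congr' fun j => ?_
    by_cases hj : j ∈ A <;> simp [hj]
  rw [this, Measure.pi_pi]
  have h3 : ∀ j, ρ (if j ∈ A then s j else univ) = if j ∈ A then ρ (s j) else 1 := fun j => by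
    split_ifs <;> simp
  simp_rw [h3]
  rw [Finset.prod_ite_mem, Finset.univ_inter]

lemma pi_setOf_two_blocks {A B : Finset ι} (hAB : Disjoint A B) (s t : Set ℝ) :
    (Measure.pi fun _ => ρ) {x : ι → ℝ | (∀ j ∈ A, x j ∈ s) ∧ ∀ j ∈ B, x j ∈ t} =
      ρ s ^ A.card * ρ t ^ B.card := by
  have h := pi_setOf_forall_mem ρ (A ∪ B) fun j => if j ∈ A then s else t
  rw [Finset.prod_union hAB, Finset.prod_congr rfl fun j hj => by rw [if_pos hj],
    Finset.prod_congr (s₁ := B) rfl fun j hj => by rw [if_neg (Finset.disjoint_right.1 hAB hj)],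
    Finset.prod_const, Finset.prod_const] at h
  rw [← h]
  congr 1
  ext x
  simp only [mem_ofPred_eq, Finset.mem_union]
  constructor
  · rintro ⟨h1, h2⟩ j hj
    split_ifs with hA
    exacts [h1 j hA, h2 j (hj.resolve_left hA)]
  · intro h
    refine ⟨fun j hj => by simpa [hj] using h j (.inl hj), fun j hj => ?_⟩
    simpa [Finset.disjoint_right.1 hAB hj] using h j (.inr hj)

lemma pi_setOf_three_blocks {b : ι} {B R : Finset ι} (hb : b ∈ B) (hBR : Disjoint B R)
    (r s t : Set ℝ) :
    (Measure.pi fun _ => ρ)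
        {x : ι → ℝ | x b ∈ r ∧ (∀ j ∈ B.erase b, x j ∈ s) ∧ ∀ j ∈ R, x j ∈ t} =
      ρ r * (ρ s ^ (B.card - 1) * ρ t ^ R.card) := by
  have h := pi_setOf_forall_mem ρ (insert b (B.erase b ∪ R))
    fun j => if j = b then r else if j ∈ B then s else t
  have hbR : b ∉ R := Finset.disjoint_left.1 hBR hb
  rw [Finset.prod_insert (by simp [hbR]),
    Finset.prod_union (hBR.mono_left (Finset.erase_subset _ _)),
    Finset.prod_congr (s₁ := B.erase b) rfl fun j hj => by
      rw [if_neg (Finset.ne_of_mem_erase hj), if_pos (Finset.mem_of_mem_erase hj)],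
    Finset.prod_congr (s₁ := R) rfl fun j hj => by
      rw [if_neg (ne_of_mem_of_not_mem hj hbR), if_neg (Finset.disjoint_right.1 hBR hj)],
    Finset.prod_const, Finset.prod_const, if_pos rfl, Finset.card_erase_of_mem hb] at h
  rw [← h]
  congr 1
  ext x
  simp only [mem_ofPred_eq, Finset.mem_union, Finset.mem_insert]
  constructor
  · rintro ⟨h0, h1, h2⟩ j (rfl | hj | hj)
    · simpa using h0
    · simpa [Finset.ne_of_mem_erase hj, Finset.mem_of_mem_erase hj] using h1 j hj
    · simpa [ne_of_mem_of_not_mem hj hbR, Finset.disjoint_right.1 hBR hj] using h2 j hj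
  · intro h
    refine ⟨by simpa using h b (.inl rfl), fun j hj => ?_, fun j hj => ?_⟩
    · simpa [Finset.ne_of_mem_erase hj, Finset.mem_of_mem_erase hj] using h j (.inr (.inl hj))
    · simpa [ne_of_mem_of_not_mem hj hbR, Finset.disjoint_right.1 hBR hj] using h j (.inr (.inr hj))

end Pi

end GapEstimator

/-! ### Laws with slowly growing distribution function -/

namespace GapEstimator

/-- The distribution function of `ρ` grows on the positive half-line at most like `d ^ (1 / γ)`. -/
def SlowCdf (γ : ℝ) (ρ : Measure ℝ) : Prop :=
  ∀ c d : ℝ, 0 < c → c ≤ d → c ^ (1 / γ) * ρ.real (Iic d) ≤ d ^ (1 / γ) * ρ.real (Iic c)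

section SlowCdf

lemma measureReal_Ioc_eq_sub {ρ : Measure ℝ} [IsFiniteMeasure ρ] {c d : ℝ} (h : c ≤ d) :
    ρ.real (Ioc c d) = ρ.real (Iic d) - ρ.real (Iic c) := by
  rw [← Iic_sdiff_Iic, measureReal_sdiff (Iic_subset_Iic.2 h) measurableSet_Iic]

variable {γ : ℝ} {ρ : Measure ℝ} [IsProbabilityMeasure ρ]

/-- The growth condition gives `F(y + τ) ≤ (1 + τ/y) ^ (1/γ) F(y)`, and since `1/γ ≤ 1`, Bernoulli's
inequality bounds the power by `1 + τ / (γ y)`. -/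
lemma SlowCdf.measure_Ioc_le (h : SlowCdf γ ρ) (hγ : 1 ≤ γ) {y : ℝ} (hy : 0 < y) (τ : ℝ) :
    ρ (Ioc y (y + τ)) ≤ ENNReal.ofReal (ρ.real (Iic y) / (γ * y)) * ENNReal.ofReal τ := by
  rcases le_or_gt τ 0 with hτ | hτ
  · rw [Ioc_eq_empty (by linarith)]
    simp
  have hγ0 : 0 < γ := by linarith
  have h1 : ρ.real (Iic (y + τ)) ≤ (1 + 1 / γ * (τ / y)) * ρ.real (Iic y) := by
    have hB : (1 + τ / y) ^ (1 / γ) ≤ 1 + 1 / γ * (τ / y) :=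
      rpow_one_add_le_one_add_mul_self (by have := div_pos hτ hy; linarith) (by positivity)
        ((div_le_one hγ0).2 hγ)
    have h2 := h y (y + τ) hy (by linarith)
    have h3 : y + τ = y * (1 + τ / y) := by field_simp
    have h4 : (y + τ) ^ (1 / γ) = y ^ (1 / γ) * (1 + τ / y) ^ (1 / γ) := by
      rw [h3, Real.mul_rpow hy.le (by positivity)]
    rw [h4, mul_assoc] at h2
    have h5 := le_of_mul_le_mul_left h2 (by positivity)
    exact h5.trans (mul_le_mul_of_nonneg_right hB measureReal_nonneg)
  have h6 : ρ.real (Ioc y (y + τ)) = ρ.real (Iic (y + τ)) - ρ.real (Iic y) := by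
    exact measureReal_Ioc_eq_sub (by linarith)
  rw [← ofReal_measureReal, ← ENNReal.ofReal_mul (by positivity), h6]
  refine ENNReal.ofReal_le_ofReal ?_
  have : ρ.real (Iic y) / (γ * y) * τ = 1 / γ * (τ / y) * ρ.real (Iic y) := by field_simp
  linarith

/-- Let `c` increase to `y` in the growth condition: `F` has no jump on the positive half-line. An
atom at `0` remains possible. -/
lemma SlowCdf.measureReal_Iio (h : SlowCdf γ ρ) {y : ℝ} (hy : 0 < y) :
    ρ.real (Iio y) = ρ.real (Iic y) := by
  refine le_antisymm (measureReal_mono Iio_subset_Iic_self) ?_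
  have h1 : ∀ᶠ c in nhdsWithin y (Iio y),
      c ^ (1 / γ) * ρ.real (Iic y) ≤ y ^ (1 / γ) * ρ.real (Iio y) := by
    filter_upwards [Ioo_mem_nhdsLT hy] with c hc
    refine (h c y hc.1 hc.2.le).trans ?_
    exact mul_le_mul_of_nonneg_left (measureReal_mono (Iic_subset_Iio.2 hc.2)) (by positivity)
  have h2 : Filter.Tendsto (fun c : ℝ => c ^ (1 / γ) * ρ.real (Iic y)) (nhdsWithin y (Iio y))
      (nhds (y ^ (1 / γ) * ρ.real (Iic y))) :=
    (((Real.continuousAt_rpow_const y _ (Or.inl hy.ne')).tendsto).mul_const _).mono_left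
      nhdsWithin_le_nhds
  exact le_of_mul_le_mul_left (le_of_tendsto h2 h1) (by positivity)

lemma SlowCdf.measure_Iio (h : SlowCdf γ ρ) {y : ℝ} (hy : 0 < y) : ρ (Iio y) = ρ (Iic y) := by
  rw [← ofReal_measureReal, h.measureReal_Iio hy, ofReal_measureReal]

lemma SlowCdf.measure_singleton (h : SlowCdf γ ρ) {y : ℝ} (hy : 0 < y) : ρ {y} = 0 := by
  rw [← Iic_sdiff_Iio_same, measure_sdiff Iio_subset_Iic_self measurableSet_Iio.nullMeasurableSet
    (measure_ne_top _ _), h.measure_Iio hy, tsub_self]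

/-- Given that `k` variables are at most `y`, each is at most `v` with probability `F(v) / F(y) ≥ (v
/ y) ^ (1/γ)`. The function `twoLowest k` decreases, so the law with equality is the extremal one.
-/
lemma SlowCdf.twoLowest_le (h : SlowCdf γ ρ) {v y : ℝ} (hv : 0 < v) (hvy : v ≤ y)
    {k : ℕ} (hk : 2 ≤ k) :
    2 * ρ.real (Ioc v y) ^ k + k * (ρ.real (Iic v) * ρ.real (Ioc v y) ^ (k - 1)) ≤
      ρ.real (Iic y) ^ k * twoLowest k ((v / y) ^ (1 / γ)) := by
  have hy : 0 < y := hv.trans_le hvy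
  have h6 : ρ.real (Ioc v y) = ρ.real (Iic y) - ρ.real (Iic v) := by
    exact measureReal_Ioc_eq_sub hvy
  have hle : ρ.real (Iic v) ≤ ρ.real (Iic y) := measureReal_mono (Iic_subset_Iic.2 hvy)
  have h2 := h v y hv hvy
  rw [h6]
  set a := ρ.real (Iic y)
  set φ := ρ.real (Iic v)
  have hφ : 0 ≤ φ := measureReal_nonneg
  rcases (hφ.trans hle).eq_or_lt with ha | ha
  · have : φ = 0 := le_antisymm (by linarith) hφ
    rw [← ha, this]
    have : k ≠ 0 := by omega
    simp [this]
  have hw : (v / y) ^ (1 / γ) ≤ φ / a := by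
    rw [Real.div_rpow hv.le hy.le, div_le_div_iff₀ (by positivity) ha]
    linarith
  have hmono := twoLowest_antitoneOn hk
    (a := (v / y) ^ (1 / γ)) (b := φ / a)
    ⟨by positivity, hw.trans ((div_le_one ha).2 hle)⟩ ⟨by positivity, (div_le_one ha).2 hle⟩ hw
  refine le_trans (le_of_eq ?_) (mul_le_mul_of_nonneg_left hmono (by positivity))
  obtain ⟨n, rfl⟩ : ∃ n, k = n + 1 := ⟨k - 1, by omega⟩
  have h7 : a - φ = a * (1 - φ / a) := by field_simp
  simp only [twoLowest, Nat.add_sub_cancel]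
  have h8 : φ = a * (φ / a) := by field_simp
  rw [h7, mul_pow, mul_pow]
  nth_rewrite 2 [h8]
  ring

end SlowCdf

/-! ### The probability of a window above a fixed threshold -/

section Window

lemma measurableSet_forall_finset {ι X : Type*} [MeasurableSpace X] (B : Finset ι)
    {p : ι → X → Prop} (hp : ∀ b ∈ B, MeasurableSet {x | p b x}) :
    MeasurableSet {x | ∀ b ∈ B, p b x} := by
  simp only [Set.ofPred_forall]
  exact Finset.measurableSet_biInter B hp

variable {ι : Type*}

/-- The coordinates in `B` are at most `y`, those in `R` and the coordinate `i` exceed `y`, and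
the coordinate `i` exceeds `y` by no more than the sum of any two coordinates in `B`. -/
def window (y : ℝ) (i : ι) (B R : Finset ι) : Set (ι → ℝ) :=
  {x | (∀ b ∈ B, x b ≤ y) ∧ (∀ j ∈ R, y < x j) ∧ y < x i ∧
    ∀ b ∈ B, ∀ b' ∈ B, b ≠ b' → x i ≤ y + x b + x b'}

/-- The vector `p.1` has its coordinates in `B` between `p.2` and `y`, and those in `R`
above `y`. -/
def allAbove (y : ℝ) (B R : Finset ι) : Set ((ι → ℝ) × ℝ) :=
  {p | (∀ b ∈ B, p.1 b ∈ Ioc p.2 y) ∧ ∀ j ∈ R, p.1 j ∈ Ioi y}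

lemma measurableSet_allAbove (y : ℝ) (B R : Finset ι) : MeasurableSet (allAbove y B R) := by
  have hm : ∀ j : ι, Measurable fun p : (ι → ℝ) × ℝ => p.1 j := fun j =>
    (measurable_pi_apply j).comp measurable_fst
  exact (measurableSet_forall_finset B fun b _ =>
    (measurableSet_lt measurable_snd (hm b)).inter (measurableSet_le (hm b) measurable_const)).inter
    (measurableSet_forall_finset R fun j _ => measurableSet_lt measurable_const (hm j))

variable [DecidableEq ι]

lemma measurableSet_window (y : ℝ) (i : ι) (B R : Finset ι) : MeasurableSet (window y i B R) := by
  have hm : ∀ j : ι, Measurable fun x : ι → ℝ => x j := measurable_pi_apply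
  refine (measurableSet_forall_finset B fun b _ => measurableSet_le (hm b) measurable_const).inter
    ((measurableSet_forall_finset R fun j _ => measurableSet_lt measurable_const (hm j)).inter
    ((measurableSet_lt measurable_const (hm i)).inter ?_))
  refine measurableSet_forall_finset B fun b _ => measurableSet_forall_finset B fun b' _ => ?_
  by_cases hb : b = b'
  · simp [hb]
  · simpa [hb] using measurableSet_le (hm i) (((measurable_const (a := y)).add (hm b)).add (hm b'))

/-- As `allAbove`, but one of the coordinates in `B` may be below `p.2`. -/
def allButOneAbove (y : ℝ) (B R : Finset ι) : Set ((ι → ℝ) × ℝ) :=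
  {p | ∃ b ∈ B, p.1 b ≤ y ∧ (∀ j ∈ B.erase b, p.1 j ∈ Ioc p.2 y) ∧ ∀ j ∈ R, p.1 j ∈ Ioi y}

lemma measurableSet_allButOneAbove (y : ℝ) (B R : Finset ι) :
    MeasurableSet (allButOneAbove y B R) := by
  have hm : ∀ j : ι, Measurable fun p : (ι → ℝ) × ℝ => p.1 j := fun j =>
    (measurable_pi_apply j).comp measurable_fst
  have : allButOneAbove y B R = ⋃ b ∈ B, {p : (ι → ℝ) × ℝ | p.1 b ≤ y} ∩
      allAbove y (B.erase b) R := by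
    ext p; simp [allButOneAbove, allAbove, and_left_comm]
  rw [this]
  exact Finset.measurableSet_biUnion B fun b _ =>
    (measurableSet_le (hm b) measurable_const).inter (measurableSet_allAbove _ _ _)

variable [Fintype ι] {γ : ℝ} {ρ : Measure ℝ} [IsProbabilityMeasure ρ]

/-- With the other coordinates fixed, coordinate `i` is confined to an interval above `y` whose
length is the sum of the two smallest coordinates in `B`. Each of the two is written as the length
of the set of levels `v` below it, in preparation for Tonelli's theorem. -/
lemma measure_update_window_le (h : SlowCdf γ ρ) (hγ : 1 ≤ γ) {y : ℝ} (hy : 0 < y) {i : ι}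
    {B R : Finset ι} (hB : 2 ≤ B.card) (hiB : i ∉ B) (hiR : i ∉ R) (x : ι → ℝ) :
    ρ {t | Function.update x i t ∈ window y i B R} ≤
      ENNReal.ofReal (ρ.real (Iic y) / (γ * y)) *
        (volume.restrict (Ioo 0 y) {v | (x, v) ∈ allAbove y B R} +
          volume.restrict (Ioo 0 y) {v | (x, v) ∈ allButOneAbove y B R}) := by
  have hne : ∀ b ∈ B, b ≠ i := fun b hb => ne_of_mem_of_not_mem hb hiB
  have hneR : ∀ b ∈ R, b ≠ i := fun b hb => ne_of_mem_of_not_mem hb hiR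
  by_cases hG : (∀ b ∈ B, x b ≤ y) ∧ ∀ j ∈ R, y < x j
  swap
  · have : {t | Function.update x i t ∈ window y i B R} = ∅ := by
      refine eq_empty_of_forall_notMem fun t ht => hG ⟨fun b hb => ?_, fun j hj => ?_⟩
      · simpa [hne b hb] using ht.1 b hb
      · simpa [hneR j hj] using ht.2.1 j hj
    simp [this]
  obtain ⟨b₀, hb₀, hmin₀⟩ := B.exists_min_image x (Finset.card_pos.1 (by omega))
  obtain ⟨b₁, hb₁, hmin₁⟩ := (B.erase b₀).exists_min_image x
    (Finset.card_pos.1 (by rw [Finset.card_erase_of_mem hb₀]; omega))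
  have hsub : {t | Function.update x i t ∈ window y i B R} ⊆ Ioc y (y + (x b₀ + x b₁)) := by
    rintro t ⟨-, -, h3, h4⟩
    have hb₁' := Finset.mem_of_mem_erase hb₁
    have := h4 b₀ hb₀ b₁ hb₁' (Finset.ne_of_mem_erase hb₁).symm
    simp only [Function.update_self, Function.update_of_ne (hne b₀ hb₀),
      Function.update_of_ne (hne b₁ hb₁')] at this h3
    exact ⟨h3, by linarith⟩
  refine (measure_mono hsub).trans ((h.measure_Ioc_le hγ hy _).trans ?_)
  refine mul_le_mul_right ?_ _
  refine ENNReal.ofReal_add_le.trans (add_le_add ?_ ?_)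
  · rw [Measure.restrict_apply' measurableSet_Ioo, ← sub_zero (x b₀), ← Real.volume_Ioo]
    refine measure_mono fun v hv => ⟨⟨fun b hb => ?_, hG.2⟩, hv.1, hv.2.trans_le (hG.1 b₀ hb₀)⟩
    exact ⟨hv.2.trans_le (hmin₀ b hb), hG.1 b hb⟩
  · rw [Measure.restrict_apply' measurableSet_Ioo, ← sub_zero (x b₁), ← Real.volume_Ioo]
    refine measure_mono fun v hv => ⟨⟨b₀, hb₀, hG.1 b₀ hb₀, fun b hb => ?_, hG.2⟩, hv.1,
      hv.2.trans_le (hG.1 b₁ (Finset.mem_of_mem_erase hb₁))⟩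
    exact ⟨hv.2.trans_le (hmin₁ b hb), hG.1 b (Finset.mem_of_mem_erase hb)⟩

/-- These are tail probabilities at level `v` of the smallest and the second smallest coordinate in
`B`. In the second case either no coordinate is at most `v`, or one of the `B.card` coordinates is
and the others are not. -/
lemma measure_allButOneAbove_le {v y : ℝ} {B R : Finset ι} (hBR : Disjoint B R) :
    (Measure.pi fun _ => ρ) {x : ι → ℝ | (x, v) ∈ allAbove y B R} +
        (Measure.pi fun _ => ρ) {x : ι → ℝ | (x, v) ∈ allButOneAbove y B R} ≤
      (2 * ρ (Ioc v y) ^ B.card + B.card * (ρ (Iic v) * ρ (Ioc v y) ^ (B.card - 1))) *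
        ρ (Ioi y) ^ R.card := by
  have h1 : (Measure.pi fun _ => ρ) {x : ι → ℝ | (x, v) ∈ allAbove y B R} =
      ρ (Ioc v y) ^ B.card * ρ (Ioi y) ^ R.card := 
    pi_setOf_two_blocks ρ hBR (Ioc v y) (Ioi y)
  have h2 : {x : ι → ℝ | (x, v) ∈ allButOneAbove y B R} ⊆
      {x : ι → ℝ | (x, v) ∈ allAbove y B R} ∪ ⋃ b ∈ B,
        {x : ι → ℝ | x b ∈ Iic v ∧ (∀ j ∈ B.erase b, x j ∈ Ioc v y) ∧ ∀ j ∈ R, x j ∈ Ioi y} := by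
    rintro x ⟨b, hb, hby, h3, h4⟩
    by_cases hbv : x b ≤ v
    · exact Or.inr (mem_biUnion hb ⟨hbv, h3, h4⟩)
    · refine Or.inl ⟨fun j hj => ?_, h4⟩
      rcases eq_or_ne j b with rfl | hjb
      · exact ⟨not_le.1 hbv, hby⟩
      · exact h3 j (Finset.mem_erase.2 ⟨hjb, hj⟩)
  have h3 : (Measure.pi fun _ => ρ) {x : ι → ℝ | (x, v) ∈ allButOneAbove y B R} ≤
      ρ (Ioc v y) ^ B.card * ρ (Ioi y) ^ R.card +
        B.card * (ρ (Iic v) * (ρ (Ioc v y) ^ (B.card - 1) * ρ (Ioi y) ^ R.card)) := by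
    refine (measure_mono h2).trans ((measure_union_le _ _).trans ?_)
    rw [h1]
    refine add_le_add_right ((measure_biUnion_finset_le _ _).trans (le_of_eq ?_)) _
    rw [Finset.sum_congr rfl fun b hb => pi_setOf_three_blocks ρ hb hBR _ _ _]
    simp
  rw [h1]
  refine (add_le_add_right h3 _).trans (le_of_eq ?_)
  ring

/-- The probability of a window. -/
theorem measure_window_le (h : SlowCdf γ ρ) (hγ : 1 ≤ γ) {y : ℝ} (hy : 0 < y) {i : ι}
    {B R : Finset ι} (hB : 2 ≤ B.card) (hiB : i ∉ B) (hiR : i ∉ R) (hBR : Disjoint B R) :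
    (Measure.pi fun _ => ρ) (window y i B R) ≤ ENNReal.ofReal (gapConst γ B.card) *
      (ρ (Iic y) ^ (B.card + 1) * ρ (Ioi y) ^ R.card) := by
  have hγ0 : 0 < γ := by linarith
  set m : Measure (ι → ℝ) := Measure.pi fun _ => ρ with hm
  set ν : Measure ℝ := volume.restrict (Ioo 0 y) with hν
  set C := ENNReal.ofReal (ρ.real (Iic y) / (γ * y)) with hC
  have hswap : ∀ A : Set ((ι → ℝ) × ℝ), MeasurableSet A →
      ∫⁻ x, ν {v | (x, v) ∈ A} ∂m = ∫⁻ v, m {x | (x, v) ∈ A} ∂ν := fun A hA => by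
    have h1 := Measure.prod_apply (μ := m) (ν := ν) hA
    rw [Measure.prod_apply_symm hA] at h1
    exact h1.symm
  have hA1 := measurableSet_allAbove y B R
  have hA2 := measurableSet_allButOneAbove y B R
  have hmeas : ∀ A : Set ((ι → ℝ) × ℝ), MeasurableSet A →
      Measurable fun x => ν {v | (x, v) ∈ A} := fun A hA => measurable_measure_prodMk_left hA
  have hmeas' : ∀ A : Set ((ι → ℝ) × ℝ), MeasurableSet A →
      Measurable fun v => m {x | (x, v) ∈ A} := fun A hA => measurable_measure_prodMk_right hA
  calc m (window y i B R)
      = ∫⁻ x, ρ {t | Function.update x i t ∈ window y i B R} ∂m :=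
        pi_apply_eq_lintegral_update' ρ i (measurableSet_window y i B R)
    _ ≤ ∫⁻ x, C * (ν {v | (x, v) ∈ allAbove y B R} + ν {v | (x, v) ∈ allButOneAbove y B R}) ∂m :=
        lintegral_mono fun x => measure_update_window_le h hγ hy hB hiB hiR x
    _ = C * ∫⁻ v, (m {x | (x, v) ∈ allAbove y B R} + m {x | (x, v) ∈ allButOneAbove y B R}) ∂ν := by
        rw [lintegral_const_mul' _ _ ENNReal.ofReal_ne_top,
          lintegral_add_left (hmeas _ hA1), lintegral_add_left (hmeas' _ hA1),
          hswap _ hA1, hswap _ hA2]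
    _ ≤ C * ∫⁻ v, ENNReal.ofReal (twoLowest B.card ((v / y) ^ (1 / γ))) *
          (ρ (Iic y) ^ B.card * ρ (Ioi y) ^ R.card) ∂ν := by
        refine mul_le_mul_right (lintegral_mono_ae ?_) _
        filter_upwards [ae_restrict_mem measurableSet_Ioo] with v hv
        refine (measure_allButOneAbove_le hBR).trans ?_
        have h1 := ENNReal.ofReal_le_ofReal (h.twoLowest_le hv.1 hv.2.le hB)
        rw [ENNReal.ofReal_mul (by positivity), ENNReal.ofReal_pow measureReal_nonneg,
          ofReal_measureReal, mul_comm] at h1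
        refine (mul_le_mul_left (le_trans (le_of_eq ?_) h1) _).trans (le_of_eq (by ring))
        rw [ENNReal.ofReal_add (by positivity) (by positivity), ENNReal.ofReal_mul (by positivity),
          ENNReal.ofReal_mul (by positivity), ENNReal.ofReal_mul (by positivity),
          ENNReal.ofReal_pow measureReal_nonneg, ENNReal.ofReal_pow measureReal_nonneg,
          ofReal_measureReal, ofReal_measureReal]
        simp [mul_comm]
    _ = C * (ENNReal.ofReal (y * (γ * gapConst γ B.card)) *
          (ρ (Iic y) ^ B.card * ρ (Ioi y) ^ R.card)) := by
        rw [lintegral_mul_const' _ _ (by finiteness), hν,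
          lintegral_twoLowest hγ0 hy (by omega)]
    _ = ENNReal.ofReal (gapConst γ B.card) *
          (ρ (Iic y) ^ (B.card + 1) * ρ (Ioi y) ^ R.card) := by
        have h1 : C * ENNReal.ofReal (y * (γ * gapConst γ B.card)) =
            ENNReal.ofReal (gapConst γ B.card) * ρ (Iic y) := by
          rw [hC, ← ENNReal.ofReal_mul (by positivity), ← ofReal_measureReal (μ := ρ) (s := Iic y),
            ← ENNReal.ofReal_mul (gapConst_pos hγ0 _).le]
          congr 1
          field_simp
        rw [← mul_assoc, h1]
        ring

end Window

end GapEstimator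

/-! ### Windows above a random threshold, and union bounds -/

namespace GapEstimator

section RankEvents

variable {ι : Type*} [Fintype ι] [DecidableEq ι]

/-- The coordinate `c` is positive, the coordinates in `B` are below it, all others above. -/
def rankEvent (c : ι) (B : Finset ι) : Set (ι → ℝ) :=
  {x | 0 < x c ∧ (∀ b ∈ B, x b < x c) ∧ ∀ j ∈ (insert c B)ᶜ, x c < x j}

/-- The window event whose threshold is the coordinate `c`. -/
def windowAt (c i : ι) (B : Finset ι) : Set (ι → ℝ) :=
  {x | 0 < x c ∧ x ∈ window (x c) i (B.erase i) (insert c B)ᶜ}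

lemma measurableSet_rankEvent (c : ι) (B : Finset ι) : MeasurableSet (rankEvent c B) := by
  have hm : ∀ j : ι, Measurable fun x : ι → ℝ => x j := measurable_pi_apply
  exact (measurableSet_lt measurable_const (hm c)).inter
    ((measurableSet_forall_finset B fun b _ => measurableSet_lt (hm b) (hm c)).inter
    (measurableSet_forall_finset _ fun j _ => measurableSet_lt (hm c) (hm j)))

lemma measurableSet_windowAt (c i : ι) (B : Finset ι) : MeasurableSet (windowAt c i B) := by
  have hm : ∀ j : ι, Measurable fun x : ι → ℝ => x j := measurable_pi_apply
  refine (measurableSet_lt measurable_const (hm c)).inter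
    ((measurableSet_forall_finset _ fun b _ => measurableSet_le (hm b) (hm c)).inter
    ((measurableSet_forall_finset _ fun j _ => measurableSet_lt (hm c) (hm j)).inter
    ((measurableSet_lt (hm c) (hm i)).inter ?_)))
  refine measurableSet_forall_finset _ fun b _ => measurableSet_forall_finset _ fun b' _ => ?_
  by_cases hb : b = b'
  · simp [hb]
  · simpa [hb] using measurableSet_le (hm i) (((hm c).add (hm b)).add (hm b'))

/-- `B` must be the set of coordinates strictly below `x c`, so its cardinality determines the rank
of `c`. Rank events of the same rank are therefore disjoint. -/
lemma eq_of_mem_rankEvent {c c' : ι} {B B' : Finset ι} (hB : B.card = B'.card) {x : ι → ℝ}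
    (h : x ∈ rankEvent c B) (h' : x ∈ rankEvent c' B') : c = c' ∧ B = B' := by
  have key : ∀ {c : ι} {B : Finset ι}, x ∈ rankEvent c B → ∀ j, j ∈ B ↔ x j < x c := by
    intro c B h j
    refine ⟨h.2.1 j, fun hj => by_contra fun hjB => ?_⟩
    have hjc : j ≠ c := by rintro rfl; exact lt_irrefl _ hj
    exact lt_asymm hj (h.2.2 j (by simp [hjc, hjB]))
  have hlt : ∀ {c c' : ι} {B B' : Finset ι}, B.card = B'.card → x ∈ rankEvent c B →
      x ∈ rankEvent c' B' → ¬ x c < x c' := by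
    intro c c' B B' hB h h' hlt
    have hsub : insert c B ⊆ B' := by
      refine Finset.insert_subset ((key h' c).2 hlt) fun j hj => ?_
      exact (key h' j).2 (((key h j).1 hj).trans hlt)
    have hc : c ∉ B := fun hc => lt_irrefl _ (h.2.1 c hc)
    have := Finset.card_le_card hsub
    rw [Finset.card_insert_of_notMem hc] at this
    omega
  have hc : x c = x c' := le_antisymm (not_lt.1 (hlt hB.symm h' h)) (not_lt.1 (hlt hB h h'))
  refine ⟨by_contra fun hne => ?_, ?_⟩
  · have hcB' : c ∉ B' := fun hm => absurd (h'.2.1 c hm) (by rw [hc]; exact lt_irrefl _)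
    exact absurd (h'.2.2 c (by simp [hne, hcB'])) (by rw [hc]; exact lt_irrefl _)
  · ext j
    rw [key h j, key h' j, hc]

variable {γ : ℝ} {ρ : Measure ℝ} [IsProbabilityMeasure ρ]

/-- Given `x c = y`, the window bound and the probability of the rank event contain the same powers
of `F(y)` and `1 - F(y)`: the price for `i` lying just above `c` instead of below is `gapConst γ k`.
-/
lemma measure_windowAt_le (h : SlowCdf γ ρ) (hγ : 1 ≤ γ) {c i : ι} {B : Finset ι} {k : ℕ}
    (hk : 2 ≤ k) (hB : B.card = k + 1) (hi : i ∈ B) (hc : c ∉ B) :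
    (Measure.pi fun _ => ρ) (windowAt c i B) ≤
      ENNReal.ofReal (gapConst γ k) * (Measure.pi fun _ => ρ) (rankEvent c B) := by
  have hne : ∀ b ∈ B, b ≠ c := fun b hb => ne_of_mem_of_not_mem hb hc
  have hneR : ∀ b ∈ (insert c B)ᶜ, b ≠ c := fun b hb => by
    rintro rfl; simp at hb
  have hcard : (B.erase i).card = k := by rw [Finset.card_erase_of_mem hi, hB]; rfl
  rw [pi_apply_eq_lintegral_update ρ c (measurableSet_windowAt c i B),
    pi_apply_eq_lintegral_update ρ c (measurableSet_rankEvent c B),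
    ← lintegral_const_mul' _ _ ENNReal.ofReal_ne_top]
  refine lintegral_mono fun y => ?_
  rcases le_or_gt y 0 with hy | hy
  · have : {x : ι → ℝ | Function.update x c y ∈ windowAt c i B} = ∅ :=
      eq_empty_of_forall_notMem fun x hx => by
        have := hx.1
        rw [Function.update_self] at this
        linarith
    simp [this]
  have hBR : Disjoint B (insert c B)ᶜ :=
    Finset.disjoint_left.2 fun j hj hj' => by simp [hj] at hj'
  have h1 : {x : ι → ℝ | Function.update x c y ∈ windowAt c i B} ⊆
      window y i (B.erase i) (insert c B)ᶜ := by
    rintro x ⟨-, h1, h2, h3, h4⟩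
    simp only [Function.update_self, Function.update_of_ne (hne i hi)] at h1 h2 h3 h4
    refine ⟨fun b hb => ?_, fun j hj => ?_, h3, fun b hb b' hb' hbb' => ?_⟩
    · simpa [hne b (Finset.mem_of_mem_erase hb)] using h1 b hb
    · simpa [hneR j hj] using h2 j hj
    · simpa [hne b (Finset.mem_of_mem_erase hb), hne b' (Finset.mem_of_mem_erase hb')] using
        h4 b hb b' hb' hbb'
  have h2 : {x : ι → ℝ | Function.update x c y ∈ rankEvent c B} =
      {x : ι → ℝ | (∀ b ∈ B, x b ∈ Iio y) ∧ ∀ j ∈ (insert c B)ᶜ, x j ∈ Ioi y} := by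
    ext x
    simp only [rankEvent, mem_ofPred_eq, Function.update_self, hy, true_and]
    exact and_congr (forall₂_congr fun b hb => by simp [hne b hb])
      (forall₂_congr fun b hb => by simp [hneR b hb])
  rw [h2, pi_setOf_two_blocks ρ hBR, h.measure_Iio hy, hB]
  refine (measure_mono h1).trans ?_
  have h3 := measure_window_le h hγ hy (i := i) (B := B.erase i) (R := (insert c B)ᶜ)
    (by omega) (by simp) (by simp [hi]) (hBR.mono_left (Finset.erase_subset _ _))
  rwa [hcard] at h3

lemma sum_measure_rankEvent_le_one (k : ℕ) :
    ∑ p ∈ (Finset.univ : Finset ι) ×ˢ Finset.powersetCard k Finset.univ,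
      (Measure.pi fun _ => ρ) (rankEvent p.1 p.2) ≤ 1 := by
  rw [← measure_biUnion_finset]
  · exact prob_le_one
  · intro p hp q hq hpq
    refine disjoint_left.2 fun x hx hx' => hpq ?_
    have hp := (Finset.mem_powersetCard.1 (Finset.mem_product.1 hp).2).2
    have hq := (Finset.mem_powersetCard.1 (Finset.mem_product.1 hq).2).2
    obtain ⟨h1, h2⟩ := eq_of_mem_rankEvent (hp.trans hq.symm) hx hx'
    exact Prod.ext h1 h2
  · exact fun p _ => measurableSet_rankEvent _ _

/-- For some choice of a threshold coordinate and of `k` coordinates below it, a window event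
takes place. -/
def someWindowAt (ι : Type*) [Fintype ι] [DecidableEq ι] (k : ℕ) : Set (ι → ℝ) :=
  {x | ∃ (c i : ι) (B : Finset ι), B.card = k + 1 ∧ i ∈ B ∧ c ∉ B ∧ x ∈ windowAt c i B}

/-- For each pair `(c, B)` there are `k + 1` choices of `i ∈ B`, and the probabilities of the
disjoint rank events sum to at most `1`. No dependence on the number of coordinates is left. -/
lemma measure_someWindowAt_le (h : SlowCdf γ ρ) (hγ : 1 ≤ γ) {k : ℕ} (hk : 2 ≤ k) :
    (Measure.pi fun _ => ρ) (someWindowAt ι k) ≤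
      ENNReal.ofReal ((k + 1) * gapConst γ k) := by
  have hsub : someWindowAt ι k ⊆
      ⋃ p ∈ (Finset.univ : Finset ι) ×ˢ Finset.powersetCard (k + 1) Finset.univ,
        ⋃ i ∈ p.2, {x | p.1 ∉ p.2 ∧ x ∈ windowAt p.1 i p.2} := by
    rintro x ⟨c, i, B, hB, hi, hc, hx⟩
    simp only [mem_iUnion]
    exact ⟨(c, B), by simp [hB], i, hi, hc, hx⟩
  refine (measure_mono hsub).trans ((measure_biUnion_finset_le _ _).trans ?_)
  calc _ ≤ ∑ p ∈ (Finset.univ : Finset ι) ×ˢ Finset.powersetCard (k + 1) Finset.univ,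
        ENNReal.ofReal ((k + 1) * gapConst γ k) *
          (Measure.pi fun _ => ρ) (rankEvent p.1 p.2) := by
        refine Finset.sum_le_sum fun p hp => ?_
        have hp := (Finset.mem_powersetCard.1 (Finset.mem_product.1 hp).2).2
        refine (measure_biUnion_finset_le _ _).trans ?_
        have h1 : ∀ i ∈ p.2, (Measure.pi fun _ => ρ) {x | p.1 ∉ p.2 ∧ x ∈ windowAt p.1 i p.2} ≤
            ENNReal.ofReal (gapConst γ k) * (Measure.pi fun _ => ρ) (rankEvent p.1 p.2) := by
          intro i hi
          by_cases hc : p.1 ∈ p.2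
          · simp [hc]
          · simpa [hc] using measure_windowAt_le h hγ hk hp hi hc
        refine (Finset.sum_le_sum h1).trans (le_of_eq ?_)
        rw [Finset.sum_const, hp, nsmul_eq_mul, ← mul_assoc, ENNReal.ofReal_mul (by positivity)]
        congr 2
        rw [← ENNReal.ofReal_natCast]
        push_cast
        rfl
    _ ≤ _ := by
        rw [← Finset.mul_sum]
        exact mul_le_of_le_one_right' (sum_measure_rankEvent_le_one (k + 1))

/-- For some choice of `k` coordinates that are at most `y`, a window event takes place. -/
def someWindow (ι : Type*) [Fintype ι] [DecidableEq ι] (y : ℝ) (k : ℕ) : Set (ι → ℝ) :=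
  {x | ∃ (i : ι) (B : Finset ι), B.card = k + 1 ∧ i ∈ B ∧ x ∈ window y i (B.erase i) Bᶜ}

lemma measure_someWindow_le (h : SlowCdf γ ρ) (hγ : 1 ≤ γ) {y : ℝ} (hy : 0 < y) {k : ℕ}
    (hk : 2 ≤ k) :
    (Measure.pi fun _ => ρ) (someWindow ι y k) ≤
      ENNReal.ofReal ((k + 1) * gapConst γ k) * ((Fintype.card ι).choose (k + 1) *
        (ρ (Iic y) ^ (k + 1) * ρ (Ioi y) ^ (Fintype.card ι - (k + 1)))) := by
  have hsub : someWindow ι y k ⊆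
      ⋃ B ∈ Finset.powersetCard (k + 1) (Finset.univ : Finset ι),
        ⋃ i ∈ B, window y i (B.erase i) Bᶜ := by
    rintro x ⟨i, B, hB, hi, hx⟩
    simp only [mem_iUnion]
    exact ⟨B, by simp [hB], i, hi, hx⟩
  refine (measure_mono hsub).trans ((measure_biUnion_finset_le _ _).trans ?_)
  have h1 : ∀ B ∈ Finset.powersetCard (k + 1) (Finset.univ : Finset ι),
      (Measure.pi fun _ => ρ) (⋃ i ∈ B, window y i (B.erase i) Bᶜ) ≤
      ENNReal.ofReal ((k + 1) * gapConst γ k) *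
        (ρ (Iic y) ^ (k + 1) * ρ (Ioi y) ^ (Fintype.card ι - (k + 1))) := by
    intro B hB
    have hB := (Finset.mem_powersetCard.1 hB).2
    refine (measure_biUnion_finset_le _ _).trans ?_
    have h2 : ∀ i ∈ B, (Measure.pi fun _ => ρ) (window y i (B.erase i) Bᶜ) ≤
        ENNReal.ofReal (gapConst γ k) *
          (ρ (Iic y) ^ (k + 1) * ρ (Ioi y) ^ (Fintype.card ι - (k + 1))) := by
      intro i hi
      have hcard : (B.erase i).card = k := by rw [Finset.card_erase_of_mem hi, hB]; rfl
      have h3 := measure_window_le h hγ hy (i := i) (B := B.erase i) (R := Bᶜ)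
        (by omega) (by simp) (by simp [hi])
        (disjoint_compl_right.mono_left (Finset.erase_subset _ _))
      rwa [hcard, Finset.card_compl, hB] at h3
    refine (Finset.sum_le_sum h2).trans (le_of_eq ?_)
    rw [Finset.sum_const, hB, nsmul_eq_mul, ← mul_assoc, ENNReal.ofReal_mul (by positivity)]
    congr 2
    rw [← ENNReal.ofReal_natCast]
    push_cast
    rfl
  refine (Finset.sum_le_sum h1).trans (le_of_eq ?_)
  rw [Finset.sum_const, Finset.card_powersetCard, nsmul_eq_mul, Finset.card_univ]
  ring

-- The restriction to positive values is essential, because the law may have an atom at `0`.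
omit [DecidableEq ι] in
lemma measure_tie_eq_zero (h : SlowCdf γ ρ) :
    (Measure.pi fun _ => ρ) {x : ι → ℝ | ∃ a b, a ≠ b ∧ 0 < x a ∧ x a = x b} = 0 := by
  classical
  have hm : ∀ j : ι, Measurable fun x : ι → ℝ => x j := measurable_pi_apply
  have : {x : ι → ℝ | ∃ a b, a ≠ b ∧ 0 < x a ∧ x a = x b} ⊆
      ⋃ a, ⋃ b, ⋃ _ : a ≠ b, {x : ι → ℝ | 0 < x a ∧ x a = x b} := by
    rintro x ⟨a, b, hab, h⟩
    simp only [mem_iUnion]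
    exact ⟨a, b, hab, h⟩
  refine measure_mono_null this (measure_iUnion_null fun a => measure_iUnion_null fun b =>
    measure_iUnion_null fun hab => ?_)
  have hms : MeasurableSet {x : ι → ℝ | 0 < x a ∧ x a = x b} :=
    (measurableSet_lt measurable_const (hm a)).inter (measurableSet_eq_fun (hm a) (hm b))
  rw [pi_apply_eq_lintegral_update' ρ a hms]
  refine (lintegral_congr fun x => ?_).trans lintegral_zero
  rcases le_or_gt (x b) 0 with hx | hx
  · refine measure_mono_null (t := ∅) (fun y hy => ?_) measure_empty
    obtain ⟨h1, h2⟩ := hy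
    simp [hab.symm] at h1 h2
    linarith
  · refine measure_mono_null (t := {x b}) (fun y hy => ?_) (h.measure_singleton hx)
    simpa [hab.symm] using hy.2

end RankEvents

/-! ### Binomial counts -/

section Binomial

variable {ι : Type*} [Fintype ι] {ρ : Measure ℝ} [IsProbabilityMeasure ρ]

/-- The number of coordinates in `s`. -/
noncomputable def countIn (s : Set ℝ) (x : ι → ℝ) : ℕ := {j | x j ∈ s}.ncard

open Classical in
lemma measure_countIn_eq {s : Set ℝ} (hs : MeasurableSet s) (k : ℕ) :
    MeasurableSet {x : ι → ℝ | countIn s x = k} ∧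
    (Measure.pi fun _ => ρ) {x : ι → ℝ | countIn s x = k} =
      (Fintype.card ι).choose k * (ρ s ^ k * ρ sᶜ ^ (Fintype.card ι - k)) := by
  have heq : {x : ι → ℝ | countIn s x = k} =
      ⋃ B ∈ Finset.powersetCard k (Finset.univ : Finset ι),
        {x : ι → ℝ | (∀ j ∈ B, x j ∈ s) ∧ ∀ j ∈ Bᶜ, x j ∈ sᶜ} := by
    ext x
    simp only [mem_iUnion, Finset.mem_powersetCard, Finset.subset_univ, true_and, mem_ofPred_eq,
      countIn, Finset.mem_compl, exists_prop]
    constructor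
    · intro hx
      refine ⟨{j | x j ∈ s}.toFinset, by rw [← hx, ncard_eq_toFinset_card'], fun j hj => ?_,
        fun j hj => ?_⟩ <;> simpa using hj
    · rintro ⟨B, hB, h1, h2⟩
      have : {j | x j ∈ s} = B := by
        ext j
        exact ⟨fun hj => by_contra fun hjB => h2 j hjB hj, h1 j⟩
      rw [this, ncard_coe_finset, hB]
  have hms : ∀ B : Finset ι,
      MeasurableSet {x : ι → ℝ | (∀ j ∈ B, x j ∈ s) ∧ ∀ j ∈ Bᶜ, x j ∈ sᶜ} := fun B =>
    (measurableSet_forall_finset _ fun j _ => measurable_pi_apply j hs).inter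
      (measurableSet_forall_finset _ fun j _ => measurable_pi_apply j hs.compl)
  rw [heq]
  refine ⟨Finset.measurableSet_biUnion _ fun B _ => hms B, ?_⟩
  rw [measure_biUnion_finset]
  · rw [Finset.sum_congr rfl fun B hB => by
      rw [pi_setOf_two_blocks ρ disjoint_compl_right, Finset.card_compl,
        (Finset.mem_powersetCard.1 hB).2], Finset.sum_const, Finset.card_powersetCard,
      nsmul_eq_mul, Finset.card_univ]
  · intro B _ B' _ hne
    refine disjoint_left.2 fun x hx hx' => hne ?_
    ext j
    refine ⟨fun hj => by_contra fun hj' => ?_, fun hj => by_contra fun hj' => ?_⟩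
    · exact hx'.2 j (by simpa using hj') (hx.1 j hj)
    · exact hx.2 j (by simpa using hj') (hx'.1 j hj)
  · exact fun B _ => hms B

lemma measurable_countIn {s : Set ℝ} (hs : MeasurableSet s) :
    Measurable (countIn s : (ι → ℝ) → ℕ) :=
  measurable_to_countable' fun k =>
    (measure_countIn_eq (ρ := Measure.dirac 0) hs k).1

lemma map_countIn {s : Set ℝ} (hs : MeasurableSet s) {p : unitInterval}
    (hp : ρ.real s = p) :
    (Measure.pi fun _ : ι => ρ).map (countIn s) = binomial (Fintype.card ι) p := by
  refine Measure.ext_of_singleton fun k => ?_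
  rw [Measure.map_apply (measurable_countIn hs) (measurableSet_singleton k), binomial_singleton]
  refine (measure_countIn_eq hs k).2.trans ?_
  have h1 : ρ s = ENNReal.ofReal p := by rw [← hp, ofReal_measureReal]
  have h2 : ρ sᶜ = ENNReal.ofReal (1 - p) := by
    rw [← hp, ← probReal_compl_eq_one_sub hs, ofReal_measureReal]
  have hp0 := p.2.1
  have hp1 : (0 : ℝ) ≤ 1 - p := sub_nonneg.2 p.2.2
  rw [h1, h2, ENNReal.ofReal_mul (by positivity), ENNReal.ofReal_mul (by positivity),
    ENNReal.ofReal_pow hp0, ENNReal.ofReal_pow hp1, ENNReal.ofReal_natCast]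
  ring

lemma measure_countIn_lt {s : Set ℝ} (hs : MeasurableSet s) (k : ℕ) :
    (Measure.pi fun _ : ι => ρ) {x | countIn s x < k} =
      binomialLower (Fintype.card ι) (ρ.real s) k := by
  have hp : ρ.real s ∈ Icc (0 : ℝ) 1 := ⟨measureReal_nonneg, measureReal_le_one⟩
  rw [binomialLower, ← map_countIn (ι := ι) hs (ρ := ρ) (by rw [projIcc_of_mem _ hp]),
    Measure.map_apply (measurable_countIn hs) (by measurability)]
  rfl

lemma binomialLower_antitone (M k : ℕ) {p q : ℝ} (hp : 0 ≤ p) (hpq : p ≤ q) (hq : q ≤ 1) :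
    binomialLower M q k ≤ binomialLower M p k := by
  -- Coupling: both binomial variables count the same uniform variables, below `p` and below `q`.
  let ρ : Measure ℝ := volume.restrict (Ioc 0 1)
  have : IsProbabilityMeasure ρ := ⟨by simp [ρ]⟩
  have hρ : ∀ r : ℝ, 0 ≤ r → r ≤ 1 → ρ.real (Iic r) = r := fun r h0 h1 => by
    have : Iic r ∩ Ioc 0 1 = Ioc 0 r := by
      ext x; simp only [mem_inter_iff, mem_Iic, mem_Ioc]
      constructor
      · rintro ⟨h1, h2, -⟩; exact ⟨h2, h1⟩
      · rintro ⟨h2, h3⟩; exact ⟨h3, h2, h3.trans h1⟩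
    simp only [ρ, measureReal_def]
    rw [Measure.restrict_apply measurableSet_Iic, this]
    simp [h0]
  have h := fun r (h0 : 0 ≤ r) (h1 : r ≤ 1) =>
    measure_countIn_lt (ι := Fin M) (ρ := ρ) (measurableSet_Iic (a := r)) k
  have h1 := h p hp (hpq.trans hq)
  have h2 := h q (hp.trans hpq) hq
  rw [hρ p hp (hpq.trans hq), Fintype.card_fin] at h1
  rw [hρ q (hp.trans hpq) hq, Fintype.card_fin] at h2
  rw [← h1, ← h2]
  refine measure_mono fun x (hx : _ < k) => ?_
  refine lt_of_le_of_lt (ncard_le_ncard (fun j hj => ?_) (toFinite _)) hx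
  exact le_trans (mem_Iic.1 hj) hpq

/-- A bound of the inner weights of a binomial distribution from their log-concavity. -/
lemma choose_mul_pow_le {n a : ℕ} (han : a + 2 ≤ n) {q s : ℝ} (hq0 : 0 ≤ q) (hq1 : q ≤ 1)
    (h : s ^ 2 * (((a : ℝ) + 2) * (n - a)) ≤ ((a : ℝ) + 1) * (n - a - 1)) :
    (1 + 2 * s) * (n.choose (a + 1) * (q ^ (a + 1) * (1 - q) ^ (n - (a + 1)))) ≤ 1 := by
  obtain ⟨l, rfl⟩ : ∃ l, n = a + 2 + l := ⟨n - (a + 2), by omega⟩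
  have hq1' : 0 ≤ 1 - q := sub_nonneg.2 hq1
  set n := a + 2 + l with hn
  let b : ℕ → ℝ := fun j => q ^ j * (1 - q) ^ (n - j) * n.choose j
  have hb0 : ∀ j, 0 ≤ b j := fun j => by positivity
  have hsum : b a + b (a + 1) + b (a + 2) ≤ 1 := by
    have h1 : ∑ j ∈ Finset.range (n + 1), b j = 1 := by
      have := add_pow q (1 - q) n
      rw [add_sub_cancel, one_pow] at this
      exact this.symm
    have h2 : ∑ j ∈ ({a, a + 1, a + 2} : Finset ℕ), b j ≤ ∑ j ∈ Finset.range (n + 1), b j :=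
      Finset.sum_le_sum_of_subset_of_nonneg (by
        intro j hj
        simp only [Finset.mem_insert, Finset.mem_singleton] at hj
        simp only [Finset.mem_range]
        omega) fun j _ _ => hb0 j
    rw [h1] at h2
    simpa [add_assoc] using h2
  have hc1 : (n.choose (a + 1) : ℝ) * (a + 1) = n.choose a * (l + 2) := by
    have := Nat.choose_succ_right_eq n a
    rw [show n - a = l + 2 by omega] at this
    exact_mod_cast this
  have hc2 : (n.choose (a + 2) : ℝ) * (a + 2) = n.choose (a + 1) * (l + 1) := by
    have := Nat.choose_succ_right_eq n (a + 1)
    rw [show n - (a + 1) = l + 1 by omega] at this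
    exact_mod_cast this
  have hprod : b a * b (a + 2) * ((a + 2) * (l + 2)) = b (a + 1) ^ 2 * ((a + 1) * (l + 1)) := by
    simp only [b, show n - a = l + 2 by omega, show n - (a + 1) = l + 1 by omega,
      show n - (a + 2) = l by omega]
    calc _ = q ^ a * q ^ (a + 2) * ((1 - q) ^ (l + 2) * (1 - q) ^ l) *
          ((n.choose a * (l + 2)) * (n.choose (a + 2) * (a + 2))) := by ring
      _ = _ := by rw [← hc1, hc2]; ring
  have hna : (n : ℝ) = a + 2 + l := by rw [hn]; push_cast; ring
  rw [hna] at h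
  -- The product of the neighbouring weights is at least `s²` times the square of the middle one, so
  -- their sum is at least `2 s` times it, while all three together are at most `1`.
  have hkey : (s * b (a + 1)) ^ 2 ≤ b a * b (a + 2) := by
    have hpos : (0 : ℝ) < (a + 2) * (l + 2) := by positivity
    refine le_of_mul_le_mul_right ?_ hpos
    rw [hprod]
    have := mul_le_mul_of_nonneg_left h (sq_nonneg (b (a + 1)))
    nlinarith
  have hfin : 2 * (s * b (a + 1)) ≤ b a + b (a + 2) := by
    refine abs_le_of_sq_le_sq' ?_ (add_nonneg (hb0 _) (hb0 _)) |>.2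
    nlinarith [sq_nonneg (b a - b (a + 2))]
  have : (n.choose (a + 1) * (q ^ (a + 1) * (1 - q) ^ (n - (a + 1))) : ℝ) = b (a + 1) := by
    simp only [b]; ring
  rw [this]
  linarith

end Binomial

end GapEstimator

/-! ### A large error forces a window event -/

namespace GapEstimator

section Covering

/-- The two neighbouring order statistics of a gap estimate are at least as close to each other
as any two values of the sample. -/
lemma IsGapEstimate.exists_pair {M : ℕ} {z : Fin M → ℝ} {v : ℝ} (h : IsGapEstimate z v) :
    ∃ p q : Fin M, p ≠ q ∧ v = (z p + z q) / 2 ∧ ∀ a b, a ≠ b → |z p - z q| ≤ |z a - z b| := by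
  obtain ⟨j, hj, hmin, hv⟩ := h
  have hmono : Monotone (orderStat z) := Tuple.monotone_sort z
  have hsort : ∀ l, orderStat z l = z (Tuple.sort z l) := fun _ => rfl
  refine ⟨Tuple.sort z ⟨j, Nat.lt_of_succ_lt hj⟩, Tuple.sort z ⟨j + 1, hj⟩, ?_, hv, ?_⟩
  · intro heq
    have := (Tuple.sort z).injective heq
    simp at this
  simp only [← hsort]
  have hpq : orderStat z ⟨j, Nat.lt_of_succ_lt hj⟩ ≤ orderStat z ⟨j + 1, hj⟩ :=
    hmono (by simp)
  rw [abs_sub_comm, abs_of_nonneg (sub_nonneg.2 hpq)]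
  have key : ∀ l m : Fin M, l < m → orderStat z ⟨j + 1, hj⟩ -
      orderStat z ⟨j, Nat.lt_of_succ_lt hj⟩ ≤ orderStat z m - orderStat z l := by
    intro l m hlm
    have hl : l.1 + 1 < M := lt_of_le_of_lt hlm m.2
    have h1 := hmin l hl
    have h2 : orderStat z ⟨l.1 + 1, hl⟩ ≤ orderStat z m := hmono hlm
    have h3 : orderStat z ⟨l.1, Nat.lt_of_succ_lt hl⟩ = orderStat z l := rfl
    linarith
  intro a b hab
  have ha : z a = orderStat z ((Tuple.sort z).symm a) := by simp [hsort]
  have hb : z b = orderStat z ((Tuple.sort z).symm b) := by simp [hsort]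
  rw [ha, hb]
  rcases lt_or_gt_of_ne ((Tuple.sort z).symm.injective.ne hab) with h | h
  · exact (key _ _ h).trans (by rw [abs_sub_comm]; exact le_abs_self _)
  · exact (key _ _ h).trans (le_abs_self _)

/-- If the gap estimate errs by more than `ε` and `k₀` values of the sample err by at most `ε`, then
a window event takes place. -/
lemma mem_someWindow_of_error {M : ℕ} {z : Fin M → ℝ} {v x ε : ℝ} (hv : IsGapEstimate z v)
    (hε : 0 < ε) (herr : ε < |v - x|) {k₀ : ℕ} (hk₀ : 2 ≤ k₀)
    (hcount : k₀ ≤ countIn (Iic ε) fun j => |z j - x|)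
    (hties : ∀ a b, a ≠ b → 0 < |z a - x| → |z a - x| ≠ |z b - x|) :
    (∃ k ∈ Finset.Icc k₀ (M - 2), (fun j => |z j - x|) ∈ someWindowAt (Fin M) k) ∨
      (fun j => |z j - x|) ∈ someWindow (Fin M) ε k₀ := by
  obtain ⟨p, q, hpq, rfl, hmin⟩ := hv.exists_pair
  set D : Fin M → ℝ := fun j => |z j - x| with hD
  have hD0 : ∀ j, 0 ≤ D j := fun j => abs_nonneg _
  -- The error of the midpoint is at most the mean of the two errors, so the larger of them exceeds
  -- `ε`.
  obtain ⟨i, i', hii', hle, hiε, hmin⟩ : ∃ i i' : Fin M, i ≠ i' ∧ D i' ≤ D i ∧ ε < D i ∧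
      ∀ a b, a ≠ b → |z i - z i'| ≤ |z a - z b| := by
    have h2 : |(z p + z q) / 2 - x| ≤ (D p + D q) / 2 := by
      have : (z p + z q) / 2 - x = ((z p - x) + (z q - x)) / 2 := by ring
      rw [this, abs_div, abs_two]
      exact div_le_div_of_nonneg_right (abs_add_le _ _) zero_le_two
    rcases le_total (D q) (D p) with h | h
    · exact ⟨p, q, hpq, h, by linarith, hmin⟩
    · exact ⟨q, p, hpq.symm, h, by linarith, fun a b hab => by rw [abs_sub_comm]; exact hmin a b hab⟩
  have hi0 : 0 < D i := hε.trans hiε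
  have hlt : D i' < D i := lt_of_le_of_ne hle (hties i i' hii' hi0).symm
  have hpair : ∀ a b, a ≠ b → D i ≤ D i' + D a + D b := by
    intro a b hab
    have h1 := hmin a b hab
    have h2 : D i ≤ |z i - z i'| + D i' := by
      have := abs_sub_le (z i) (z i') x
      exact this
    have h3 : |z a - z b| ≤ D a + D b := by
      have := abs_sub_le (z a) x (z b)
      rw [abs_sub_comm x (z b)] at this
      exact this
    linarith
  set B : Finset (Fin M) := Finset.univ.filter fun j => D j < D i with hB
  have hmem : ∀ j, j ∈ B ↔ D j < D i := fun j => by simp [hB]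
  have hi'B : i' ∈ B := (hmem i').2 hlt
  have hiB : i ∉ B := fun h => lt_irrefl _ ((hmem i).1 h)
  set K : Finset (Fin M) := Finset.univ.filter fun j => D j ≤ ε with hK
  have hKcard : k₀ ≤ K.card := by
    refine hcount.trans (le_of_eq ?_)
    rw [countIn, ← ncard_coe_finset]
    congr 1
    ext j
    simp [hK]
  have hKB : K ⊆ B := fun j hj => (hmem j).2 (lt_of_le_of_lt (by simpa [hK] using hj) hiε)
  have hcard := hKcard.trans (Finset.card_le_card hKB)
  rcases hcard.eq_or_lt with hcard | hcard
  · right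
    -- Exactly `k₀` errors lie below `D i`, and they are those within `ε`. Taking the largest as
    -- threshold would leave only `k₀ - 1` below it, so `ε` serves as threshold.
    have hKB' : K = B := Finset.eq_of_subset_of_card_le hKB (by omega)
    have hε' : ∀ j, j ∈ B ↔ D j ≤ ε := fun j => by rw [← hKB']; simp [hK]
    refine ⟨i, insert i B, by rw [Finset.card_insert_of_notMem hiB, hcard], by simp, ?_⟩
    rw [Finset.erase_insert hiB]
    refine ⟨fun b hb => (hε' b).1 hb, fun j hj => ?_, hiε, fun b _ b' _ hbb' => ?_⟩
    · have : j ∉ B := fun h => by simp [h] at hj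
      exact not_le.1 fun h => this ((hε' j).2 h)
    · have := hpair b b' hbb'
      have := (hε' i').1 hi'B
      linarith
  · left
    obtain ⟨c, hc, hmax⟩ := B.exists_max_image D ⟨i', hi'B⟩
    have hci : i ≠ c := fun h => hiB (h ▸ hc)
    have hiBc : i ∉ B.erase c := fun h => hiB (Finset.mem_of_mem_erase h)
    have hcB : c ∉ insert i (B.erase c) := by simp [hci.symm]
    have hins : insert c (insert i (B.erase c)) = insert i B := by
      rw [Finset.insert_comm, Finset.insert_erase hc]
    have hcard' : (B.erase c).card + 1 = B.card := Finset.card_erase_add_one hc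
    -- If the largest error below `D i` were `0`, two of the errors in `B` would vanish and `hpair`
    -- would give `D i ≤ 0`.
    have hc0 : 0 < D c := by
      refine (hD0 c).lt_of_ne fun h0 => ?_
      obtain ⟨a, ha, b, hb, hab⟩ := Finset.one_lt_card.1 (show 1 < B.card by omega)
      have h1 := hmax a ha
      have h2 := hmax b hb
      have h3 := hmax i' hi'B
      have h4 := hpair a b hab
      linarith [hD0 i']
    refine ⟨(B.erase c).card, ?_, c, i, insert i (B.erase c),
      Finset.card_insert_of_notMem hiBc, by simp, hcB, hc0, ?_⟩
    -- Besides the counted coordinates there are `c` and `i`, hence the upper limit `M - 2`.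
    · rw [Finset.mem_Icc]
      have h1 := Finset.card_le_univ (insert i B)
      rw [Finset.card_insert_of_notMem hiB, Fintype.card_fin] at h1
      omega
    rw [Finset.erase_insert hiBc, hins]
    refine ⟨fun b hb => hmax b (Finset.mem_of_mem_erase hb), fun j hj => ?_, (hmem c).1 hc,
      fun b _ b' _ hbb' => ?_⟩
    · have hj' : j ∉ B := fun h => by simp [h] at hj
      exact ((hmem c).1 hc).trans_le (not_lt.1 fun h => hj' ((hmem j).2 h))
    · have := hpair b b' hbb'
      have := hmax i' hi'B
      linarith

end Covering

/-! ### The error bound for laws with slowly growing distribution function -/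

section GapBound

variable {Ω : Type*} [MeasurableSpace Ω] {P : Measure Ω} {M : ℕ} {γ x ε : ℝ} {ρ : Measure ℝ}
  [IsProbabilityMeasure ρ]

theorem measure_error_le (h : SlowCdf γ ρ) (hγ : 1 ≤ γ) {z : Ω → Fin M → ℝ}
    (hz : AEMeasurable (fun ω j => |z ω j - x|) P)
    (hlaw : P.map (fun ω j => |z ω j - x|) = Measure.pi fun _ => ρ)
    {v : Ω → ℝ} (hv : ∀ᵐ ω ∂P, IsGapEstimate (z ω) (v ω)) (hε : 0 < ε) {k₀ : ℕ} (hk₀ : 2 ≤ k₀) :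
    P {ω | ε < |v ω - x|} ≤ binomialLower M (ρ.real (Iic ε)) k₀ +
      (∑ k ∈ Finset.Icc k₀ (M - 2), ENNReal.ofReal ((k + 1) * gapConst γ k) +
        ENNReal.ofReal ((k₀ + 1) * gapConst γ k₀) * (M.choose (k₀ + 1) *
          (ρ (Iic ε) ^ (k₀ + 1) * ρ (Ioi ε) ^ (M - (k₀ + 1))))) := by
  set D : Ω → Fin M → ℝ := fun ω j => |z ω j - x| with hD
  have hties : ∀ᵐ ω ∂P, ¬ ∃ a b, a ≠ b ∧ 0 < D ω a ∧ D ω a = D ω b := by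
    have h1 : ∀ᵐ y ∂P.map D, ¬ ∃ a b, a ≠ b ∧ 0 < y a ∧ y a = y b := by
      rw [hlaw, ae_iff]
      simpa using measure_tie_eq_zero (ι := Fin M) h
    exact ae_of_ae_map hz h1
  have hsub : {ω | ε < |v ω - x|} ≤ᵐ[P] D ⁻¹' ({y | countIn (Iic ε) y < k₀} ∪
      ((⋃ k ∈ Finset.Icc k₀ (M - 2), someWindowAt (Fin M) k) ∪ someWindow (Fin M) ε k₀)) := by
    filter_upwards [hties, hv] with ω h1 h2 h3
    by_cases hc : countIn (Iic ε) (D ω) < k₀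
    · exact Or.inl hc
    right
    rcases mem_someWindow_of_error h2 hε h3 hk₀ (not_lt.1 hc)
      (fun a b hab ha heq => h1 ⟨a, b, hab, ha, heq⟩) with ⟨k, hk, h4⟩ | h4
    · exact Or.inl (mem_biUnion (x := k) hk h4)
    · exact Or.inr h4
  refine (measure_mono_ae hsub).trans ?_
  -- This inequality holds for arbitrary sets, so no measurability of the estimate is needed.
  refine (Measure.le_map_apply hz _).trans ?_
  rw [hlaw]
  refine (measure_union_le _ _).trans (add_le_add (le_of_eq ?_) ((measure_union_le _ _).trans
    (add_le_add ((measure_biUnion_finset_le _ _).trans ?_) ?_)))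
  · rw [measure_countIn_lt measurableSet_Iic, Fintype.card_fin]
  · exact Finset.sum_le_sum fun k hk =>
      measure_someWindowAt_le h hγ (hk₀.trans (Finset.mem_Icc.1 hk).1)
  · have := measure_someWindow_le (ι := Fin M) h hγ hε hk₀
    rwa [Fintype.card_fin] at this

/-- The additional term has the same constant as the summand `k = k₀`. It is charged to the whole
sum, each summand having room for a factor `1 + A ≤ C`. -/
lemma sum_window_bounds_le {A C : ℝ} {b : ℝ≥0∞} {k₀ n : ℕ} (hγ : 0 < γ) (hA : 0 ≤ A)
    (hn : k₀ ≤ n) (hb : b ≤ ENNReal.ofReal A) (hC : 1 + A ≤ C) {f : ℕ → ℝ≥0∞}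
    (hf : ∀ k ∈ Finset.Icc k₀ n, ENNReal.ofReal ((k + 1) * C * gapConst γ k) ≤ f k) :
    ∑ k ∈ Finset.Icc k₀ n, ENNReal.ofReal ((k + 1) * gapConst γ k) +
      ENNReal.ofReal ((k₀ + 1) * gapConst γ k₀) * b ≤ ∑ k ∈ Finset.Icc k₀ n, f k := by
  have hg : ∀ k : ℕ, 0 ≤ ((k : ℝ) + 1) * gapConst γ k := fun k =>
    mul_nonneg (by positivity) (gapConst_pos hγ k).le
  have h1 : ENNReal.ofReal ((k₀ + 1) * gapConst γ k₀) * b ≤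
      ∑ k ∈ Finset.Icc k₀ n, ENNReal.ofReal ((k + 1) * gapConst γ k) * b :=
    Finset.single_le_sum (f := fun k : ℕ => ENNReal.ofReal (((k : ℝ) + 1) * gapConst γ k) * b)
      (fun _ _ => zero_le) (Finset.mem_Icc.2 ⟨le_rfl, hn⟩)
  refine (add_le_add_right h1 _).trans ?_
  rw [← Finset.sum_add_distrib]
  refine Finset.sum_le_sum fun k hk => le_trans ?_ (hf k hk)
  calc _ ≤ ENNReal.ofReal ((k + 1) * gapConst γ k) +
        ENNReal.ofReal ((k + 1) * gapConst γ k) * ENNReal.ofReal A := by gcongr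
    _ = ENNReal.ofReal ((k + 1) * gapConst γ k + (k + 1) * gapConst γ k * A) := by
        rw [← ENNReal.ofReal_mul (hg k), ← ENNReal.ofReal_add (hg k) (mul_nonneg (hg k) hA)]
    _ ≤ _ := by
        refine ENNReal.ofReal_le_ofReal ?_
        have := mul_le_mul_of_nonneg_left hC (hg k)
        linarith

/-- The error probability of the gap estimate in terms of the constants `eta`. -/
theorem measure_error_le_eta (h : SlowCdf γ ρ) (hγ : 0 < γ) [IsProbabilityMeasure P]
    {z : Ω → Fin M → ℝ} (hz : AEMeasurable (fun ω j => |z ω j - x|) P)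
    (hlaw : P.map (fun ω j => |z ω j - x|) = Measure.pi fun _ => ρ)
    {v : Ω → ℝ} (hv : ∀ᵐ ω ∂P, IsGapEstimate (z ω) (v ω)) (hε : 0 < ε) {k₀ : ℕ} (hk₀ : 2 ≤ k₀)
    (hM : 2 * k₀ + 1 ≤ M) :
    P {ω | ε < |v ω - x|} ≤ binomialLower M (ρ.real (Iic ε)) k₀ +
      ∑ k ∈ Finset.Icc k₀ (M - 2), ENNReal.ofReal (1 + 1 / (2 * (k : ℝ))) * eta k γ 2 := by
  by_cases htriv : γ ≤ 2 ∨ (γ ≤ 4 ∧ k₀ ≤ 3)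
  · exact prob_le_one.trans ((one_le_sum_eta hγ hk₀ hM htriv).trans le_add_self)
  push Not at htriv
  obtain ⟨hγ2, hγ4⟩ := htriv
  refine (measure_error_le h (by linarith) hz hlaw hv hε hk₀).trans (add_le_add_right ?_ _)
  have hq0 : 0 ≤ ρ.real (Iic ε) := measureReal_nonneg
  have hq1 : ρ.real (Iic ε) ≤ 1 := measureReal_le_one
  have hq1' : 0 ≤ 1 - ρ.real (Iic ε) := sub_nonneg.2 hq1
  have hw : (M.choose (k₀ + 1) * (ρ (Iic ε) ^ (k₀ + 1) * ρ (Ioi ε) ^ (M - (k₀ + 1))) : ℝ≥0∞) =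
      ENNReal.ofReal (M.choose (k₀ + 1) * (ρ.real (Iic ε) ^ (k₀ + 1) *
        (1 - ρ.real (Iic ε)) ^ (M - (k₀ + 1)))) := by
    rw [ENNReal.ofReal_mul (by positivity), ENNReal.ofReal_mul (by positivity),
      ENNReal.ofReal_pow hq0, ENNReal.ofReal_pow hq1', ENNReal.ofReal_natCast, ofReal_measureReal,
      ← probReal_compl_eq_one_sub measurableSet_Iic, ofReal_measureReal, compl_Iic]
  have hM' : (2 : ℝ) * k₀ + 1 ≤ M := by exact_mod_cast hM
  have hk₀' : (2 : ℝ) ≤ k₀ := by exact_mod_cast hk₀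
  have hweight : ∀ s : ℝ, 0 ≤ s →
      s ^ 2 * (((k₀ : ℝ) + 2) * (M - k₀)) ≤ ((k₀ : ℝ) + 1) * (M - k₀ - 1) →
      (M.choose (k₀ + 1) * (ρ (Iic ε) ^ (k₀ + 1) * ρ (Ioi ε) ^ (M - (k₀ + 1))) : ℝ≥0∞) ≤
        ENNReal.ofReal (1 / (1 + 2 * s)) := by
    intro s hs h1
    rw [hw]
    refine ENNReal.ofReal_le_ofReal ?_
    rw [le_div_iff₀' (by positivity)]
    exact choose_mul_pow_le (by omega) hq0 hq1 h1
  rcases le_or_gt 4 γ with h4 | h4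
  · refine sum_window_bounds_le (A := 1 / (1 + 2 * (1 / 2))) (C := 3 / 2) hγ (by norm_num) (by omega)
      (hweight (1 / 2) (by norm_num) (by nlinarith)) (by norm_num) fun k hk => ?_
    exact le_mul_eta_of_four_le (hk₀.trans (Finset.mem_Icc.1 hk).1) h4
  · have hk4 : 4 ≤ k₀ := hγ4 h4.le
    have hk4' : (4 : ℝ) ≤ k₀ := by exact_mod_cast hk4
    -- Here `k₀ ≥ 4` allows the better ratio `s = 3/4`, thus the weight `2/5` and `C = 7/5`.
    refine sum_window_bounds_le (A := 1 / (1 + 2 * (3 / 4))) (C := 7 / 5) hγ (by norm_num) (by omega)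
      (hweight (3 / 4) (by norm_num) (by nlinarith)) (by norm_num) fun k hk => ?_
    exact le_mul_eta_of_two_le (hk4.trans (Finset.mem_Icc.1 hk).1) hγ2.le h4.le

end GapBound

end GapEstimator

/-! ### The law of the errors of the ratio statistics -/

namespace GapEstimator

section Column

variable {N : ℕ} {α : ℝ} {μ : Measure ℝ} [IsProbabilityMeasure μ] (x : Fin N → ℝ) (i : Fin N)

/-- The error of the ratio statistic of the coordinate `i` as a function of a column. -/
noncomputable def columnError (s : Fin N → ℝ) : ℝ := |(∑ t, x t * s t) / s i - x i|

lemma measurable_columnError : Measurable (columnError x i) := by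
  unfold columnError
  fun_prop

lemma measurable_sum_erase :
    Measurable fun s : Fin N → ℝ => ∑ t ∈ Finset.univ.erase i, x t * s t := by
  fun_prop

/-- The coordinates other than `i` contribute a stable variable to the measurement. -/
lemma isStableLaw_sum_erase (hμ : IsStableLaw α 1 μ) :
    IsStableLaw α (∑ t ∈ Finset.univ.erase i, |x t| ^ α)
      ((Measure.pi fun _ => μ).map fun s : Fin N → ℝ => ∑ t ∈ Finset.univ.erase i, x t * s t) := by
  refine ⟨fun u => ?_⟩
  have hind : iIndepFun (fun (t : Fin N) (s : Fin N → ℝ) => x t * s t)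
      (Measure.pi fun _ => μ) :=
    iIndepFun_pi (X := fun t y => x t * y) fun t => by fun_prop
  rw [iIndepFun.charFun_map_fun_finsetSum_eq_prod (X := fun t (s : Fin N → ℝ) => x t * s t)
    (fun t _ => ((measurable_pi_apply t).const_mul _).aemeasurable) (hind.restrict _), Finset.prod_apply, Finset.sum_mul]
  push_cast
  rw [← Finset.sum_neg_distrib, Complex.exp_sum]
  refine Finset.prod_congr rfl fun t _ => ?_
  have h1 : (Measure.pi fun _ => μ).map (fun s : Fin N → ℝ => x t * s t) =
      μ.map (fun y => x t * y) := by
    have h2 := (measurePreserving_eval (fun _ : Fin N => μ) t).map_eq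
    conv_rhs => rw [← h2]
    exact (Measure.map_map (measurable_const_mul (x t)) (measurable_pi_apply t)).symm
  rw [h1, charFun_map_mul, hμ.charFun_eq, abs_mul, Real.mul_rpow (abs_nonneg _) (abs_nonneg _)]
  push_cast
  ring_nf

lemma map_pair_eq_prod :
    (Measure.pi fun _ => μ).map
        (fun s : Fin N → ℝ => (s i, ∑ t ∈ Finset.univ.erase i, x t * s t)) =
      μ.prod ((Measure.pi fun _ => μ).map
        fun s : Fin N → ℝ => ∑ t ∈ Finset.univ.erase i, x t * s t) := by
  -- The weight `1` at `i` makes `s i` itself a member of the independent family, also when `x i =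
  -- 0`; the sum over the other indices does not see it.
  have hind : iIndepFun (fun (t : Fin N) (s : Fin N → ℝ) => (if t = i then 1 else x t) * s t)
      (Measure.pi fun _ => μ) :=
    iIndepFun_pi (X := fun t y => (if t = i then 1 else x t) * y) fun t => by fun_prop
  have h := (hind.indepFun_finsetSum_of_notMem (fun t => by fun_prop)
    (Finset.notMem_erase i Finset.univ)).symm
  have h1 : (∑ t ∈ Finset.univ.erase i, fun s : Fin N → ℝ => (if t = i then 1 else x t) * s t) =
      fun s => ∑ t ∈ Finset.univ.erase i, x t * s t := by
    ext s
    rw [Finset.sum_apply]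
    exact Finset.sum_congr rfl fun t ht => by rw [if_neg (Finset.ne_of_mem_erase ht)]
  rw [h1] at h
  simp only [if_true, one_mul] at h
  rw [indepFun_iff_map_prod_eq_prod_map_map (measurable_pi_apply i).aemeasurable
    (measurable_sum_erase x i).aemeasurable] at h
  rw [h]
  congr 1
  exact (measurePreserving_eval (fun _ : Fin N => μ) i).map_eq

/-- Almost surely `s i ≠ 0`, and then the term `x i * s i` contributes exactly `x i` to the ratio.
-/
lemma measureReal_columnError_le (hα : 0 < α) (hμ : IsStableLaw α 1 μ) (d : ℝ) :
    ((Measure.pi fun _ => μ).map (columnError x i)).real (Iic d) =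
      (μ.prod ((Measure.pi fun _ => μ).map
        fun s : Fin N → ℝ => ∑ t ∈ Finset.univ.erase i, x t * s t)).real
        {p | |p.2 / p.1| ≤ d} := by
  rw [← map_pair_eq_prod x i, measureReal_def, measureReal_def,
    Measure.map_apply (measurable_columnError x i) measurableSet_Iic,
    Measure.map_apply (by fun_prop) (measurableSet_le (by fun_prop) measurable_const)]
  congr 1
  have h0 : ∀ᵐ s ∂(Measure.pi fun _ : Fin N => μ), s i ≠ 0 := by
    have h1 : ∀ᵐ y ∂μ, y ≠ 0 := by
      rw [ae_iff]
      simpa using hμ.measure_singleton_zero hα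
    rw [← (measurePreserving_eval (fun _ : Fin N => μ) i).map_eq] at h1
    exact ae_of_ae_map (measurable_pi_apply i).aemeasurable h1
  refine measure_congr ?_
  filter_upwards [h0] with s hs
  have : (∑ t, x t * s t) / s i - x i = (∑ t ∈ Finset.univ.erase i, x t * s t) / s i := by
    rw [← Finset.add_sum_erase _ _ (Finset.mem_univ i)]
    field_simp
    ring
  change (columnError x i s ≤ d) = (|(∑ t ∈ Finset.univ.erase i, x t * s t) / s i| ≤ d)
  rw [columnError, this]

end Column

section Design

variable {Ω : Type*} [MeasurableSpace Ω] {P : Measure Ω} {N M : ℕ} {α : ℝ}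
  {S : Fin N → Fin M → Ω → ℝ}

lemma IsStableDesign.map_eq (hS : IsStableDesign P α S) (i i' : Fin N) (j j' : Fin M) :
    P.map (S i j) = P.map (S i' j') := by
  have h := hS.law i j
  have h' := hS.law i' j'
  have := h.isProbabilityMeasure
  have := h'.isProbabilityMeasure
  exact Measure.ext_of_charFun (funext fun t => by rw [h.charFun_eq, h'.charFun_eq])

/-- The columns of the design are i.i.d. vectors with i.i.d. entries. -/
lemma IsStableDesign.map_columns (hS : IsStableDesign P α S) (i : Fin N) (j : Fin M) :
    P.map (fun ω (j' : Fin M) (i' : Fin N) => S i' j' ω) =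
      Measure.pi fun _ => Measure.pi fun _ => P.map (S i j) := by
  have := (hS.law i j).isProbabilityMeasure
  have h1 : ProbabilityTheory.iIndepFun (fun p : Fin M × Fin N => S p.2 p.1) P :=
    hS.iIndepFun.precomp (g := Prod.swap) Prod.swap_injective
  have h2 := h1.map_fun_eq_pi_map fun p : Fin M × Fin N => hS.aemeasurable p.2 p.1
  have h3 : (fun p : Fin M × Fin N => P.map (S p.2 p.1)) = fun _ => P.map (S i j) :=
    funext fun p => hS.map_eq _ _ _ _
  rw [h3, ← Measure.infinitePi_eq_pi] at h2
  have h4 := Measure.infinitePi_map_curry fun (_ : Fin M) (_ : Fin N) => P.map (S i j)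
  simp only [Measure.infinitePi_eq_pi] at h4 h2
  rw [← h4, ← h2]
  exact (AEMeasurable.map_map_of_aemeasurable
    (MeasurableEquiv.curry (Fin M) (Fin N) ℝ).measurable.aemeasurable
    (aemeasurable_pi_lambda _ fun p : Fin M × Fin N => hS.aemeasurable p.2 p.1)).symm

lemma IsStableDesign.aemeasurable_columns (hS : IsStableDesign P α S) :
    AEMeasurable (fun ω (j : Fin M) (i : Fin N) => S i j ω) P :=
  aemeasurable_pi_lambda _ fun j => aemeasurable_pi_lambda _ fun i => hS.aemeasurable i j

omit [MeasurableSpace Ω] in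
lemma ratioStat_error_eq (x : Fin N → ℝ) (i : Fin N) :
    (fun ω j => |ratioStat S x i ω j - x i|) =
      (fun (c : Fin M → Fin N → ℝ) j => columnError x i (c j)) ∘ fun ω j i => S i j ω :=
  rfl

lemma measurable_columnErrors (x : Fin N → ℝ) (i : Fin N) :
    Measurable fun (c : Fin M → Fin N → ℝ) j => columnError x i (c j) :=
  measurable_pi_lambda _ fun j => (measurable_columnError x i).comp (measurable_pi_apply j)

lemma IsStableDesign.map_ratioStat_error (hS : IsStableDesign P α S) (x : Fin N → ℝ) (i : Fin N)
    (j : Fin M) :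
    P.map (fun ω j => |ratioStat S x i ω j - x i|) =
      Measure.pi fun _ => (Measure.pi fun _ => P.map (S i j)).map (columnError x i) := by
  have := (hS.law i j).isProbabilityMeasure
  have : IsProbabilityMeasure ((Measure.pi fun _ : Fin N => P.map (S i j)).map (columnError x i)) :=
    Measure.isProbabilityMeasure_map (measurable_columnError x i).aemeasurable
  rw [ratioStat_error_eq, ← AEMeasurable.map_map_of_aemeasurable
    (measurable_columnErrors x i).aemeasurable hS.aemeasurable_columns, hS.map_columns i j,
    Measure.pi_map_pi fun _ => (measurable_columnError x i).aemeasurable]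

lemma IsStandardStable.isStableLaw {μ : Measure ℝ} (h : IsStandardStable α μ) :
    IsStableLaw α 1 μ :=
  ⟨fun t => by rw [one_mul, h.charFun_eq]⟩

end Design

/-! ### Admissible pairs and attainment of the minimum -/

section Admissible

variable {M : ℕ} {α ε θ a₀ : ℝ} {k₀ : ℕ}

lemma gam_pos (hα0 : 0 < α) (hα1 : α < 1) : 0 < gam α := div_pos (by linarith) hα0

lemma Kstar_eq (hε : 0 < ε) (hθ : 0 < θ) :
    Kstar α ε θ = (θ / ε) ^ (1 / gam α) + 1 := by
  rw [Kstar, gam, one_div_div, neg_div, Real.rpow_neg (by positivity),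
    ← Real.inv_rpow (by positivity), inv_div]

lemma one_lt_Kstar (hε : 0 < ε) (hθ : 0 < θ) : 1 < Kstar α ε θ := by
  rw [Kstar_eq hε hθ]
  have : 0 < (θ / ε) ^ (1 / gam α) := by positivity
  linarith

lemma two_le_Kstar (hα0 : 0 < α) (hα1 : α < 1) (hε : 0 < ε) (hεθ : ε ≤ θ) :
    2 ≤ Kstar α ε θ := by
  have hγ := gam_pos hα0 hα1
  rw [Kstar_eq hε (hε.trans_le hεθ)]
  have : 1 ≤ (θ / ε) ^ (1 / gam α) :=
    Real.one_le_rpow ((one_le_div hε).2 hεθ) (by positivity)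
  linarith

lemma admissible_iff (hα0 : 0 < α) (hα1 : α < 1) (hε : 0 < ε) (hθ : 0 < θ) (ha : 1 < a₀)
    (hk : 2 ≤ k₀) : Admissible M α ε θ a₀ k₀ ↔ a₀ * k₀ ≤ M / Kstar α ε θ := by
  have hγ := gam_pos hα0 hα1
  have hK1 := one_lt_Kstar (α := α) hε hθ
  have hs : 0 < a₀ * k₀ := by
    have : (0 : ℝ) < k₀ := by exact_mod_cast (by omega : 0 < k₀)
    positivity
  set s := a₀ * k₀ with hs_def
  have hK : Kstar α ε θ - 1 = (θ / ε) ^ (1 / gam α) := by rw [Kstar_eq hε hθ]; ring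
  have key : s < M → (θ * (s / (M - s)) ^ gam α ≤ ε ↔ s ≤ M / Kstar α ε θ) := by
    intro hsM
    have hMs : 0 < (M : ℝ) - s := sub_pos.2 hsM
    have h1 : θ * (s / (M - s)) ^ gam α ≤ ε ↔ θ / ε ≤ ((M - s) / s) ^ gam α := by
      rw [← inv_div (M - s) s, Real.inv_rpow (by positivity), div_le_iff₀ hε,
        mul_inv_le_iff₀ (by positivity), mul_comm ε]
    have h2 : θ / ε ≤ ((M - s) / s) ^ gam α ↔ (θ / ε) ^ (1 / gam α) ≤ (M - s) / s := by
      rw [one_div]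
      exact (Real.rpow_inv_le_iff_of_pos (by positivity) (by positivity) hγ).symm
    rw [h1, h2, ← hK, le_div_iff₀ hs, le_div_iff₀ (by linarith)]
    constructor <;> intro h <;> nlinarith
  constructor
  · intro h
    exact (key h.lt).1 h.le
  · intro h
    have hsM : s < M := by
      rw [le_div_iff₀ (by linarith)] at h
      nlinarith
    exact ⟨ha, hk, hsM, (key hsM).2 h⟩

/-- The least of the bounds exists: for each `k₀` the largest admissible `a₀` is the best one. -/
lemma exists_isLeast_boundSet (hα0 : 0 < α) (hα1 : α < 1) (hε : 0 < ε) (hθ : 0 < θ)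
    (hadm : ∃ (a₀ : ℝ) (k₀ : ℕ), Admissible M α ε θ a₀ k₀) :
    ∃ G, IsLeast (boundSet M α ε θ) G := by
  have hK1 := one_lt_Kstar (α := α) hε hθ
  set K := Kstar α ε θ with hK
  have hK0 : 0 < K := by linarith
  -- The binomial term decreases in `a₀`, so for fixed `k₀` the best choice is `a₀ = M / (K k₀)`,
  -- for which `a₀ k₀ / M = 1 / K`. The condition `k K < M` says that this `a₀` exceeds `1`.
  let I : Finset ℕ := (Finset.range (M + 1)).filter fun k => 2 ≤ k ∧ k * K < M
  let g : ℕ → ℝ≥0∞ := fun k => pairBound M α (M / (K * k)) k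
  have hI : ∀ a₀ k₀, Admissible M α ε θ a₀ k₀ → k₀ ∈ I ∧ g k₀ ≤ pairBound M α a₀ k₀ := by
    intro a₀ k₀ h
    have h1 := (admissible_iff hα0 hα1 hε hθ h.one_lt h.two_le).1 h
    rw [← hK] at h1
    have hk : (0 : ℝ) < k₀ := by exact_mod_cast (by have := h.two_le; omega : 0 < k₀)
    have ha := h.one_lt
    have hs : 0 < a₀ * k₀ := by positivity
    have hM : (0 : ℝ) < M := hs.trans h.lt
    have h2 : (k₀ : ℝ) < a₀ * k₀ := by nlinarith
    rw [le_div_iff₀ hK0] at h1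
    have h3 : k₀ * K < M := lt_of_lt_of_le (mul_lt_mul_of_pos_right h2 hK0) h1
    have h4 : k₀ < M + 1 := by
      have : (k₀ : ℝ) < M := by nlinarith
      have : k₀ < M := by exact_mod_cast this
      omega
    refine ⟨by simp [I, h4, h.two_le, h3], ?_⟩
    refine add_le_add_left ?_ _
    have h5 : (M : ℝ) / (K * k₀) * k₀ / M = 1 / K := by field_simp
    rw [h5]
    refine binomialLower_antitone M k₀ (by positivity) ?_ ((div_le_one hK0).2 hK1.le)
    rw [div_le_div_iff₀ hM hK0]
    linarith
  obtain ⟨a, k, hak⟩ := hadm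
  obtain ⟨m, hm, hmin⟩ := I.exists_min_image g ⟨k, (hI a k hak).1⟩
  refine ⟨g m, ⟨M / (K * m), m, ?_, rfl⟩, ?_⟩
  · obtain ⟨-, hm2, hmK⟩ := by simpa [I] using hm
    have hm0 : (0 : ℝ) < m := by exact_mod_cast (by omega : 0 < m)
    refine (admissible_iff hα0 hα1 hε hθ ?_ hm2).2 ?_
    · rw [one_lt_div (by positivity)]
      linarith
    · rw [← hK]
      exact le_of_eq (by field_simp)
  · rintro _ ⟨a₀, k₀, h, rfl⟩
    exact (hmin k₀ (hI a₀ k₀ h).1).trans (hI a₀ k₀ h).2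

end Admissible

/-! ### The bound for the gap estimator -/

section Main

variable {Ω : Type*} [MeasurableSpace Ω] {P : Measure Ω} [IsProbabilityMeasure P] {N M : ℕ}
  {α : ℝ} {S : Fin N → Fin M → Ω → ℝ} {x : Fin N → ℝ} {ε : ℝ}

lemma theta_rpow (hα0 : 0 < α) : theta α x ^ α = ∑ t, |x t| ^ α := by
  rw [theta, ← Real.rpow_mul (Finset.sum_nonneg fun t _ => by positivity),
    one_div_mul_cancel hα0.ne', Real.rpow_one]

theorem measure_error_le_pairBound (hα0 : 0 < α) (hα1 : α < 1) (hS : IsStableDesign P α S)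
    (i : Fin N) (hε : 0 < ε) (hεθ : ε ≤ theta α x) {a₀ : ℝ} {k₀ : ℕ}
    (hadm : Admissible M α ε (theta α x) a₀ k₀) {xhat : Ω → ℝ}
    (hx : ∀ᵐ ω ∂P, IsGapEstimate (ratioStat S x i ω) (xhat ω)) :
    P {ω | ε < |xhat ω - x i|} ≤ pairBound M α a₀ k₀ := by
  have hθ : 0 < theta α x := hε.trans_le hεθ
  have hγ := gam_pos hα0 hα1
  have hK2 := two_le_Kstar hα0 hα1 hε hεθ
  have hk : (2 : ℝ) ≤ k₀ := by exact_mod_cast hadm.two_le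
  have ha := hadm.one_lt
  have hs := (admissible_iff hα0 hα1 hε hθ ha hadm.two_le).1 hadm
  have hs0 : 0 < a₀ * k₀ := by positivity
  have hM0 : (0 : ℝ) < M := hs0.trans hadm.lt
  -- Here `ε ≤ θ` enters: it gives `K* ≥ 2`, hence `2 k₀ < 2 a₀ k₀ ≤ M`.
  have hM : 2 * k₀ + 1 ≤ M := by
    rw [le_div_iff₀ (by linarith)] at hs
    have : (2 : ℝ) * k₀ < M := by nlinarith
    exact_mod_cast this
  have hM0' : 0 < M := by omega
  set μ := P.map (S i ⟨0, hM0'⟩) with hμ_def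
  have hlaw := hS.law i ⟨0, hM0'⟩
  have hμ : IsStableLaw α 1 μ := hlaw.isStableLaw
  have : IsProbabilityMeasure μ := hlaw.isProbabilityMeasure
  set ν := (Measure.pi fun _ => μ).map
    fun s : Fin N → ℝ => ∑ t ∈ Finset.univ.erase i, x t * s t with hν_def
  have : IsProbabilityMeasure ν :=
    Measure.isProbabilityMeasure_map (measurable_sum_erase x i).aemeasurable
  set ρ := (Measure.pi fun _ => μ).map (columnError x i) with hρ_def
  have : IsProbabilityMeasure ρ :=
    Measure.isProbabilityMeasure_map (measurable_columnError x i).aemeasurable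
  have hρ : ∀ d, ρ.real (Iic d) = (μ.prod ν).real {p | |p.2 / p.1| ≤ d} :=
    measureReal_columnError_le x i hα0 hμ
  obtain ⟨hslow, hlow⟩ := ratio_law hα0 hα1 (Finset.sum_nonneg fun t _ => by positivity) hμ
    (isStableLaw_sum_erase x i hμ)
  have hslow' : SlowCdf (gam α) ρ := fun c d hc hcd => by
    rw [hρ, hρ]
    exact hslow c d hc hcd
  have hlow' : 1 ≤ Kstar α ε (theta α x) * ρ.real (Iic ε) := by
    rw [hρ, Kstar_eq hε hθ]
    refine hlow ε _ hε hεθ ?_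
    rw [theta_rpow hα0]
    exact Finset.sum_le_sum_of_subset_of_nonneg (Finset.erase_subset _ _)
      fun t _ _ => by positivity
  -- Admissibility means `a₀ k₀ / M ≤ 1 / K*`, and `F(ε) ≥ 1 / K*`.
  have hq : a₀ * k₀ / M ≤ ρ.real (Iic ε) := by
    have hK0 : 0 < Kstar α ε (theta α x) := by linarith
    rw [le_div_iff₀ hK0] at hs
    rw [div_le_iff₀ hM0]
    have : 0 ≤ ρ.real (Iic ε) := measureReal_nonneg
    refine le_of_mul_le_mul_right ?_ hK0
    nlinarith
  refine (measure_error_le_eta hslow' hγ (z := ratioStat S x i) ?_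
    (hS.map_ratioStat_error x i ⟨0, hM0'⟩) hx hε hadm.two_le hM).trans (add_le_add_left ?_ _)
  · rw [ratioStat_error_eq]
    exact (measurable_columnErrors x i).comp_aemeasurable hS.aemeasurable_columns
  · exact binomialLower_antitone M k₀ (by positivity) hq measureReal_le_one

end Main

end GapEstimator
theorem mainTheorem1 {Ω : Type*} [MeasurableSpace Ω] (P : Measure Ω) [IsProbabilityMeasure P]
    {N M : ℕ} (α : ℝ) (hα0 : 0 < α) (hα1 : α < 1)
    (S : Fin N → Fin M → Ω → ℝ) (hS : GapEstimator.IsStableDesign P α S)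
    (x : Fin N → ℝ) (i : Fin N)
    (ε : ℝ) (hε : 0 < ε) (hεθ : ε ≤ GapEstimator.theta α x)
    (hadm : ∃ (a₀ : ℝ) (k₀ : ℕ), GapEstimator.Admissible M α ε (GapEstimator.theta α x) a₀ k₀) :
    (∀ (a₀ : ℝ) (k₀ : ℕ), 1 < a₀ → 2 ≤ k₀ →
      (GapEstimator.Admissible M α ε (GapEstimator.theta α x) a₀ k₀ ↔
        a₀ * k₀ ≤ M / GapEstimator.Kstar α ε (GapEstimator.theta α x))) ∧
    ∃ G : ℝ≥0∞, IsLeast (GapEstimator.boundSet M α ε (GapEstimator.theta α x)) G ∧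
      ∀ xhat : Ω → ℝ,
        (∀ᵐ ω ∂P, GapEstimator.IsGapEstimate (GapEstimator.ratioStat S x i ω) (xhat ω)) →
        P {ω | ε < |xhat ω - x i|} ≤ G := by
  have hθ : 0 < GapEstimator.theta α x := hε.trans_le hεθ
  refine ⟨fun a₀ k₀ ha hk => GapEstimator.admissible_iff hα0 hα1 hε hθ ha hk, ?_⟩
  obtain ⟨G, hG⟩ := GapEstimator.exists_isLeast_boundSet hα0 hα1 hε hθ hadm
  refine ⟨G, hG, fun xhat hx => ?_⟩
  obtain ⟨a₀, k₀, h, rfl⟩ := hG.1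
  exact GapEstimator.measure_error_le_pairBound hα0 hα1 hS i hε hεθ h hx
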